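/- Let $P_{\mathtt x}$ be a probability measure on $\mathbb{R}$ with bounded support, mean $0$ and variance $1$. For $\lambda\ge 0$ and $N\ge 1$ let $\mathbb{P}_\lambda=\mathbb{P}_{\lambda,N}$ be the joint law of the off-diagonal observations $$Y_{ij}=\sqrt{\tfrac{\lambda}{N}}\,x_i^*x_j^*+W_{ij},\qquad 1\le i<j\le N,$$ where $x_1^*,\dots,x_N^*$ are i.i.d. with law $P_{\mathtt x}$, and the $W_{ij}$ ($i<j$) are i.i.d. $\mathcal N(0,1)$ and independent of $(x_i^*)_i$ (the diagonal entries are not observed). For $r\ge0$ put $$\psi(r)=\mathbb{E}_{x^*,z}\log\int \exp\Big(\sqrt r\,zx+r\,xx^*-\tfrac r2x^2\Big)\,\mathrm dP_{\mathtt x}(x),$$ with $x^*\sim P_{\mathtt x}$ and $z\sim\mathcal N(0,1)$ independent, let $F(\lambda,q)=\psi(\lambda q)-\frac{\lambda q^2}{4}$ for $q\ge 0$, and write $q^*(\lambda)$ for the maximizer of $F(\lambda,\cdot)$ over $[0,\infty)$ whenever it exists and is unique. Let $$\lambda_c=\sup\{\lambda>0:\ q^*(\lambda)\text{ is defined and }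 q^*(\lambda)=0\}.$$ Then for every $0\le\lambda<\lambda_c$ the Kullback--Leibler divergence $D_{\mathrm{KL}}(\mathbb{P}_{\lambda,N},\mathbb{P}_{0,N})$ is finite for every $N$, and $$\lim_{N\to\infty}D_{\mathrm{KL}}(\mathbb{P}_{\lambda,N},\mathbb{P}_{0,N})=\tfrac14\big(-\log(1-\lambda)-\lambda\big).$$ -/

import Mathlib

open MeasureTheory ProbabilityTheory Filter Topology

namespace SpikedWigner

/-- The off-diagonal index pairs `(i, j)` with `i < j` of an `N × N` symmetric matrix. -/
abbrev Pairs (N : ℕ) : Type := {p : Fin N × Fin N // p.1 < p.2}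

/-- The observation `Y i j = √(lam / N) x i x j + W i j`, for `i < j`. -/
noncomputable def observation (lam : ℝ) (N : ℕ) (x : Fin N → ℝ) (W : Pairs N → ℝ) :
    Pairs N → ℝ :=
  fun p => √(lam / N) * (x p.1.1 * x p.1.2) + W p

/-- The law of the off-diagonal observations `(Y i j)` for `i < j`, when the spike has i.i.d.
entries of law `P`, and the noise entries are i.i.d. standard Gaussian and independent of the
spike. -/
noncomputable def law (P : Measure ℝ) (lam : ℝ) (N : ℕ) : Measure (Pairs N → ℝ) :=
  ((Measure.pi fun _ : Fin N => P).prod (Measure.pi fun _ : Pairs N => gaussianReal 0 1)).map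
    fun xW => observation lam N xW.1 xW.2

/-- `ψ(r) = E log ∫ exp(√r z x + r x x* - r x² / 2) dP(x)`, with `x* ∼ P` and `z ∼ N(0, 1)`
independent; the pair `s` is `(x*, z)`. -/
noncomputable def psi (P : Measure ℝ) (r : ℝ) : ℝ :=
  ∫ s : ℝ × ℝ, Real.log (∫ x, Real.exp (√r * s.2 * x + r * x * s.1 - r / 2 * x ^ 2) ∂P)
    ∂(P.prod (gaussianReal 0 1))

/-- The replica-symmetric potential `F(lam, q) = ψ(lam q) - lam q² / 4`. -/
noncomputable def rsPotential (P : Measure ℝ) (lam q : ℝ) : ℝ :=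
  psi P (lam * q) - lam * q ^ 2 / 4

/-- `q` is the unique maximizer of `F(lam, ·)` on `[0, ∞)`, that is, `q*(lam)` exists and
equals `q`. -/
def IsOptimalOverlap (P : Measure ℝ) (lam q : ℝ) : Prop :=
  0 ≤ q ∧ ∀ q' : ℝ, 0 ≤ q' → q' ≠ q → rsPotential P lam q' < rsPotential P lam q

/-- The reconstruction threshold: the supremum, in the extended reals, of the `lam > 0` with
`q*(lam) = 0`. -/
noncomputable def reconstructionThreshold (P : Measure ℝ) : EReal :=
  sSup ((fun lam : ℝ => (lam : EReal)) '' {lam : ℝ | 0 < lam ∧ IsOptimalOverlap P lam 0})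

end SpikedWigner

set_option linter.unusedSectionVars false

namespace SpikedWigner

section Growth

variable {W W' : Type*} [MeasurableSpace W] [MeasurableSpace W']

/-- Measurable functions of at most exponential growth in the size function `N`. -/
def ExpGrowth (N : W → ℝ) (f : W → ℝ) : Prop :=
  Measurable f ∧ ∃ C : ℝ, ∀ w, |f w| ≤ Real.exp (C * (1 + |N w|))

/-- Measurable positive functions whose logarithm grows at most linearly in `N`. -/
def ExpPos (N : W → ℝ) (f : W → ℝ) : Prop :=
  Measurable f ∧ ∃ C : ℝ, ∀ w, Real.exp (-(C * (1 + |N w|))) ≤ f w ∧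
    f w ≤ Real.exp (C * (1 + |N w|))

/-- All exponentials of the size function are integrable. -/
def ExpIntegrable (N : W → ℝ) (μ : Measure W) : Prop :=
  ∀ C : ℝ, Integrable (fun w => Real.exp (C * (1 + |N w|))) μ

variable {N : W → ℝ} {N' : W' → ℝ} {f g : W → ℝ}

theorem ExpGrowth.integrable {μ : Measure W} (hf : ExpGrowth N f) (hμ : ExpIntegrable N μ) :
    Integrable f μ := by
  obtain ⟨hm, C, hC⟩ := hf
  exact (hμ C).mono' hm.aestronglyMeasurable (ae_of_all _ hC)

theorem ExpIntegrable.prod_snd {μ : Measure W} [SFinite μ] (hμ : ExpIntegrable N μ)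
    (ρ : Measure W') [IsFiniteMeasure ρ] :
    ExpIntegrable (fun w : W' × W => N w.2) (ρ.prod μ) := fun C => (hμ C).comp_snd ρ

theorem exp_mul_one_add_le {C D t : ℝ} (h : C ≤ D) :
    Real.exp (C * (1 + |t|)) ≤ Real.exp (D * (1 + |t|)) := by
  gcongr

theorem ExpGrowth.of_bound (hm : Measurable f) (B : ℝ) (h : ∀ w, |f w| ≤ B) : ExpGrowth N f := by
  refine ⟨hm, B, fun w => (h w).trans ?_⟩
  have hB : 0 ≤ B := (abs_nonneg _).trans (h w)
  have h1 := Real.add_one_le_exp (B * (1 + |N w|))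
  nlinarith [abs_nonneg (N w)]

theorem ExpGrowth.const (c : ℝ) : ExpGrowth N (fun _ => c) :=
  .of_bound measurable_const |c| fun _ => le_rfl

theorem ExpGrowth.mul (hf : ExpGrowth N f) (hg : ExpGrowth N g) :
    ExpGrowth N (fun w => f w * g w) := by
  obtain ⟨hfm, C, hC⟩ := hf
  obtain ⟨hgm, D, hD⟩ := hg
  refine ⟨hfm.mul hgm, C + D, fun w => ?_⟩
  rw [abs_mul, add_mul, Real.exp_add]
  exact mul_le_mul (hC w) (hD w) (abs_nonneg _) (Real.exp_pos _).le

theorem ExpGrowth.add (hf : ExpGrowth N f) (hg : ExpGrowth N g) :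
    ExpGrowth N (fun w => f w + g w) := by
  obtain ⟨hfm, C, hC⟩ := hf
  obtain ⟨hgm, D, hD⟩ := hg
  refine ⟨hfm.add hgm, |C| + |D| + 1, fun w => ?_⟩
  have h1 := (hC w).trans (exp_mul_one_add_le (t := N w)
    (show C ≤ |C| + |D| by linarith [le_abs_self C, abs_nonneg D]))
  have h2 := (hD w).trans (exp_mul_one_add_le (t := N w)
    (show D ≤ |C| + |D| by linarith [le_abs_self D, abs_nonneg C]))
  have h3 : 2 ≤ Real.exp (1 * (1 + |N w|)) := by
    have := Real.add_one_le_exp (1 * (1 + |N w|))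
    linarith [abs_nonneg (N w)]
  rw [add_mul (|C| + |D|), Real.exp_add]
  refine (abs_add_le _ _).trans ?_
  nlinarith [Real.exp_pos ((|C| + |D|) * (1 + |N w|))]

theorem ExpGrowth.neg (hf : ExpGrowth N f) : ExpGrowth N (fun w => -f w) :=
  ⟨hf.1.neg, by simpa using hf.2⟩

theorem ExpGrowth.sub (hf : ExpGrowth N f) (hg : ExpGrowth N g) :
    ExpGrowth N (fun w => f w - g w) := by
  simpa [sub_eq_add_neg] using hf.add hg.neg

theorem ExpGrowth.pow (hf : ExpGrowth N f) (k : ℕ) : ExpGrowth N (fun w => f w ^ k) := by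
  induction k with
  | zero => simpa using ExpGrowth.const 1
  | succ k ih => simpa [pow_succ] using ih.mul hf

theorem ExpGrowth.sum {ι : Type*} (s : Finset ι) {F : ι → W → ℝ} (hF : ∀ i ∈ s, ExpGrowth N (F i)) :
    ExpGrowth N (fun w => ∑ i ∈ s, F i w) := by
  classical
  induction s using Finset.induction_on with
  | empty => simpa using ExpGrowth.const 0
  | insert i s hi ih =>
    simp only [Finset.sum_insert hi]
    exact (hF i (by simp)).add (ih fun j hj => hF j (by simp [hj]))

theorem ExpGrowth.prod {ι : Type*} (s : Finset ι) {F : ι → W → ℝ}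
    (hF : ∀ i ∈ s, ExpGrowth N (F i)) : ExpGrowth N (fun w => ∏ i ∈ s, F i w) := by
  classical
  induction s using Finset.induction_on with
  | empty => simpa using ExpGrowth.const 1
  | insert i s hi ih =>
    simp only [Finset.prod_insert hi]
    exact (hF i (by simp)).mul (ih fun j hj => hF j (by simp [hj]))

theorem ExpGrowth.mono (hf : ExpGrowth N f) (hg : Measurable g) (h : ∀ w, |g w| ≤ |f w|) :
    ExpGrowth N g :=
  ⟨hg, hf.2.imp fun _ hC w => (h w).trans (hC w)⟩

theorem ExpGrowth.comp (hf : ExpGrowth N f) {φ : W' → W} (hφ : Measurable φ)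
    (h : ∀ w, |N (φ w)| ≤ |N' w|) : ExpGrowth N' (fun w => f (φ w)) := by
  obtain ⟨hm, C, hC⟩ := hf
  refine ⟨hm.comp hφ, |C|, fun w => (hC _).trans ?_⟩
  exact Real.exp_le_exp.2 (mul_le_mul (le_abs_self C) (by linarith [h w]) (by positivity)
    (abs_nonneg _))

theorem ExpPos.growth (hf : ExpPos N f) : ExpGrowth N f := by
  obtain ⟨hm, C, hC⟩ := hf
  refine ⟨hm, C, fun w => ?_⟩
  rw [abs_of_pos ((Real.exp_pos _).trans_le (hC w).1)]
  exact (hC w).2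

theorem ExpPos.pos (hf : ExpPos N f) (w : W) : 0 < f w := by
  obtain ⟨hm, C, hC⟩ := hf
  exact (Real.exp_pos _).trans_le (hC w).1

theorem ExpPos.inv (hf : ExpPos N f) : ExpPos N (fun w => (f w)⁻¹) := by
  have hp := hf.pos
  obtain ⟨hm, C, hC⟩ := hf
  refine ⟨hm.inv, C, fun w => ⟨?_, ?_⟩⟩
  · rw [Real.exp_neg]
    exact inv_anti₀ (hp w) (hC w).2
  · rw [← inv_inv (Real.exp _), ← Real.exp_neg]
    exact inv_anti₀ (Real.exp_pos _) (hC w).1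

theorem ExpPos.log (hf : ExpPos N f) : ExpGrowth N (fun w => Real.log (f w)) := by
  have hp := hf.pos
  obtain ⟨hm, C, hC⟩ := hf
  refine ⟨hm.log, C, fun w => ?_⟩
  have h1 := Real.log_le_log (Real.exp_pos _) (hC w).1
  have h2 := Real.log_le_log (hp w) (hC w).2
  rw [Real.log_exp] at h1 h2
  have h3 := Real.add_one_le_exp (C * (1 + |N w|))
  exact (abs_le.2 ⟨by linarith, by linarith⟩ : _ ≤ C * (1 + |N w|)).trans (by linarith)

theorem ExpPos.rpow (hf : ExpPos N f) (p : ℝ) : ExpPos N (fun w => f w ^ p) := by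
  have hp := hf.pos
  obtain ⟨hm, C, hC⟩ := hf
  refine ⟨hm.pow_const p, |p| * C, fun w => ?_⟩
  have h1 := Real.log_le_log (Real.exp_pos _) (hC w).1
  have h2 := Real.log_le_log (hp w) (hC w).2
  rw [Real.log_exp] at h1 h2
  have h3 : |Real.log (f w) * p| ≤ |p| * C * (1 + |N w|) := by
    rw [abs_mul, mul_comm, mul_assoc]
    exact mul_le_mul_of_nonneg_left (abs_le.2 ⟨by linarith, by linarith⟩) (abs_nonneg _)
  simp only [Real.rpow_def_of_pos (hp w)]
  exact ⟨Real.exp_le_exp.2 (abs_le.1 h3).1, Real.exp_le_exp.2 (abs_le.1 h3).2⟩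

theorem ExpPos.comp (hf : ExpPos N f) {φ : W' → W} (hφ : Measurable φ)
    (h : ∀ w, |N (φ w)| ≤ |N' w|) : ExpPos N' (fun w => f (φ w)) := by
  obtain ⟨hm, C, hC⟩ := hf
  have hk : ∀ w, C * (1 + |N (φ w)|) ≤ |C| * (1 + |N' w|) := fun w =>
    mul_le_mul (le_abs_self C) (by linarith [h w]) (by positivity) (abs_nonneg _)
  refine ⟨hm.comp hφ, |C|, fun w => ⟨le_trans ?_ (hC _).1, (hC _).2.trans ?_⟩⟩
  · exact Real.exp_le_exp.2 (neg_le_neg (hk w))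
  · exact Real.exp_le_exp.2 (hk w)

theorem ExpGrowth.exp_of_linear (hm : Measurable f) (C : ℝ) (h : ∀ w, |f w| ≤ C * (1 + |N w|)) :
    ExpPos N (fun w => Real.exp (f w)) :=
  ⟨hm.exp, C, fun w => ⟨Real.exp_le_exp.2 (abs_le.1 (h w)).1, Real.exp_le_exp.2 (abs_le.1 (h w)).2⟩⟩

theorem ExpGrowth.integrable_section {h : W' × W → ℝ}
    (hh : ExpGrowth (fun w : W' × W => N w.2) h) (ρ : Measure W') [IsFiniteMeasure ρ] (w : W) :
    Integrable (fun z => h (z, w)) ρ := by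
  obtain ⟨hm, C, hC⟩ := hh
  exact .of_bound (hm.comp measurable_prodMk_right).aestronglyMeasurable
    (Real.exp (C * (1 + |N w|))) (ae_of_all _ fun z => hC (z, w))

theorem ExpGrowth.integral {h : W' × W → ℝ} (hh : ExpGrowth (fun w : W' × W => N w.2) h)
    (ρ : Measure W') [IsFiniteMeasure ρ] : ExpGrowth N (fun w => ∫ z, h (z, w) ∂ρ) := by
  obtain ⟨hm, C, hC⟩ := hh
  have hm' : Measurable (fun w => ∫ z, h (z, w) ∂ρ) :=
    (hm.stronglyMeasurable.integral_prod_left').measurable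
  have h2 : ∀ w, ρ.real Set.univ * Real.exp (C * (1 + |N w|)) ≤
      Real.exp ((ρ.real Set.univ + C) * (1 + |N w|)) := by
    intro w
    rw [add_mul, Real.exp_add]
    gcongr
    have := Real.add_one_le_exp (ρ.real Set.univ * (1 + |N w|))
    nlinarith [mul_nonneg (measureReal_nonneg (μ := ρ) (s := Set.univ)) (abs_nonneg (N w))]
  refine ⟨hm', ρ.real Set.univ + C, fun w => le_trans ?_ (h2 w)⟩
  have hb : ∀ z, ‖h (z, w)‖ ≤ Real.exp (C * (1 + |N w|)) := fun z => hC (z, w)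
  have := norm_integral_le_of_norm_le_const (μ := ρ) (ae_of_all _ hb)
  simpa [mul_comm] using this

theorem ExpPos.integral {h : W' × W → ℝ} (hh : ExpPos (fun w : W' × W => N w.2) h)
    (ρ : Measure W') [IsProbabilityMeasure ρ] : ExpPos N (fun w => ∫ z, h (z, w) ∂ρ) := by
  have hi := hh.growth.integrable_section ρ
  have hm := (hh.growth.integral ρ).1
  obtain ⟨-, C, hC⟩ := hh
  refine ⟨hm, C, fun w => ⟨?_, ?_⟩⟩
  · have hb : ∀ z, Real.exp (-(C * (1 + |N w|))) ≤ h (z, w) := fun z => (hC (z, w)).1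
    have := integral_mono (μ := ρ) (integrable_const _) (hi w) hb
    simpa using this
  · have hb : ∀ z, h (z, w) ≤ Real.exp (C * (1 + |N w|)) := fun z => (hC (z, w)).2
    have := integral_mono (μ := ρ) (hi w) (integrable_const _) hb
    simpa using this

end Growth

section Gaussian

open scoped NNReal

variable (K : Type*) [Fintype K]

/-- Independent centered Gaussian coordinates of variance `v`. -/
noncomputable def gaussPi (v : ℝ≥0) : Measure (K → ℝ) := Measure.pi fun _ : K => gaussianReal 0 v

instance (v : ℝ≥0) : IsProbabilityMeasure (gaussPi K v) := by
  unfold gaussPi; infer_instance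

variable {K}

/-- The `ℓ¹` norm of a noise vector. -/
def noiseSize (y : K → ℝ) : ℝ := ∑ k, |y k|

theorem expIntegrable_gaussPi (v : ℝ≥0) : ExpIntegrable noiseSize (gaussPi K v) := by
  intro C
  have h : (fun y : K → ℝ => Real.exp (C * (1 + |noiseSize y|))) =
      fun y => Real.exp C * ∏ k, Real.exp (C * |y k|) := by
    ext y
    rw [← Real.exp_sum, ← Real.exp_add, noiseSize, abs_of_nonneg (by positivity), ← Finset.mul_sum]
    ring_nf
  rw [h]
  refine Integrable.const_mul ?_ _
  refine Integrable.fintype_prod (f := fun _ t => Real.exp (C * |t|)) fun k => ?_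
  exact integrable_exp_mul_abs (integrable_exp_mul_gaussianReal C)
    (integrable_exp_mul_gaussianReal (-C))

/-- The likelihood ratio of the shift `v • a` of the noise of variance `v`. -/
noncomputable def lr (v : ℝ≥0) (a y : K → ℝ) : ℝ :=
  Real.exp (∑ k, a k * y k - v / 2 * ∑ k, a k ^ 2)

theorem lr_pos (v : ℝ≥0) (a y : K → ℝ) : 0 < lr v a y := Real.exp_pos _

@[fun_prop]
theorem measurable_lr {W : Type*} [MeasurableSpace W] (v : ℝ≥0) {a y : W → K → ℝ}
    (ha : Measurable a) (hy : Measurable y) : Measurable (fun w => lr v (a w) (y w)) := by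
  unfold lr; fun_prop

theorem expPos_lr {X : Type*} [MeasurableSpace X] (v : ℝ≥0) {a : X → K → ℝ} (ha : Measurable a)
    {A : ℝ} (hA : ∀ x k, |a x k| ≤ A) :
    ExpPos (fun w : X × (K → ℝ) => noiseSize w.2) (fun w => lr v (a w.1) w.2) := by
  unfold lr
  refine ExpGrowth.exp_of_linear (by fun_prop)
    (|A| + v / 2 * ∑ _k : K, A ^ 2) fun w => ?_
  have h1 : |∑ k, a w.1 k * w.2 k| ≤ |A| * |noiseSize w.2| := by
    rw [noiseSize, abs_of_nonneg (a := ∑ k, |w.2 k|) (by positivity), Finset.mul_sum]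
    refine (Finset.abs_sum_le_sum_abs _ _).trans (Finset.sum_le_sum fun k _ => ?_)
    rw [abs_mul]
    exact mul_le_mul_of_nonneg_right ((hA _ _).trans (le_abs_self A)) (abs_nonneg _)
  have h2 : ∑ k, a w.1 k ^ 2 ≤ ∑ _k : K, A ^ 2 :=
    Finset.sum_le_sum fun k _ => sq_le_sq.2 ((hA _ _).trans (le_abs_self A))
  have h3 : 0 ≤ ∑ k, a w.1 k ^ 2 := by positivity
  have h4 : (v : ℝ) / 2 * ∑ k, a w.1 k ^ 2 ≤ v / 2 * ∑ _k : K, A ^ 2 := by gcongr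
  have h5 : 0 ≤ (v : ℝ) / 2 * ∑ k, a w.1 k ^ 2 := by positivity
  have h6 : 0 ≤ (v : ℝ) / 2 * (∑ _k : K, A ^ 2) * |noiseSize w.2| := by positivity
  have h7 := abs_le.1 h1
  have h8 : 0 ≤ |A| := abs_nonneg A
  rw [abs_le]
  constructor <;> nlinarith

theorem integral_exp_sum_mul (v : ℝ≥0) (c : K → ℝ) :
    ∫ y, Real.exp (∑ k, c k * y k) ∂gaussPi K v = Real.exp (v / 2 * ∑ k, c k ^ 2) := by
  simp_rw [Real.exp_sum]
  rw [gaussPi, integral_fintype_prod_eq_prod (f := fun k t => Real.exp (c k * t)),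
    Finset.mul_sum, Real.exp_sum]
  refine Finset.prod_congr rfl fun k _ => ?_
  have := congrFun (mgf_id_gaussianReal (μ := 0) (v := v)) (c k)
  simp only [mgf, id] at this
  rw [this]; ring_nf

/-- The Gaussian expectation of a product of likelihood ratios. -/
theorem integral_prod_lr {R : Type*} (s : Finset R) (v : ℝ≥0) (a : R → K → ℝ) :
    ∫ y, ∏ r ∈ s, lr v (a r) y ∂gaussPi K v =
      Real.exp (v / 2 * (∑ k, (∑ r ∈ s, a r k) ^ 2 - ∑ r ∈ s, ∑ k, a r k ^ 2)) := by
  have h : ∀ y : K → ℝ, ∏ r ∈ s, lr v (a r) y =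
      Real.exp (∑ k, (∑ r ∈ s, a r k) * y k) *
        Real.exp (-(v / 2 * ∑ r ∈ s, ∑ k, a r k ^ 2)) := by
    intro y
    unfold lr
    rw [← Real.exp_sum, ← Real.exp_add, Finset.sum_sub_distrib, Finset.mul_sum, Finset.sum_comm,
      sub_eq_add_neg]
    simp_rw [Finset.sum_mul]
  simp_rw [h]
  rw [integral_mul_const, integral_exp_sum_mul, ← Real.exp_add]
  ring_nf

theorem integral_lr (v : ℝ≥0) (a : K → ℝ) : ∫ y, lr v a y ∂gaussPi K v = 1 := by
  have := integral_prod_lr (K := K) {()} v (fun _ => a)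
  simpa using this

theorem integral_lr_mul_lr (v : ℝ≥0) (a b : K → ℝ) :
    ∫ y, lr v a y * lr v b y ∂gaussPi K v = Real.exp (v * ∑ k, a k * b k) := by
  have := integral_prod_lr (K := K) Finset.univ v (fun i : Fin 2 => ![a, b] i)
  simp only [Fin.prod_univ_two, Fin.sum_univ_two, Matrix.cons_val_zero, Matrix.cons_val_one] at this
  rw [this]
  congr 1
  have h : ∑ k, (a k + b k) ^ 2 = ∑ k, a k ^ 2 + ∑ k, b k ^ 2 + 2 * ∑ k, a k * b k := by
    rw [Finset.mul_sum, ← Finset.sum_add_distrib, ← Finset.sum_add_distrib]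
    exact Finset.sum_congr rfl fun k _ => by ring
  rw [h]; ring

/-- Cameron–Martin: the density of the shifted Gaussian vector. -/
theorem gaussPi_map_add (a : K → ℝ) :
    (gaussPi K 1).map (fun y => a + y) =
      (gaussPi K 1).withDensity (fun y => ENNReal.ofReal (lr 1 a y)) := by
  have h1 : (gaussPi K 1).map (fun y => a + y) = Measure.pi fun k => gaussianReal (a k) 1 := by
    have := Measure.pi_map_pi (μ := fun _ : K => gaussianReal 0 1) (f := fun k t => a k + t)
      (fun k => by fun_prop)
    simp only [gaussianReal_map_const_add, zero_add] at this
    exact this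
  rw [h1]
  refine Measure.pi_eq fun s hs => ?_
  have hg : ∀ k, gaussianReal (a k) 1 (s k) =
      ENNReal.ofReal (∫ t in s k, Real.exp (a k * t - 1 / 2 * a k ^ 2) ∂gaussianReal 0 1) := by
    intro k
    have hi : Integrable (fun t => Real.exp (a k * t - 1 / 2 * a k ^ 2)) (gaussianReal 0 1) := by
      simp_rw [sub_eq_add_neg, Real.exp_add]
      exact (integrable_exp_mul_gaussianReal (a k)).mul_const _
    rw [ofReal_integral_eq_lintegral_ofReal hi.integrableOn (ae_of_all _ fun t => (Real.exp_pos _).le),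
      gaussianReal_apply _ one_ne_zero, gaussianReal_of_var_ne_zero _ one_ne_zero,
      restrict_withDensity (hs k), lintegral_withDensity_eq_lintegral_mul _
        (measurable_gaussianPDF _ _) (by fun_prop)]
    refine lintegral_congr fun t => ?_
    simp only [Pi.mul_apply, gaussianPDF]
    rw [← ENNReal.ofReal_mul (gaussianPDFReal_nonneg _ _ _), gaussianPDFReal, gaussianPDFReal,
      mul_assoc _ (Real.exp _) (Real.exp _), ← Real.exp_add]
    congr 3
    simp only [NNReal.coe_one]
    ring
  simp_rw [hg]
  rw [withDensity_apply _ (MeasurableSet.univ_pi hs), gaussPi, Measure.restrict_pi_pi,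
    ← ofReal_integral_eq_lintegral_ofReal]
  · rw [← ENNReal.ofReal_prod_of_nonneg fun k _ => integral_nonneg fun t => (Real.exp_pos _).le,
      ← integral_fintype_prod_eq_prod (f := fun k t => Real.exp (a k * t - 1 / 2 * a k ^ 2))]
    congr 2
    ext y
    rw [lr, ← Real.exp_sum, Finset.sum_sub_distrib, Finset.mul_sum]
    simp
  · rw [← Measure.restrict_pi_pi]
    refine Integrable.integrableOn ?_
    have := (expPos_lr (X := Unit) (K := K) 1 (a := fun _ => a) measurable_const
      (A := ∑ k, |a k|) fun _ k => Finset.single_le_sum (f := fun k => |a k|)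
        (fun _ _ => abs_nonneg _) (Finset.mem_univ k)).growth.comp
        (φ := fun y => ((), y)) (N' := noiseSize) (by fun_prop) (fun _ => le_rfl)
    exact this.integrable (expIntegrable_gaussPi 1)
  · exact ae_of_all _ fun y => (lr_pos _ _ _).le

/-- Gaussian vectors of variances `u` and `v` add up to one of variance `u + v`. -/
theorem lintegral_gaussPi_add (u v : ℝ≥0) {f : (K → ℝ) → ENNReal} (hf : Measurable f) :
    ∫⁻ y, f y ∂gaussPi K (u + v) = ∫⁻ y, ∫⁻ z, f (y + z) ∂gaussPi K v ∂gaussPi K u := by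
  have h1 : gaussPi K (u + v) = (Measure.pi fun _ : K => (gaussianReal 0 u).prod
      (gaussianReal 0 v)).map (fun w k => (w k).1 + (w k).2) := by
    have hm : (fun k : K => ((gaussianReal 0 u).prod (gaussianReal 0 v)).map
        (fun w : ℝ × ℝ => w.1 + w.2)) = fun _ => gaussianReal 0 (u + v) := by
      ext1 k
      have := gaussianReal_conv_gaussianReal (m₁ := 0) (m₂ := 0) (v₁ := u) (v₂ := v)
      rw [Measure.conv] at this
      simpa using this
    rw [gaussPi, ← hm]
    exact (Measure.pi_map_pi (μ := fun _ : K => (gaussianReal 0 u).prod (gaussianReal 0 v))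
      (f := fun k w => w.1 + w.2) fun k => by fun_prop).symm
  have h2 := (measurePreserving_arrowProdEquivProdArrow ℝ ℝ K
    (fun _ => gaussianReal 0 u) (fun _ => gaussianReal 0 v))
  have hf' : Measurable fun p : (K → ℝ) × (K → ℝ) => f (p.1 + p.2) := by fun_prop
  rw [h1, lintegral_map hf (by fun_prop), ← lintegral_prod _ hf'.aemeasurable]
  have := h2.lintegral_comp hf'
  exact this

theorem measurePreserving_gaussPi_neg (v : ℝ≥0) :
    MeasurePreserving (fun y : K → ℝ => -y) (gaussPi K v) (gaussPi K v) := by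
  refine ⟨by fun_prop, ?_⟩
  have := Measure.pi_map_pi (μ := fun _ : K => gaussianReal 0 v) (f := fun k t => -t)
      (fun k => by fun_prop)
  simp only [gaussianReal_map_neg, neg_zero] at this
  exact this

end Gaussian
end SpikedWigner

namespace SpikedWigner

section Inequalities

theorem abs_le_cube_of_second_deriv_le {g g' g'' : ℝ → ℝ} {C : ℝ} (hC : 0 ≤ C)
    (hg : ∀ x, 0 < x → HasDerivAt g (g' x) x) (hg' : ∀ x, 0 < x → HasDerivAt g' (g'' x) x)
    (h0 : g 1 = 0) (h0' : g' 1 = 0) (hb : ∀ x, 1 / 2 ≤ x → |g'' x| ≤ C * |x - 1|) {x : ℝ}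
    (hx : 1 / 2 ≤ x) : |g x| ≤ C * |x - 1| ^ 3 := by
  have hseg : ∀ x : ℝ, 1 / 2 ≤ x → ∀ t ∈ Set.uIcc 1 x, 1 / 2 ≤ t ∧ |t - 1| ≤ |x - 1| := by
    intro x hx t ht
    refine ⟨?_, Set.abs_sub_left_of_mem_uIcc ht⟩
    rcases Set.mem_uIcc.1 ht with h | h <;> linarith [h.1]
  have h1 : ∀ x, 1 / 2 ≤ x → |g' x| ≤ C * |x - 1| ^ 2 := by
    intro x hx
    have := (convex_uIcc 1 x).norm_image_sub_le_of_norm_hasDerivWithin_le (f := g') (f' := g'')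
      (C := C * |x - 1|) (x := 1) (y := x)
      (fun t ht => (hg' t (by linarith [(hseg x hx t ht).1])).hasDerivWithinAt)
      (fun t ht => (hb t (hseg x hx t ht).1).trans
        (mul_le_mul_of_nonneg_left (hseg x hx t ht).2 hC)) Set.left_mem_uIcc Set.right_mem_uIcc
    rw [h0', sub_zero, Real.norm_eq_abs, Real.norm_eq_abs] at this
    linarith
  have := (convex_uIcc 1 x).norm_image_sub_le_of_norm_hasDerivWithin_le (f := g) (f' := g')
      (C := C * |x - 1| ^ 2) (x := 1) (y := x)
      (fun t ht => (hg t (by linarith [(hseg x hx t ht).1])).hasDerivWithinAt)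
      (fun t ht => (h1 t (hseg x hx t ht).1).trans
        (mul_le_mul_of_nonneg_left (pow_le_pow_left₀ (abs_nonneg _) (hseg x hx t ht).2 2) hC))
      Set.left_mem_uIcc Set.right_mem_uIcc
  rw [h0, sub_zero, Real.norm_eq_abs, Real.norm_eq_abs] at this
  linarith

theorem one_le_eight_mul_cube {x : ℝ} (hx : x < 1 / 2) : 1 ≤ 8 * |x - 1| ^ 3 := by
  have h1 : 1 / 2 ≤ |x - 1| := by rw [abs_of_neg (by linarith)]; linarith
  have := pow_le_pow_left₀ (by norm_num) h1 3
  linarith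

theorem abs_mul_log_sub_le {x : ℝ} (hx : 0 < x) :
    |x * Real.log x - (x - 1) - (x - 1) ^ 2 / 2| ≤ 16 * |x - 1| ^ 3 := by
  by_cases hx2 : 1 / 2 ≤ x
  · have h := abs_le_cube_of_second_deriv_le
      (g := fun x => x * Real.log x - (x - 1) - (x - 1) ^ 2 / 2)
      (g' := fun x => Real.log x - (x - 1)) (g'' := fun x => x⁻¹ - 1) (C := 2) (by norm_num)
      (fun x hx => by
        have h1 := ((hasDerivAt_id x).mul (Real.hasDerivAt_log hx.ne')).sub
          ((hasDerivAt_id x).sub_const 1)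
        have h2 := h1.sub ((((hasDerivAt_id x).sub_const 1).pow 2).div_const 2)
        refine h2.congr_deriv ?_
        simp only [id]
        field_simp
        ring)
      (fun x hx => by
        have h1 := (Real.hasDerivAt_log hx.ne').sub ((hasDerivAt_id x).sub_const 1)
        exact h1)
      (by simp) (by simp) (fun x hx => by
        have hx0 : 0 < x := by linarith
        rw [show x⁻¹ - 1 = -(x⁻¹ * (x - 1)) by field_simp; ring, abs_neg, abs_mul,
          abs_of_pos (inv_pos.2 hx0)]
        refine mul_le_mul_of_nonneg_right ?_ (abs_nonneg _)
        rw [inv_le_comm₀ hx0 (by norm_num)]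
        linarith) hx2
    refine h.trans ?_
    have := pow_nonneg (abs_nonneg (x - 1)) 3
    linarith
  · push Not at hx2
    have h1 := one_le_eight_mul_cube hx2
    have h2 := Real.one_sub_inv_le_log_of_pos hx
    have h3 : Real.log x ≤ 0 := Real.log_nonpos hx.le (by linarith)
    have h4 : x - 1 ≤ x * Real.log x := by
      have := mul_le_mul_of_nonneg_left h2 hx.le
      rwa [mul_sub, mul_one, mul_inv_cancel₀ hx.ne'] at this
    have h5 : x * Real.log x ≤ 0 := mul_nonpos_of_nonneg_of_nonpos hx.le h3
    rw [abs_le]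
    constructor <;> nlinarith

theorem exists_abs_rpow_sub_le {p : ℝ} (hp : 0 < p) (hp1 : p < 1) :
    ∃ C : ℝ, 0 ≤ C ∧ ∀ x : ℝ, 0 ≤ x →
      |x ^ p - 1 - p * (x - 1) + p * (1 - p) / 2 * (x - 1) ^ 2| ≤ C * |x - 1| ^ 3 := by
  have hpp : 0 ≤ p * (1 - p) := mul_nonneg hp.le (by linarith)
  have hpp1 : p * (1 - p) ≤ 1 := by nlinarith
  refine ⟨32, by norm_num, fun x hx => ?_⟩
  by_cases hx2 : 1 / 2 ≤ x
  · have h := abs_le_cube_of_second_deriv_le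
      (g := fun x => x ^ p - 1 - p * (x - 1) + p * (1 - p) / 2 * (x - 1) ^ 2)
      (g' := fun x => p * x ^ (p - 1) - p + p * (1 - p) * (x - 1))
      (g'' := fun x => p * ((p - 1) * x ^ (p - 1 - 1)) + p * (1 - p)) (C := 32) (by norm_num)
      (fun x hx => by
        have h1 := (((Real.hasDerivAt_rpow_const (p := p) (Or.inl hx.ne')).sub_const 1).sub
          (((hasDerivAt_id x).sub_const 1).const_mul p)).add
          ((((hasDerivAt_id x).sub_const 1).pow 2).const_mul (p * (1 - p) / 2))
        refine h1.congr_deriv ?_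
        simp only [id]
        ring)
      (fun x hx => by
        have h1 := (((Real.hasDerivAt_rpow_const (p := p - 1) (Or.inl hx.ne')).const_mul p).sub_const
          p).add (((hasDerivAt_id x).sub_const 1).const_mul (p * (1 - p)))
        refine h1.congr_deriv ?_
        ring)
      (by simp) (by simp) (fun x hx => by
        have hx0 : 0 < x := by linarith
        rw [show p * ((p - 1) * x ^ (p - 1 - 1)) + p * (1 - p) =
          p * (1 - p) * (1 - x ^ (p - 2)) by ring_nf, abs_mul, abs_of_nonneg hpp]
        have key : |1 - x ^ (p - 2)| ≤ 8 * |x - 1| := by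
          rcases le_total 1 x with h | h
          · have h2 : x ^ (p - 2) ≤ 1 := Real.rpow_le_one_of_one_le_of_nonpos h (by linarith)
            have h3 : x ^ (-2 : ℝ) ≤ x ^ (p - 2) := Real.rpow_le_rpow_of_exponent_le h (by linarith)
            have h4 : x ^ (-2 : ℝ) = (x ^ 2)⁻¹ := by
              rw [Real.rpow_neg hx0.le]; norm_num
            rw [abs_of_nonneg (by linarith), abs_of_nonneg (by linarith)]
            have h5 : 1 - (x ^ 2)⁻¹ ≤ 8 * (x - 1) := by
              have : 1 - 2 * (x - 1) ≤ (x ^ 2)⁻¹ := by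
                rw [← one_div, le_div_iff₀ (by positivity)]
                nlinarith [mul_nonneg (sq_nonneg (x - 1)) (show 0 ≤ 2 * x + 1 by linarith)]
              linarith
            linarith
          · have h2 : 1 ≤ x ^ (p - 2) := Real.one_le_rpow_of_pos_of_le_one_of_nonpos hx0 h (by linarith)
            have h3 : x ^ (p - 2) ≤ x ^ (-2 : ℝ) :=
              Real.rpow_le_rpow_of_exponent_ge hx0 h (by linarith)
            have h4 : x ^ (-2 : ℝ) = (x ^ 2)⁻¹ := by
              rw [Real.rpow_neg hx0.le]; norm_num
            rw [abs_of_nonpos (by linarith), abs_of_nonpos (by linarith)]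
            have h5 : (x ^ 2)⁻¹ ≤ 1 + 8 * (1 - x) := by
              rw [inv_le_iff_one_le_mul₀ (by positivity)]
              nlinarith [mul_nonneg (sub_nonneg.2 h) (sub_nonneg.2 hx)]
            linarith
        have := mul_le_mul hpp1 key (abs_nonneg _) zero_le_one
        linarith [abs_nonneg (x - 1)]) hx2
    exact h
  · push Not at hx2
    have h1 := one_le_eight_mul_cube hx2
    have h2 := Real.rpow_nonneg hx p
    have h3 : x ^ p ≤ 1 := Real.rpow_le_one hx (by linarith) hp.le
    have h4 : 0 ≤ (x - 1) ^ 2 := sq_nonneg _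
    have h5 : (x - 1) ^ 2 ≤ 1 := by nlinarith
    have h6 := mul_le_mul hpp1 h5 h4 zero_le_one
    have h7 := mul_nonneg hpp h4
    have h8 : 0 ≤ p * (1 - x) := mul_nonneg hp.le (by linarith)
    have h9 : p * (1 - x) ≤ 1 := by nlinarith
    rw [abs_le]
    constructor <;> nlinarith

theorem abs_exp_sub_le (q : ℝ) :
    |Real.exp q - 1 - q - q ^ 2 / 2| ≤ |q| ^ 3 * Real.exp |q| := by
  have := Complex.norm_exp_sub_sum_le_norm_mul_exp (q : ℂ) 3
  rw [← Complex.ofReal_exp] at this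
  simp only [Finset.sum_range_succ, Finset.sum_range_zero, Nat.factorial] at this
  norm_cast at this
  rw [Real.norm_eq_abs, Real.norm_eq_abs] at this
  convert this using 2
  push_cast
  ring

theorem abs_exp_sub_one_sub_le (q : ℝ) :
    |Real.exp q - 1 - q| ≤ |q| ^ 2 * Real.exp |q| := by
  have := Complex.norm_exp_sub_sum_le_norm_mul_exp (q : ℂ) 2
  rw [← Complex.ofReal_exp] at this
  simp only [Finset.sum_range_succ, Finset.sum_range_zero, Nat.factorial] at this
  norm_cast at this
  rw [Real.norm_eq_abs, Real.norm_eq_abs] at this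
  convert this using 2
  push_cast
  ring

theorem abs_exp_sub_one_le (q : ℝ) : |Real.exp q - 1| ≤ |q| * Real.exp |q| := by
  have := Complex.norm_exp_sub_sum_le_norm_mul_exp (q : ℂ) 1
  rw [← Complex.ofReal_exp] at this
  simp only [Finset.sum_range_succ, Finset.sum_range_zero, Nat.factorial] at this
  norm_cast at this
  rw [Real.norm_eq_abs, Real.norm_eq_abs] at this
  convert this using 2
  · ring
  · simp

theorem five_sub_le_inv_pow {t : ℝ} (ht : 0 < t) : 5 - 4 * t ≤ (t ^ 4)⁻¹ := by
  rw [← one_div, le_div_iff₀ (by positivity)]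
  nlinarith [mul_nonneg (sq_nonneg (t - 1)) (show 0 ≤ 4 * t ^ 3 + 3 * t ^ 2 + 2 * t + 1 by positivity)]

end Inequalities
end SpikedWigner

namespace SpikedWigner

section Replicas

variable {X Ω K : Type*} [MeasurableSpace X] [MeasurableSpace Ω] [Fintype K]

theorem integral_prod_integral {Z Y R : Type*} [MeasurableSpace Z] [MeasurableSpace Y] [Fintype R]
    {N : Y → ℝ} {γ : Measure Y} [IsProbabilityMeasure γ] (hγ : ExpIntegrable N γ)
    (ρ : Measure Z) [IsProbabilityMeasure ρ] {g : R → Z × Y → ℝ}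
    (hg : ∀ r, ExpGrowth (fun w : Z × Y => N w.2) (g r)) :
    ∫ y, ∏ r, ∫ z, g r (z, y) ∂ρ ∂γ =
      ∫ z : R → Z, ∫ y, ∏ r, g r (z r, y) ∂γ ∂Measure.pi fun _ => ρ := by
  have h1 : ∀ y, ∏ r, ∫ z, g r (z, y) ∂ρ =
      ∫ z : R → Z, ∏ r, g r (z r, y) ∂Measure.pi fun _ => ρ := fun y =>
    (integral_fintype_prod_eq_prod (μ := fun _ : R => ρ) (fun r z => g r (z, y))).symm
  simp_rw [h1]
  rw [integral_integral_swap]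
  have h2 : ExpGrowth (fun w : (R → Z) × Y => N w.2) (fun w => ∏ r, g r (w.1 r, w.2)) :=
    ExpGrowth.prod _ fun r _ => (hg r).comp (φ := fun w : (R → Z) × Y => (w.1 r, w.2))
      (by fun_prop) fun _ => le_rfl
  exact (h2.integrable (hγ.prod_snd (Measure.pi fun _ : R => ρ))).swap

theorem integral_pi_prod {R : Type*} [Fintype R] (π : Measure X) (P : Measure Ω)
    [IsProbabilityMeasure π] [IsProbabilityMeasure P] {F : (R → X × Ω) → ℝ}
    (hF : Measurable F) {B : ℝ} (hB : ∀ z, |F z| ≤ B) :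
    ∫ z, F z ∂(Measure.pi fun _ => π.prod P) =
      ∫ x : R → X, ∫ ω : R → Ω, F (fun r => (x r, ω r)) ∂(Measure.pi fun _ => P)
        ∂(Measure.pi fun _ => π) := by
  have h := measurePreserving_arrowProdEquivProdArrow X Ω R (fun _ => π) (fun _ => P)
  have h2 := h.symm.integral_comp' (g := F)
  rw [← h2, integral_prod]
  · rfl
  · refine Integrable.of_bound ?_ B (ae_of_all _ fun z => hB _)
    exact (hF.comp (MeasurableEquiv.measurable _)).aestronglyMeasurable

theorem integral_pi_pair {R : Type*} [Fintype R] (π : Measure X) [IsProbabilityMeasure π]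
    {g : X × X → ℝ} (hg : Measurable g) {r s : R} (hrs : r ≠ s) :
    ∫ x : R → X, g (x r, x s) ∂(Measure.pi fun _ => π) = ∫ p, g p ∂(π.prod π) := by
  have h1 : iIndepFun (fun (i : R) (x : R → X) => x i) (Measure.pi fun _ => π) :=
    iIndepFun_pi (X := fun _ => id) (fun _ => aemeasurable_id)
  have h2 := (indepFun_iff_map_prod_eq_prod_map_map (measurable_pi_apply r).aemeasurable
    (measurable_pi_apply s).aemeasurable).1 (h1.indepFun hrs)
  have h3 : ∀ i : R, (Measure.pi fun _ : R => π).map (fun x => x i) = π := fun i =>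
    (measurePreserving_eval (fun _ : R => π) i).map_eq
  rw [h3, h3] at h2
  rw [← h2, integral_map (by fun_prop) hg.aestronglyMeasurable]

/-- Ordered pairs of distinct replicas. -/
def pairSet (R : Type*) [Fintype R] [LinearOrder R] : Finset (R × R) :=
  Finset.univ.filter fun p => p.1 < p.2

theorem sq_sum_eq {R : Type*} [Fintype R] [LinearOrder R] (b : R → ℝ) :
    (∑ r, b r) ^ 2 = ∑ r, b r ^ 2 + 2 * ∑ p ∈ pairSet R, b p.1 * b p.2 := by
  have h1 : (∑ r, b r) ^ 2 = ∑ p : R × R, b p.1 * b p.2 := by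
    rw [sq, Finset.sum_mul_sum, Fintype.sum_prod_type]
  have h2 : ∀ p : R × R, b p.1 * b p.2 = (if p.1 < p.2 then b p.1 * b p.2 else 0) +
      (if p.1 = p.2 then b p.1 * b p.2 else 0) + (if p.2 < p.1 then b p.1 * b p.2 else 0) := by
    intro p
    rcases lt_trichotomy p.1 p.2 with h | h | h
    · simp [h, h.ne, h.not_gt]
    · simp [h]
    · simp [h, h.ne', h.not_gt]
  have h3 : ∑ p : R × R, (if p.2 < p.1 then b p.1 * b p.2 else 0) =
      ∑ p : R × R, (if p.1 < p.2 then b p.1 * b p.2 else 0) := by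
    rw [← (Equiv.prodComm R R).sum_comp]
    exact Finset.sum_congr rfl fun p _ => by simp [mul_comm]
  have h4 : ∑ p : R × R, (if p.1 = p.2 then b p.1 * b p.2 else 0) = ∑ r, b r ^ 2 := by
    rw [Fintype.sum_prod_type]
    simp [sq]
  rw [h1, Finset.sum_congr rfl fun p _ => h2 p, Finset.sum_add_distrib, Finset.sum_add_distrib,
    h3, h4, pairSet, Finset.sum_filter]
  ring

/-- The Gram kernel of a field. -/
def gram (v : X → K → ℝ) (x x' : X) : ℝ := ∑ k, v x k * v x' k

/-- A bounded, centered and normalized spin variable. -/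
structure IsSpin (P : Measure Ω) (ξ : Ω → ℝ) (M : ℝ) : Prop where
  meas : Measurable ξ
  one_le : 1 ≤ M
  bound : ∀ ω, |ξ ω| ≤ M
  mean : ∫ ω, ξ ω ∂P = 0
  second : ∫ ω, ξ ω ^ 2 ∂P = 1

/-- A measurable vector field with uniformly bounded norm. -/
structure IsField (v : X → K → ℝ) (κ : ℝ) : Prop where
  meas : Measurable v
  nonneg : 0 ≤ κ
  sq_le : ∀ x, ∑ k, v x k ^ 2 ≤ κ

variable {P : Measure Ω} {ξ : Ω → ℝ} {M κ : ℝ} {v : X → K → ℝ}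

theorem IsField.abs_gram_le (hv : IsField v κ) (x x' : X) : |gram v x x'| ≤ κ := by
  have h := Finset.sum_mul_sq_le_sq_mul_sq Finset.univ (v x) (v x')
  have h1 := hv.sq_le x
  have h2 := hv.sq_le x'
  have h3 : 0 ≤ ∑ k, v x' k ^ 2 := by positivity
  refine abs_le_of_sq_le_sq ?_ hv.nonneg
  calc gram v x x' ^ 2 ≤ _ := h
    _ ≤ κ * κ := mul_le_mul h1 h2 h3 hv.nonneg
    _ = κ ^ 2 := by ring

theorem IsField.abs_le (hv : IsField v κ) (x : X) (k : K) : |v x k| ≤ κ + 1 := by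
  have h1 : v x k ^ 2 ≤ κ :=
    (Finset.single_le_sum (f := fun k => v x k ^ 2) (fun _ _ => sq_nonneg _)
      (Finset.mem_univ k)).trans (hv.sq_le x)
  have h2 := hv.nonneg
  exact abs_le_of_sq_le_sq (by nlinarith) (by linarith)

theorem IsField.measurable_gram (hv : IsField v κ) :
    Measurable (fun p : X × X => gram v p.1 p.2) := by
  have := hv.meas
  unfold gram
  fun_prop

theorem IsSpin.nonneg (hξ : IsSpin P ξ M) : 0 ≤ M := zero_le_one.trans hξ.one_le

theorem IsSpin.sq_le (hξ : IsSpin P ξ M) (ω : Ω) : ξ ω ^ 2 ≤ M ^ 2 :=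
  sq_le_sq.2 ((hξ.bound ω).trans (le_abs_self M))

/-- The field of a column with spin `ξ` and direction `v`. -/
def colField (ξ : Ω → ℝ) (v : X → K → ℝ) (z : X × Ω) : K → ℝ := fun k => ξ z.2 * v z.1 k

theorem IsSpin.isField_colField (hξ : IsSpin P ξ M) (hv : IsField v κ) :
    IsField (colField ξ v) (M ^ 2 * κ) where
  meas := by
    have := hξ.meas
    have := hv.meas
    unfold colField
    fun_prop
  nonneg := mul_nonneg (sq_nonneg _) hv.nonneg
  sq_le z := by
    simp only [colField, mul_pow, ← Finset.mul_sum]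
    exact mul_le_mul (hξ.sq_le _) (hv.sq_le _) (by positivity) (sq_nonneg _)

theorem IsField.expPos_lr (hv : IsField v κ) (s : NNReal) :
    ExpPos (fun w : X × (K → ℝ) => noiseSize w.2) (fun w => lr s (v w.1) w.2) :=
  SpikedWigner.expPos_lr s hv.meas hv.abs_le

/-- The interaction energy of replicas in a column. -/
def energy {R : Type*} [Fintype R] [LinearOrder R] (ξ : Ω → ℝ) (v : X → K → ℝ) (x : R → X)
    (ω : R → Ω) : ℝ :=
  ∑ p ∈ pairSet R, ξ (ω p.1) * ξ (ω p.2) * gram v (x p.1) (x p.2)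

theorem measurable_energy {R : Type*} [Fintype R] [LinearOrder R] (hξ : IsSpin P ξ M)
    (hv : IsField v κ) :
    Measurable (fun w : (R → X) × (R → Ω) => energy ξ v w.1 w.2) := by
  have := hξ.meas
  have hg : ∀ p : R × R, Measurable (fun w : (R → X) × (R → Ω) => gram v (w.1 p.1) (w.1 p.2)) :=
    fun p => hv.measurable_gram.comp (g := fun q : X × X => gram v q.1 q.2)
      (f := fun w : (R → X) × (R → Ω) => (w.1 p.1, w.1 p.2)) (by fun_prop)
  unfold energy
  refine Finset.measurable_sum _ fun p _ => Measurable.mul (by fun_prop) (hg p)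

theorem abs_energy_le {R : Type*} [Fintype R] [LinearOrder R] (hξ : IsSpin P ξ M)
    (x : R → X) (ω : R → Ω) :
    |energy ξ v x ω| ≤ M ^ 2 * ∑ p ∈ pairSet R, |gram v (x p.1) (x p.2)| := by
  unfold energy
  rw [Finset.mul_sum]
  refine (Finset.abs_sum_le_sum_abs _ _).trans (Finset.sum_le_sum fun p _ => ?_)
  rw [abs_mul, abs_mul, sq]
  exact mul_le_mul_of_nonneg_right (mul_le_mul (hξ.bound _) (hξ.bound _) (abs_nonneg _) hξ.nonneg)
    (abs_nonneg _)

theorem abs_energy_le_const {R : Type*} [Fintype R] [LinearOrder R] (hξ : IsSpin P ξ M)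
    (hv : IsField v κ) (x : R → X) (ω : R → Ω) :
    |energy ξ v x ω| ≤ M ^ 2 * ((pairSet R).card * κ) := by
  refine (abs_energy_le hξ x ω).trans (mul_le_mul_of_nonneg_left ?_ (sq_nonneg _))
  refine (Finset.sum_le_card_nsmul _ _ κ fun p _ => hv.abs_gram_le _ _).trans ?_
  simp

theorem integral_prod_lr_colField {R : Type*} [Fintype R] [LinearOrder R] (x : R → X)
    (ω : R → Ω) :
    ∫ y, ∏ r, lr 1 (colField ξ v (x r, ω r)) y ∂gaussPi K 1 = Real.exp (energy ξ v x ω) := by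
  rw [integral_prod_lr]
  congr 1
  have h1 : ∑ k, ∑ r, colField ξ v (x r, ω r) k ^ 2 = ∑ r, ∑ k, colField ξ v (x r, ω r) k ^ 2 :=
    Finset.sum_comm
  have h2 : ∑ k, ∑ p ∈ pairSet R, colField ξ v (x p.1, ω p.1) k * colField ξ v (x p.2, ω p.2) k =
      energy ξ v x ω := by
    rw [Finset.sum_comm]
    refine Finset.sum_congr rfl fun p _ => ?_
    rw [gram, Finset.mul_sum]
    exact Finset.sum_congr rfl fun k _ => by simp only [colField]; ring
  simp only [sq_sum_eq]
  rw [Finset.sum_add_distrib, ← Finset.mul_sum, h1, h2, NNReal.coe_one]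
  ring

theorem column_replica {R : Type*} [Fintype R] [LinearOrder R] (π : Measure X)
    [IsProbabilityMeasure π] [IsProbabilityMeasure P] (hξ : IsSpin P ξ M) (hv : IsField v κ)
    {f : R → X × Ω → ℝ} (hf : ∀ r, Measurable (f r)) {B : ℝ} (hB : ∀ r z, |f r z| ≤ B) :
    ∫ y, ∏ r, ∫ z, f r z * lr 1 (colField ξ v z) y ∂(π.prod P) ∂gaussPi K 1 =
      ∫ x : R → X, ∫ ω : R → Ω, (∏ r, f r (x r, ω r)) * Real.exp (energy ξ v x ω)
        ∂(Measure.pi fun _ => P) ∂(Measure.pi fun _ => π) := by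
  have hc := hξ.isField_colField hv
  have hg : ∀ r, ExpGrowth (fun w : (X × Ω) × (K → ℝ) => noiseSize w.2)
      (fun w => f r w.1 * lr 1 (colField ξ v w.1) w.2) := fun r =>
    (ExpGrowth.of_bound ((hf r).comp measurable_fst) B fun w => hB r w.1).mul
      (hc.expPos_lr 1).growth
  rw [integral_prod_integral (expIntegrable_gaussPi 1) (π.prod P)
    (g := fun r w => f r w.1 * lr 1 (colField ξ v w.1) w.2) hg]
  have h1 : ∀ z : R → X × Ω, ∫ y, ∏ r, (f r (z r) * lr 1 (colField ξ v (z r)) y) ∂gaussPi K 1 =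
      (∏ r, f r (z r)) * Real.exp (energy ξ v (fun r => (z r).1) (fun r => (z r).2)) := by
    intro z
    simp_rw [Finset.prod_mul_distrib]
    rw [integral_const_mul]
    congr 1
    exact integral_prod_lr_colField (fun r => (z r).1) (fun r => (z r).2)
  simp_rw [h1]
  have hm : Measurable fun z : R → X × Ω =>
      (∏ r, f r (z r)) * Real.exp (energy ξ v (fun r => (z r).1) (fun r => (z r).2)) := by
    refine Measurable.mul (Finset.measurable_prod _ fun r _ => (hf r).comp (measurable_pi_apply r))
      (Measurable.exp ?_)
    exact (measurable_energy (R := R) hξ hv).comp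
      (g := fun w : (R → X) × (R → Ω) => energy ξ v w.1 w.2)
      (f := fun z : R → X × Ω => (fun r => (z r).1, fun r => (z r).2)) (by fun_prop)
  refine integral_pi_prod π P hm
    (B := (∏ _r : R, B) * Real.exp (M ^ 2 * ((pairSet R).card * κ))) fun z => ?_
  rw [abs_mul, Finset.abs_prod, Real.abs_exp]
  refine mul_le_mul (Finset.prod_le_prod (fun _ _ => abs_nonneg _) fun r _ => hB r _)
    (Real.exp_le_exp.2 ((le_abs_self _).trans (abs_energy_le_const hξ hv _ _)))
    (Real.exp_pos _).le (Finset.prod_nonneg fun r _ => (abs_nonneg _).trans (hB r (z r)))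

/-- The expectation of a product with a centered factor vanishes. -/
theorem integral_prod_eq_zero {R : Type*} [Fintype R] [IsProbabilityMeasure P] (g : R → Ω → ℝ)
    {r : R} (hr : ∫ ω, g r ω ∂P = 0) :
    ∫ ω : R → Ω, ∏ r, g r (ω r) ∂(Measure.pi fun _ => P) = 0 := by
  rw [integral_fintype_prod_eq_prod]
  exact Finset.prod_eq_zero (Finset.mem_univ r) hr

theorem prod_pow_ite {R : Type*} [Fintype R] [DecidableEq R] (b : R → ℝ) (s : R) :
    ∏ r, b r ^ (if r = s then 1 else 0) = b s := by
  rw [Finset.prod_eq_single s (fun r _ h => by simp [h]) (by simp)]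
  simp

theorem integral_spin_pair {R : Type*} [Fintype R] [LinearOrder R] [IsProbabilityMeasure P]
    (hξ : IsSpin P ξ M) {p : R × R} (hp : p ∈ pairSet R) :
    ∫ ω : R → Ω, ξ (ω p.1) * ξ (ω p.2) ∂(Measure.pi fun _ => P) = 0 := by
  have hp' : p.1 < p.2 := by simpa [pairSet] using hp
  have h : ∀ ω : R → Ω, ξ (ω p.1) * ξ (ω p.2) =
      ∏ r, ξ (ω r) ^ ((if r = p.1 then 1 else 0) + (if r = p.2 then 1 else 0)) := by
    intro ω
    simp_rw [pow_add, Finset.prod_mul_distrib]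
    rw [prod_pow_ite (fun r => ξ (ω r)), prod_pow_ite (fun r => ξ (ω r))]
  simp_rw [h]
  exact integral_prod_eq_zero (fun r ω => ξ ω ^ ((if r = p.1 then 1 else 0) +
    (if r = p.2 then 1 else 0))) (r := p.1) (by simpa [hp'.ne] using hξ.mean)

theorem integral_spin_pair_mul {R : Type*} [Fintype R] [LinearOrder R] [IsProbabilityMeasure P]
    (hξ : IsSpin P ξ M) {p q : R × R} (hp : p ∈ pairSet R) (hq : q ∈ pairSet R) :
    ∫ ω : R → Ω, (ξ (ω p.1) * ξ (ω p.2)) * (ξ (ω q.1) * ξ (ω q.2)) ∂(Measure.pi fun _ => P) =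
      if p = q then 1 else 0 := by
  have hp' : p.1 < p.2 := by simpa [pairSet] using hp
  have hq' : q.1 < q.2 := by simpa [pairSet] using hq
  set c : R → ℕ := fun r => ((if r = p.1 then 1 else 0) + (if r = p.2 then 1 else 0)) +
      ((if r = q.1 then 1 else 0) + (if r = q.2 then 1 else 0)) with hc
  have h : ∀ ω : R → Ω, (ξ (ω p.1) * ξ (ω p.2)) * (ξ (ω q.1) * ξ (ω q.2)) =
      ∏ r, ξ (ω r) ^ c r := by
    intro ω
    simp only [hc, pow_add, Finset.prod_mul_distrib]
    rw [prod_pow_ite (fun r => ξ (ω r)), prod_pow_ite (fun r => ξ (ω r)),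
      prod_pow_ite (fun r => ξ (ω r)), prod_pow_ite (fun r => ξ (ω r))]
  simp_rw [h]
  split_ifs with hpq
  · rw [integral_fintype_prod_eq_prod (f := fun r ω => ξ ω ^ c r)]
    refine Finset.prod_eq_one fun r _ => ?_
    have : c r = 0 ∨ c r = 2 := by
      subst hpq
      simp only [hc]
      split_ifs with h1 h2
      · exact absurd (h1.symm.trans h2) hp'.ne
      all_goals simp
    rcases this with h0 | h0
    · simp [h0]
    · rw [h0]; exact hξ.second
  · obtain ⟨r, hr⟩ : ∃ r, c r = 1 := by
      by_contra! hno
      have h1 := hno p.1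
      have h2 := hno p.2
      simp only [hc, hp'.ne, hp'.ne'] at h1 h2
      apply hpq
      have e1 : p.1 = q.1 ∨ p.1 = q.2 := by
        by_contra! hcon
        simp [hcon.1, hcon.2] at h1
      have e2 : p.2 = q.1 ∨ p.2 = q.2 := by
        by_contra! hcon
        simp [hcon.1, hcon.2] at h2
      refine Prod.ext ?_ ?_
      · rcases e1 with e1 | e1
        · exact e1
        · rcases e2 with e2 | e2
          · exact absurd (e1 ▸ e2 ▸ hp') hq'.not_gt
          · exact absurd (e1.trans e2.symm) hp'.ne
      · rcases e2 with e2 | e2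
        · rcases e1 with e1 | e1
          · exact absurd (e1.trans e2.symm) hp'.ne
          · exact absurd (e1 ▸ e2 ▸ hp') hq'.not_gt
        · exact e2
    exact integral_prod_eq_zero (fun r ω => ξ ω ^ c r) (r := r) (by simpa [hr] using hξ.mean)

end Replicas
end SpikedWigner

namespace SpikedWigner

section Moments

variable {X Ω K : Type*} [MeasurableSpace X] [MeasurableSpace Ω] [Fintype K]
variable {P : Measure Ω} {ξ : Ω → ℝ} {M κ : ℝ} {v : X → K → ℝ}

theorem measurable_energy_section {R : Type*} [Fintype R] [LinearOrder R] (hξ : IsSpin P ξ M)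
    (hv : IsField v κ) (x : R → X) : Measurable (fun ω : R → Ω => energy ξ v x ω) :=
  (measurable_energy (R := R) hξ hv).comp (g := fun w : (R → X) × (R → Ω) => energy ξ v w.1 w.2)
    measurable_prodMk_left

theorem integrable_spin_pair {R : Type*} [Fintype R] [IsProbabilityMeasure P]
    (hξ : IsSpin P ξ M) (r s : R) :
    Integrable (fun ω : R → Ω => ξ (ω r) * ξ (ω s)) (Measure.pi fun _ => P) := by
  have := hξ.meas
  refine Integrable.of_bound (by fun_prop) (M * M) (ae_of_all _ fun ω => ?_)
  rw [Real.norm_eq_abs, abs_mul]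
  exact mul_le_mul (hξ.bound _) (hξ.bound _) (abs_nonneg _) hξ.nonneg

theorem integral_energy {R : Type*} [Fintype R] [LinearOrder R] [IsProbabilityMeasure P]
    (hξ : IsSpin P ξ M) (x : R → X) :
    ∫ ω, energy ξ v x ω ∂(Measure.pi fun _ : R => P) = 0 := by
  unfold energy
  rw [integral_finsetSum _ fun p _ => (integrable_spin_pair hξ p.1 p.2).mul_const _]
  refine Finset.sum_eq_zero fun p hp => ?_
  rw [integral_mul_const, integral_spin_pair hξ hp, zero_mul]

theorem integral_energy_sq {R : Type*} [Fintype R] [LinearOrder R] [IsProbabilityMeasure P]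
    (hξ : IsSpin P ξ M) (x : R → X) :
    ∫ ω, energy ξ v x ω ^ 2 ∂(Measure.pi fun _ : R => P) =
      ∑ p ∈ pairSet R, gram v (x p.1) (x p.2) ^ 2 := by
  have h : ∀ ω : R → Ω, energy ξ v x ω ^ 2 = ∑ p ∈ pairSet R, ∑ q ∈ pairSet R,
      ((ξ (ω p.1) * ξ (ω p.2)) * (ξ (ω q.1) * ξ (ω q.2))) *
        (gram v (x p.1) (x p.2) * gram v (x q.1) (x q.2)) := by
    intro ω
    rw [energy, sq, Finset.sum_mul_sum]
    exact Finset.sum_congr rfl fun p _ => Finset.sum_congr rfl fun q _ => by ring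
  have hi : ∀ p q : R × R, Integrable (fun ω : R → Ω =>
      (ξ (ω p.1) * ξ (ω p.2)) * (ξ (ω q.1) * ξ (ω q.2)) *
        (gram v (x p.1) (x p.2) * gram v (x q.1) (x q.2))) (Measure.pi fun _ => P) := by
    intro p q
    have := hξ.meas
    refine Integrable.mul_const ?_ _
    refine Integrable.of_bound (by fun_prop) ((M * M) * (M * M)) (ae_of_all _ fun ω => ?_)
    rw [Real.norm_eq_abs, abs_mul, abs_mul, abs_mul]
    have h0 := hξ.nonneg
    gcongr <;> exact hξ.bound _
  simp_rw [h]
  rw [integral_finsetSum _ fun p _ => integrable_finsetSum _ fun q _ => hi p q]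
  refine Finset.sum_congr rfl fun p hp => ?_
  rw [integral_finsetSum _ fun q _ => hi p q, Finset.sum_eq_single p]
  · rw [integral_mul_const, integral_spin_pair_mul hξ hp hp]
    simp [sq]
  · intro q hq hqp
    rw [integral_mul_const, integral_spin_pair_mul hξ hp hq]
    simp [hqp.symm]
  · exact fun h => absurd hp h

theorem integrable_pi_of_bound {R : Type*} [Fintype R] [IsProbabilityMeasure P] {f : (R → Ω) → ℝ}
    (hf : Measurable f) {B : ℝ} (hB : ∀ ω, |f ω| ≤ B) : Integrable f (Measure.pi fun _ => P) :=
  Integrable.of_bound hf.aestronglyMeasurable B (ae_of_all _ hB)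

theorem abs_integral_exp_energy_sub_le {R : Type*} [Fintype R] [LinearOrder R]
    [IsProbabilityMeasure P] (hξ : IsSpin P ξ M) (hv : IsField v κ) (x : R → X) :
    |∫ ω, Real.exp (energy ξ v x ω) ∂(Measure.pi fun _ : R => P) - 1 -
        (∑ p ∈ pairSet R, gram v (x p.1) (x p.2) ^ 2) / 2| ≤
      (M ^ 2 * ∑ p ∈ pairSet R, |gram v (x p.1) (x p.2)|) ^ 3 *
        Real.exp (M ^ 2 * ((pairSet R).card * κ)) := by
  set B := M ^ 2 * ((pairSet R).card * κ)
  have hm := measurable_energy_section (R := R) hξ hv x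
  have hb := abs_energy_le_const (R := R) hξ hv x
  have i1 : Integrable (fun ω => Real.exp (energy ξ v x ω)) (Measure.pi fun _ : R => P) :=
    integrable_pi_of_bound hm.exp (B := Real.exp B) fun ω => by
      rw [Real.abs_exp]; exact Real.exp_le_exp.2 ((le_abs_self _).trans (hb ω))
  have i2 : Integrable (fun ω => energy ξ v x ω) (Measure.pi fun _ : R => P) :=
    integrable_pi_of_bound hm hb
  have i3 : Integrable (fun ω => energy ξ v x ω ^ 2) (Measure.pi fun _ : R => P) :=
    integrable_pi_of_bound (hm.pow_const 2) (B := B ^ 2) fun ω => by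
      rw [abs_pow]; exact pow_le_pow_left₀ (abs_nonneg _) (hb ω) 2
  have h1 : ∫ ω, (Real.exp (energy ξ v x ω) - 1 - energy ξ v x ω - energy ξ v x ω ^ 2 / 2)
      ∂(Measure.pi fun _ : R => P) = ∫ ω, Real.exp (energy ξ v x ω) ∂(Measure.pi fun _ : R => P)
        - 1 - (∑ p ∈ pairSet R, gram v (x p.1) (x p.2) ^ 2) / 2 := by
    have i4 : Integrable (fun ω => Real.exp (energy ξ v x ω) - 1) (Measure.pi fun _ : R => P) :=
      i1.sub (integrable_const _)
    have i5 : Integrable (fun ω => Real.exp (energy ξ v x ω) - 1 - energy ξ v x ω)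
      (Measure.pi fun _ : R => P) := i4.sub i2
    rw [integral_sub i5 (i3.div_const 2), integral_sub i4 i2, integral_sub i1 (integrable_const _),
      integral_div, integral_energy hξ, integral_energy_sq hξ]
    simp
  rw [← h1, ← Real.norm_eq_abs]
  refine (norm_integral_le_of_norm_le_const (C := (M ^ 2 * ∑ p ∈ pairSet R,
    |gram v (x p.1) (x p.2)|) ^ 3 * Real.exp B) (ae_of_all _ fun ω => ?_)).trans (by simp)
  refine (abs_exp_sub_le _).trans ?_
  gcongr
  · exact abs_energy_le hξ x ω
  · exact hb ω

theorem cube_sum_le {ι : Type*} (s : Finset ι) {f : ι → ℝ} (hf : ∀ i, 0 ≤ f i) (n : ℕ) :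
    (∑ i ∈ s, f i) ^ (n + 1) ≤ (s.card : ℝ) ^ n * ∑ i ∈ s, f i ^ (n + 1) := by
  rcases s.eq_empty_or_nonempty with rfl | hs
  · simp
  have h := pow_sum_div_card_le_sum_pow (s := s) (f := f) (fun i _ => hf i) n
  rw [div_le_iff₀ (by have := hs.card_pos; positivity)] at h
  linarith

/-- The absolute moments of the Gram kernel under two independent samples. -/
noncomputable def gramMoment (v : X → K → ℝ) (π : Measure X) (k : ℕ) : ℝ :=
  ∫ p, |gram v p.1 p.2| ^ k ∂(π.prod π)

theorem gramMoment_nonneg (π : Measure X) (k : ℕ) : 0 ≤ gramMoment v π k :=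
  integral_nonneg fun _ => by positivity

variable (π : Measure X) [IsProbabilityMeasure π]

theorem integrable_gram_replica {R : Type*} [Fintype R] (hv : IsField v κ) (k : ℕ) (r s : R) :
    Integrable (fun x : R → X => |gram v (x r) (x s)| ^ k) (Measure.pi fun _ => π) := by
  refine integrable_pi_of_bound (B := κ ^ k) ?_ fun x => ?_
  · exact ((hv.measurable_gram.comp (g := fun q : X × X => gram v q.1 q.2)
      (f := fun w : R → X => (w r, w s)) (by fun_prop)).abs).pow_const k
  · rw [abs_pow, abs_abs]
    exact pow_le_pow_left₀ (abs_nonneg _) (hv.abs_gram_le _ _) k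

theorem integral_gram_replica {R : Type*} [Fintype R] (hv : IsField v κ) (k : ℕ) {r s : R}
    (hrs : r ≠ s) :
    ∫ x : R → X, |gram v (x r) (x s)| ^ k ∂(Measure.pi fun _ => π) = gramMoment v π k :=
  integral_pi_pair π (g := fun p => |gram v p.1 p.2| ^ k)
    ((hv.measurable_gram.abs).pow_const k) hrs

theorem integral_sum_gram {R : Type*} [Fintype R] [LinearOrder R] (hv : IsField v κ) (k : ℕ) :
    ∫ x : R → X, ∑ p ∈ pairSet R, |gram v (x p.1) (x p.2)| ^ k ∂(Measure.pi fun _ => π) =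
      (pairSet R).card * gramMoment v π k := by
  rw [integral_finsetSum _ fun p _ => integrable_gram_replica π hv k p.1 p.2,
    Finset.sum_congr rfl fun p hp => integral_gram_replica π hv k
      (show p.1 ≠ p.2 from (by simpa [pairSet] using hp : p.1 < p.2).ne)]
  simp

theorem integrable_sum_gram {R : Type*} [Fintype R] [LinearOrder R] (hv : IsField v κ) (k : ℕ) :
    Integrable (fun x : R → X => ∑ p ∈ pairSet R, |gram v (x p.1) (x p.2)| ^ k)
      (Measure.pi fun _ => π) :=
  integrable_finsetSum _ fun p _ => integrable_gram_replica π hv k p.1 p.2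

/-- The likelihood ratio of a column given a prior `π` on the other spins. -/
noncomputable def col (P : Measure Ω) (ξ : Ω → ℝ) (v : X → K → ℝ) (π : Measure X) (y : K → ℝ) : ℝ :=
  ∫ z, lr 1 (colField ξ v z) y ∂(π.prod P)

variable [IsProbabilityMeasure P]

theorem expPos_col (hξ : IsSpin P ξ M) (hv : IsField v κ) :
    ExpPos noiseSize (col P ξ v π) :=
  ((hξ.isField_colField hv).expPos_lr 1).integral (π.prod P)

theorem measurable_integral_pi_section {R : Type*} [Fintype R] {f : (R → X) × (R → Ω) → ℝ}
    (hf : Measurable f) :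
    Measurable fun x => ∫ ω, f (x, ω) ∂(Measure.pi fun _ : R => P) :=
  hf.stronglyMeasurable.integral_prod_right'.measurable

theorem column_moment (hξ : IsSpin P ξ M) (hv : IsField v κ) (j : ℕ) :
    |∫ y, col P ξ v π y ^ j ∂gaussPi K 1 - 1 - (pairSet (Fin j)).card / 2 * gramMoment v π 2| ≤
      M ^ 6 * (pairSet (Fin j)).card ^ 3 * Real.exp (M ^ 2 * ((pairSet (Fin j)).card * κ)) *
        gramMoment v π 3 := by
  set c : ℝ := ((pairSet (Fin j)).card : ℝ)
  have h1 := column_replica (R := Fin j) (f := fun _ _ => 1) π hξ hv (fun _ => measurable_const)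
    (B := 1) (fun _ _ => by simp)
  simp only [one_mul, Finset.prod_const, Finset.card_univ, Fintype.card_fin, one_pow] at h1
  change ∫ y, col P ξ v π y ^ j ∂gaussPi K 1 = _ at h1
  rw [h1]
  have hm : Measurable fun x => ∫ ω, Real.exp (energy ξ v x ω) ∂(Measure.pi fun _ : Fin j => P) :=
    measurable_integral_pi_section (measurable_energy (R := Fin j) hξ hv).exp
  have hb : ∀ x : Fin j → X, |∫ ω, Real.exp (energy ξ v x ω) ∂(Measure.pi fun _ : Fin j => P)| ≤
      Real.exp (M ^ 2 * (c * κ)) := fun x => by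
    rw [← Real.norm_eq_abs]
    refine (norm_integral_le_of_norm_le_const (C := Real.exp (M ^ 2 * (c * κ)))
      (ae_of_all _ fun ω => ?_)).trans (by simp)
    rw [Real.norm_eq_abs, Real.abs_exp]
    exact Real.exp_le_exp.2 ((le_abs_self _).trans (abs_energy_le_const hξ hv x ω))
  have i1 : Integrable (fun x => ∫ ω, Real.exp (energy ξ v x ω) ∂(Measure.pi fun _ : Fin j => P))
    (Measure.pi fun _ => π) := integrable_pi_of_bound hm hb
  have i2 := integrable_sum_gram (R := Fin j) π hv 2
  have i3 := integrable_sum_gram (R := Fin j) π hv 3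
  have h2 : ∫ x : Fin j → X, (∫ ω, Real.exp (energy ξ v x ω) ∂(Measure.pi fun _ : Fin j => P) - 1
      - (∑ p ∈ pairSet (Fin j), |gram v (x p.1) (x p.2)| ^ 2) / 2) ∂(Measure.pi fun _ => π) =
      ∫ x : Fin j → X, ∫ ω, Real.exp (energy ξ v x ω) ∂(Measure.pi fun _ : Fin j => P)
        ∂(Measure.pi fun _ => π) - 1 - c / 2 * gramMoment v π 2 := by
    have i4 : Integrable (fun x => ∫ ω, Real.exp (energy ξ v x ω) ∂(Measure.pi fun _ : Fin j => P)
      - 1) (Measure.pi fun _ => π) := i1.sub (integrable_const _)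
    rw [integral_sub i4 (i2.div_const 2), integral_sub i1 (integrable_const _), integral_div, integral_sum_gram π hv]
    simp
    ring
  rw [← h2, ← Real.norm_eq_abs]
  have h3 := norm_integral_le_of_norm_le (μ := Measure.pi fun _ : Fin j => π)
    (f := fun x => ∫ ω, Real.exp (energy ξ v x ω) ∂(Measure.pi fun _ : Fin j => P) - 1
      - (∑ p ∈ pairSet (Fin j), |gram v (x p.1) (x p.2)| ^ 2) / 2)
    (i3.const_mul (M ^ 6 * c ^ 2 * Real.exp (M ^ 2 * (c * κ)))) (ae_of_all _ fun x => by
      rw [Real.norm_eq_abs]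
      simp only [sq_abs]
      refine (abs_integral_exp_energy_sub_le hξ hv x).trans ?_
      have h4 := cube_sum_le (pairSet (Fin j)) (f := fun p => |gram v (x p.1) (x p.2)|)
        (fun _ => abs_nonneg _) 2
      have h5 : 0 ≤ M ^ 6 * Real.exp (M ^ 2 * (c * κ)) :=
        mul_nonneg (pow_nonneg hξ.nonneg 6) (Real.exp_pos _).le
      have h6 := mul_le_mul_of_nonneg_left h4 h5
      rw [mul_pow, ← pow_mul]
      refine le_of_eq_of_le ?_ (h6.trans (le_of_eq ?_)) <;> norm_num <;> ring)
  refine h3.trans (le_of_eq ?_)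
  rw [integral_const_mul, integral_sum_gram π hv]
  ring

end Moments
end SpikedWigner

namespace SpikedWigner

section Column

variable {X Ω K : Type*} [MeasurableSpace X] [MeasurableSpace Ω] [Fintype K]
variable {P : Measure Ω} {ξ : Ω → ℝ} {M κ : ℝ} {v : X → K → ℝ}
variable (π : Measure X) [IsProbabilityMeasure π] [IsProbabilityMeasure P]

/-- A constant controlling all column estimates. -/
noncomputable def colConst (M κ : ℝ) : ℝ := 216 * M ^ 12 * Real.exp (10 * M ^ 2 * κ)

theorem colConst_ge {M κ c : ℝ} (hM : 1 ≤ M) (hκ : 0 ≤ κ) {j : ℕ} (hj : j ≤ 12) (hc : c ≤ 10) :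
    216 * M ^ j * Real.exp (c * M ^ 2 * κ) ≤ colConst M κ := by
  unfold colConst
  have h1 : M ^ j ≤ M ^ 12 := pow_le_pow_right₀ hM hj
  have h2 : c * M ^ 2 * κ ≤ 10 * M ^ 2 * κ := by
    have : 0 ≤ M ^ 2 * κ := by positivity
    nlinarith
  have h3 : 0 ≤ M ^ j := by positivity
  exact mul_le_mul (by linarith) (Real.exp_le_exp.2 h2) (Real.exp_pos _).le (by positivity)

theorem one_le_colConst {M κ : ℝ} (hM : 1 ≤ M) (hκ : 0 ≤ κ) : 1 ≤ colConst M κ := by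
  have h := colConst_ge (c := 0) hM hκ (j := 0) (by norm_num) (by norm_num)
  norm_num at h
  linarith

theorem column_moment_le (hξ : IsSpin P ξ M) (hv : IsField v κ) {j : ℕ} (hj : j ≤ 4) :
    |∫ y, col P ξ v π y ^ j ∂gaussPi K 1 - 1 - (pairSet (Fin j)).card / 2 * gramMoment v π 2| ≤
      colConst M κ * gramMoment v π 3 := by
  refine (column_moment π hξ hv j).trans
    (mul_le_mul_of_nonneg_right ?_ (gramMoment_nonneg π 3))
  have hM := hξ.one_le
  have hκ := hv.nonneg
  have hc : ((pairSet (Fin j)).card : ℝ) ≤ 6 := by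
    have : (pairSet (Fin j)).card ≤ 6 := by interval_cases j <;> decide
    exact_mod_cast this
  refine le_trans ?_ (colConst_ge (c := 6) hM hκ (j := 6) (by norm_num) (by norm_num))
  have h1 : ((pairSet (Fin j)).card : ℝ) ^ 3 ≤ 6 ^ 3 := pow_le_pow_left₀ (by positivity) hc 3
  have h2 : M ^ 2 * ((pairSet (Fin j)).card * κ) ≤ 6 * M ^ 2 * κ := by
    have : 0 ≤ M ^ 2 * κ := by positivity
    nlinarith
  have h3 : 0 ≤ M ^ 6 := by positivity
  refine mul_le_mul ?_ (Real.exp_le_exp.2 h2) (Real.exp_pos _).le (by positivity)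
  nlinarith

theorem integral_col (hξ : IsSpin P ξ M) (hv : IsField v κ) :
    ∫ y, col P ξ v π y ∂gaussPi K 1 = 1 := by
  have h := column_moment π hξ hv 1
  have hc : (pairSet (Fin 1)).card = 0 := by decide
  simp only [hc, pow_one, Nat.cast_zero] at h
  norm_num at h
  linarith

theorem col_growth (hξ : IsSpin P ξ M) (hv : IsField v κ) : ExpGrowth noiseSize (col P ξ v π) :=
  (expPos_col π hξ hv).growth

theorem col_sub_growth (hξ : IsSpin P ξ M) (hv : IsField v κ) :
    ExpGrowth noiseSize (fun y => col P ξ v π y - 1) :=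
  (col_growth π hξ hv).sub (.const 1)

theorem ExpGrowth.integrable_gauss {f : (K → ℝ) → ℝ} (hf : ExpGrowth noiseSize f) :
    Integrable f (gaussPi K 1) := hf.integrable (expIntegrable_gaussPi 1)

theorem column_sq (hξ : IsSpin P ξ M) (hv : IsField v κ) :
    |∫ y, (col P ξ v π y - 1) ^ 2 ∂gaussPi K 1 - gramMoment v π 2 / 2| ≤
      colConst M κ * gramMoment v π 3 := by
  have h := column_moment_le π hξ hv (j := 2) (by norm_num)
  have hc : (pairSet (Fin 2)).card = 1 := by decide
  have hg := col_growth π hξ hv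
  have e : ∫ y, (col P ξ v π y - 1) ^ 2 ∂gaussPi K 1 = ∫ y, col P ξ v π y ^ 2 ∂gaussPi K 1 - 1 := by
    have : ∀ y, (col P ξ v π y - 1) ^ 2 = col P ξ v π y ^ 2 - (2 * col P ξ v π y - 1) := fun y => by
      ring
    simp_rw [this]
    have i1 : Integrable (fun y => 2 * col P ξ v π y - 1) (gaussPi K 1) :=
      (((ExpGrowth.const 2).mul hg).sub (.const 1)).integrable_gauss
    rw [integral_sub (hg.pow 2).integrable_gauss i1,
      integral_sub (hg.integrable_gauss.const_mul 2) (integrable_const _), integral_const_mul,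
      integral_col π hξ hv]
    norm_num
  rw [e]
  simp only [hc] at h
  convert h using 2
  push_cast
  ring

theorem column_four (hξ : IsSpin P ξ M) (hv : IsField v κ) :
    ∫ y, (col P ξ v π y - 1) ^ 4 ∂gaussPi K 1 ≤ 11 * colConst M κ * gramMoment v π 3 := by
  have h2 := abs_le.1 (column_moment_le π hξ hv (j := 2) (by norm_num))
  have h3 := abs_le.1 (column_moment_le π hξ hv (j := 3) (by norm_num))
  have h4 := abs_le.1 (column_moment_le π hξ hv (j := 4) (by norm_num))
  have c2 : (pairSet (Fin 2)).card = 1 := by decide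
  have c3 : (pairSet (Fin 3)).card = 3 := by decide
  have c4 : (pairSet (Fin 4)).card = 6 := by decide
  have hg := col_growth π hξ hv
  have e : ∫ y, (col P ξ v π y - 1) ^ 4 ∂gaussPi K 1 = ∫ y, col P ξ v π y ^ 4 ∂gaussPi K 1 -
      4 * ∫ y, col P ξ v π y ^ 3 ∂gaussPi K 1 + 6 * ∫ y, col P ξ v π y ^ 2 ∂gaussPi K 1 - 3 := by
    have : ∀ y, (col P ξ v π y - 1) ^ 4 = col P ξ v π y ^ 4 - 4 * col P ξ v π y ^ 3 +
        6 * col P ξ v π y ^ 2 - (4 * col P ξ v π y - 1) := fun y => by ring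
    simp_rw [this]
    have g3 := (ExpGrowth.const 4).mul (hg.pow 3)
    have g2 := (ExpGrowth.const 6).mul (hg.pow 2)
    have i1 : Integrable (fun y => 4 * col P ξ v π y - 1) (gaussPi K 1) :=
      (((ExpGrowth.const 4).mul hg).sub (.const 1)).integrable_gauss
    rw [integral_sub (((hg.pow 4).sub g3).add g2).integrable_gauss i1,
      integral_add ((hg.pow 4).sub g3).integrable_gauss g2.integrable_gauss,
      integral_sub (hg.pow 4).integrable_gauss g3.integrable_gauss,
      integral_sub (hg.integrable_gauss.const_mul 4) (integrable_const _), integral_const_mul,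
      integral_const_mul, integral_const_mul, integral_col π hξ hv]
    norm_num
  rw [e]
  simp only [c2, c3, c4] at h2 h3 h4
  push_cast at h2 h3 h4
  linarith [h2.1, h2.2, h3.1, h3.2, h4.1, h4.2]

theorem lr_pow_inv_eq (a y : K → ℝ) :
    (lr 1 a y ^ 4)⁻¹ = Real.exp (10 * ∑ k, a k ^ 2) * lr 1 (fun k => -4 * a k) y := by
  rw [lr, lr, ← Real.exp_nat_mul, ← Real.exp_neg, ← Real.exp_add]
  congr 1
  have h1 : ∑ k, -4 * a k * y k = -4 * ∑ k, a k * y k := by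
    rw [Finset.mul_sum]; exact Finset.sum_congr rfl fun k _ => by ring
  have h2 : ∑ k, (-4 * a k) ^ 2 = 16 * ∑ k, a k ^ 2 := by
    rw [Finset.mul_sum]; exact Finset.sum_congr rfl fun k _ => by ring
  rw [h1, h2, NNReal.coe_one]
  push_cast
  ring

theorem column_inv_four (hξ : IsSpin P ξ M) (hv : IsField v κ) :
    ∫ y, (col P ξ v π y ^ 4)⁻¹ ∂gaussPi K 1 ≤ colConst M κ := by
  have hc := hξ.isField_colField hv
  have hpos := hc.expPos_lr 1
  have hinv : ExpGrowth (fun w : (X × Ω) × (K → ℝ) => noiseSize w.2)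
      (fun w => (lr 1 (colField ξ v w.1) w.2 ^ 4)⁻¹) := by
    simpa using hpos.inv.growth.pow 4
  have h1 : ∀ y, (col P ξ v π y ^ 4)⁻¹ ≤ ∫ z, (lr 1 (colField ξ v z) y ^ 4)⁻¹ ∂(π.prod P) := by
    intro y
    have ha := (expPos_col π hξ hv).pos y
    set a := col P ξ v π y with haa
    have i1 : Integrable (fun z => lr 1 (colField ξ v z) y) (π.prod P) :=
      hpos.growth.integrable_section (π.prod P) y
    have i2 : Integrable (fun z => (lr 1 (colField ξ v z) y ^ 4)⁻¹) (π.prod P) :=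
      hinv.integrable_section (π.prod P) y
    have i3 : Integrable (fun z => (a ^ 4)⁻¹ * (5 - 4 / a * lr 1 (colField ξ v z) y)) (π.prod P) :=
      ((integrable_const _).sub (i1.const_mul _)).const_mul _
    have h := integral_mono i3 i2 fun z => by
      have hl := lr_pos 1 (colField ξ v z) y
      have := five_sub_le_inv_pow (div_pos hl ha)
      simp only
      rw [div_pow, inv_div] at this
      calc (a ^ 4)⁻¹ * (5 - 4 / a * lr 1 (colField ξ v z) y)
          = (a ^ 4)⁻¹ * (5 - 4 * (lr 1 (colField ξ v z) y / a)) := by ring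
        _ ≤ (a ^ 4)⁻¹ * (a ^ 4 / lr 1 (colField ξ v z) y ^ 4) :=
          mul_le_mul_of_nonneg_left this (by positivity)
        _ = (lr 1 (colField ξ v z) y ^ 4)⁻¹ := by field_simp
    refine le_of_eq_of_le ?_ h
    rw [integral_const_mul, integral_sub (integrable_const _) (i1.const_mul _), integral_const_mul]
    change _ = (a ^ 4)⁻¹ * (_ - 4 / a * a)
    rw [div_mul_cancel₀ _ ha.ne']
    norm_num
  have h2 : ∫ y, (∫ z, (lr 1 (colField ξ v z) y ^ 4)⁻¹ ∂(π.prod P)) ∂gaussPi K 1 ≤ colConst M κ := by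
    rw [← integral_integral_swap
      (f := fun z y => (lr 1 (colField ξ v z) y ^ 4)⁻¹)
      (hinv.integrable ((expIntegrable_gaussPi 1).prod_snd _))]
    have h3 : ∀ z, ∫ y, (lr 1 (colField ξ v z) y ^ 4)⁻¹ ∂gaussPi K 1 =
        Real.exp (10 * ∑ k, colField ξ v z k ^ 2) := fun z => by
      simp_rw [lr_pow_inv_eq]
      rw [integral_const_mul, integral_lr, mul_one]
    simp_rw [h3]
    have h4 : ∀ z : X × Ω, ‖Real.exp (10 * ∑ k, colField ξ v z k ^ 2)‖ ≤ colConst M κ := by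
      intro z
      rw [Real.norm_eq_abs, Real.abs_exp]
      refine le_trans (Real.exp_le_exp.2 (?_ : _ ≤ 10 * M ^ 2 * κ)) ?_
      · linarith [hc.sq_le z]
      · have := colConst_ge (c := 10) hξ.one_le hv.nonneg (j := 0) (by norm_num) le_rfl
        have h5 := Real.exp_pos (10 * M ^ 2 * κ)
        linarith
    have := norm_integral_le_of_norm_le_const (μ := π.prod P) (ae_of_all _ h4)
    rw [probReal_univ, mul_one] at this
    exact (le_abs_self _).trans this
  refine le_trans (integral_mono ?_ ?_ h1) h2
  · have : ExpGrowth noiseSize (fun y => (col P ξ v π y ^ 4)⁻¹) := by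
      simpa using (expPos_col π hξ hv).inv.growth.pow 4
    exact this.integrable_gauss
  · exact (hinv.integral (π.prod P)).integrable_gauss

theorem abs_cube_le {θ : ℝ} (hθ : 0 < θ) (b : ℝ) : |b| ^ 3 ≤ (θ * b ^ 2 + b ^ 4 / θ) / 2 := by
  have h1 : |b| ^ 3 = |b| * b ^ 2 := by rw [← sq_abs b]; ring
  have h2 : b ^ 4 / θ = |b| ^ 2 / θ * b ^ 2 := by rw [sq_abs]; ring
  have h3 : |b| ≤ (θ + |b| ^ 2 / θ) / 2 := by
    have : 0 ≤ (θ - |b|) ^ 2 / θ := by positivity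
    have e : (θ - |b|) ^ 2 / θ = θ - 2 * |b| + |b| ^ 2 / θ := by
      field_simp
      ring
    linarith
  rw [h1, h2]
  nlinarith [mul_le_mul_of_nonneg_right h3 (sq_nonneg b)]

theorem column_kl (hξ : IsSpin P ξ M) (hv : IsField v κ) {θ : ℝ} (hθ : 0 < θ) (hθ1 : θ ≤ 1) :
    |∫ y, col P ξ v π y * Real.log (col P ξ v π y) ∂gaussPi K 1 - gramMoment v π 2 / 4| ≤
      100 * colConst M κ * (θ * gramMoment v π 2 + gramMoment v π 3 / θ) := by
  have hpos := expPos_col π hξ hv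
  have hg := col_growth π hξ hv
  have hb := col_sub_growth π hξ hv
  have hlog := hg.mul hpos.log
  have hq : ExpGrowth noiseSize (fun y => (col P ξ v π y - 1) ^ 2 / 2) := by
    simpa [div_eq_mul_inv] using (hb.pow 2).mul (.const 2⁻¹)
  have hl1 := hlog.sub hb
  have e1 : ∫ y, (col P ξ v π y * Real.log (col P ξ v π y) - (col P ξ v π y - 1) -
      (col P ξ v π y - 1) ^ 2 / 2) ∂gaussPi K 1 =
      ∫ y, col P ξ v π y * Real.log (col P ξ v π y) ∂gaussPi K 1 -
        (∫ y, (col P ξ v π y - 1) ^ 2 ∂gaussPi K 1) / 2 := by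
    rw [integral_sub hl1.integrable_gauss hq.integrable_gauss,
      integral_sub hlog.integrable_gauss hb.integrable_gauss,
      integral_sub hg.integrable_gauss (integrable_const _), integral_col π hξ hv, integral_div]
    simp
  have g4 : ExpGrowth noiseSize (fun y => (θ * (col P ξ v π y - 1) ^ 2 +
      (col P ξ v π y - 1) ^ 4 / θ) / 2) := by
    simpa [div_eq_mul_inv] using
      ((((ExpGrowth.const θ).mul (hb.pow 2)).add ((hb.pow 4).mul (.const θ⁻¹))).mul (.const 2⁻¹))
  have e2 := norm_integral_le_of_norm_le (μ := gaussPi K 1)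
    (f := fun y => col P ξ v π y * Real.log (col P ξ v π y) - (col P ξ v π y - 1) -
      (col P ξ v π y - 1) ^ 2 / 2) (g4.integrable_gauss.const_mul 16) (ae_of_all _ fun y => by
      rw [Real.norm_eq_abs]
      refine (abs_mul_log_sub_le (hpos.pos y)).trans ?_
      exact mul_le_mul_of_nonneg_left (abs_cube_le hθ _) (by norm_num))
  rw [e1, integral_const_mul, integral_div, integral_add ((hb.pow 2).integrable_gauss.const_mul θ)
    ((hb.pow 4).integrable_gauss.div_const θ), integral_const_mul, integral_div,
    Real.norm_eq_abs] at e2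
  have h2 := abs_le.1 (column_sq π hξ hv)
  have h4 := column_four π hξ hv
  have hD := one_le_colConst hξ.one_le hv.nonneg
  set D := colConst M κ
  set I2 := ∫ y, (col P ξ v π y - 1) ^ 2 ∂gaussPi K 1
  set I4 := ∫ y, (col P ξ v π y - 1) ^ 4 ∂gaussPi K 1
  have G2 := gramMoment_nonneg (v := v) π 2
  have G3 := gramMoment_nonneg (v := v) π 3
  set g2 := gramMoment v π 2
  set g3 := gramMoment v π 3
  have h5 : I4 / θ ≤ 11 * D * (g3 / θ) := by
    rw [div_le_iff₀ hθ, mul_assoc, div_mul_cancel₀ _ hθ.ne']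
    exact h4
  have h6 : g3 ≤ g3 / θ := by rw [le_div_iff₀ hθ]; nlinarith
  have h7 : θ * I2 ≤ θ * g2 / 2 + D * (g3 / θ) := by
    have : θ * I2 ≤ θ * (g2 / 2 + D * g3) := mul_le_mul_of_nonneg_left (by linarith [h2.2]) hθ.le
    have h8 : θ * (D * g3) ≤ D * (g3 / θ) := by
      have : θ * (D * g3) ≤ 1 * (D * g3) := mul_le_mul_of_nonneg_right hθ1 (by positivity)
      have : D * g3 ≤ D * (g3 / θ) := mul_le_mul_of_nonneg_left h6 (by linarith)
      linarith
    linarith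
  have h9 : D * g3 ≤ D * (g3 / θ) := mul_le_mul_of_nonneg_left h6 (by linarith)
  have h10 : θ * g2 ≤ D * (θ * g2) := by
    have : 0 ≤ θ * g2 := by positivity
    nlinarith
  have h11 : 0 ≤ D * (g3 / θ) := by positivity
  have h12 : 0 ≤ D * (θ * g2) := by positivity
  have e3 := abs_le.1 e2
  rw [abs_le]
  constructor <;> linarith [h2.1, h2.2, e3.1, e3.2]

/-- The squared norm of the unnormalized posterior mean of the rank-one column signal. -/
noncomputable def colSq (P : Measure Ω) (ξ : Ω → ℝ) (v : X → K → ℝ) (π : Measure X) (y : K → ℝ) :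
    ℝ :=
  ∑ k, (∫ z, (ξ z.2 * v z.1 k) * lr 1 (colField ξ v z) y ∂(π.prod P)) ^ 2

/-- The unnormalized posterior mean of the squared column spin. -/
noncomputable def colDiag (P : Measure Ω) (ξ : Ω → ℝ) (v : X → K → ℝ) (π : Measure X)
    (y : K → ℝ) : ℝ :=
  ∫ z, ξ z.2 ^ 2 * lr 1 (colField ξ v z) y ∂(π.prod P)

theorem growth_integral_mul_lr (hξ : IsSpin P ξ M) (hv : IsField v κ) {f : X × Ω → ℝ}
    (hf : Measurable f) {B : ℝ} (hB : ∀ z, |f z| ≤ B) :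
    ExpGrowth noiseSize (fun y => ∫ z, f z * lr 1 (colField ξ v z) y ∂(π.prod P)) := by
  refine ExpGrowth.integral (h := fun w : (X × Ω) × (K → ℝ) => f w.1 * lr 1 (colField ξ v w.1) w.2)
    ?_ (π.prod P)
  exact (ExpGrowth.of_bound (hf.comp measurable_fst) B fun w => hB w.1).mul
    ((hξ.isField_colField hv).expPos_lr 1).growth

theorem measurable_spin_mul (hξ : IsSpin P ξ M) (hv : IsField v κ) (k : K) :
    Measurable fun z : X × Ω => ξ z.2 * v z.1 k := by
  have := hξ.meas
  have := hv.meas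
  fun_prop

theorem abs_spin_mul_le (hξ : IsSpin P ξ M) (hv : IsField v κ) (k : K) (z : X × Ω) :
    |ξ z.2 * v z.1 k| ≤ M * (κ + 1) := by
  rw [abs_mul]
  exact mul_le_mul (hξ.bound _) (hv.abs_le _ _) (abs_nonneg _) hξ.nonneg

theorem growth_colSq (hξ : IsSpin P ξ M) (hv : IsField v κ) :
    ExpGrowth noiseSize (colSq P ξ v π) :=
  ExpGrowth.sum _ fun k _ => (growth_integral_mul_lr π hξ hv (measurable_spin_mul hξ hv k)
    (abs_spin_mul_le hξ hv k)).pow 2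

theorem growth_colDiag (hξ : IsSpin P ξ M) (hv : IsField v κ) :
    ExpGrowth noiseSize (colDiag P ξ v π) := by
  have := hξ.meas
  exact growth_integral_mul_lr π hξ hv (f := fun z => ξ z.2 ^ 2) (by fun_prop) (B := M ^ 2)
    fun z => by rw [abs_of_nonneg (sq_nonneg _)]; exact hξ.sq_le _

theorem energy_fin_two (x : Fin 2 → X) (ω : Fin 2 → Ω) :
    energy ξ v x ω = ξ (ω 0) * ξ (ω 1) * gram v (x 0) (x 1) := by
  have : pairSet (Fin 2) = {(0, 1)} := by decide
  rw [energy, this, Finset.sum_singleton]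

theorem integrable_exp_energy_mul {R : Type*} [Fintype R] [LinearOrder R] (hξ : IsSpin P ξ M)
    (hv : IsField v κ) (x : R → X) {g : (R → Ω) → ℝ} (hg : Measurable g) {B : ℝ}
    (hB : ∀ ω, |g ω| ≤ B) :
    Integrable (fun ω => g ω * Real.exp (energy ξ v x ω)) (Measure.pi fun _ : R => P) := by
  refine integrable_pi_of_bound (hg.mul (measurable_energy_section hξ hv x).exp)
    (B := B * Real.exp (M ^ 2 * ((pairSet R).card * κ))) fun ω => ?_
  rw [abs_mul, Real.abs_exp]
  exact mul_le_mul (hB ω) (Real.exp_le_exp.2 ((le_abs_self _).trans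
    (abs_energy_le_const hξ hv x ω))) (Real.exp_pos _).le ((abs_nonneg _).trans (hB ω))

theorem abs_integral_energy_mul_exp_le (hξ : IsSpin P ξ M) (hv : IsField v κ) (x : Fin 2 → X) :
    |∫ ω, energy ξ v x ω * Real.exp (energy ξ v x ω) ∂(Measure.pi fun _ : Fin 2 => P) -
        |gram v (x 0) (x 1)| ^ 2| ≤
      M ^ 6 * Real.exp (M ^ 2 * κ) * |gram v (x 0) (x 1)| ^ 3 := by
  have hm := measurable_energy_section (R := Fin 2) hξ hv x
  have hc : (pairSet (Fin 2)).card = 1 := by decide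
  have hp : pairSet (Fin 2) = {(0, 1)} := by decide
  have hb : ∀ ω, |energy ξ v x ω| ≤ M ^ 2 * κ := fun ω => by
    simpa [hc] using abs_energy_le_const (R := Fin 2) hξ hv x ω
  have hb' : ∀ ω, |energy ξ v x ω| ≤ M ^ 2 * |gram v (x 0) (x 1)| := fun ω => by
    simpa [hp] using abs_energy_le (R := Fin 2) hξ (v := v) x ω
  have i1 := integrable_exp_energy_mul hξ hv x hm hb
  have i2 : Integrable (fun ω => energy ξ v x ω) (Measure.pi fun _ : Fin 2 => P) :=
    integrable_pi_of_bound hm hb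
  have i3 : Integrable (fun ω => energy ξ v x ω ^ 2) (Measure.pi fun _ : Fin 2 => P) :=
    integrable_pi_of_bound (hm.pow_const 2) (B := (M ^ 2 * κ) ^ 2) fun ω => by
      rw [abs_pow]; exact pow_le_pow_left₀ (abs_nonneg _) (hb ω) 2
  have i4 : Integrable (fun ω => energy ξ v x ω * Real.exp (energy ξ v x ω) - energy ξ v x ω)
    (Measure.pi fun _ : Fin 2 => P) := i1.sub i2
  have h1 : ∫ ω, (energy ξ v x ω * Real.exp (energy ξ v x ω) - energy ξ v x ω -
      energy ξ v x ω ^ 2) ∂(Measure.pi fun _ : Fin 2 => P) =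
      ∫ ω, energy ξ v x ω * Real.exp (energy ξ v x ω) ∂(Measure.pi fun _ : Fin 2 => P) -
        |gram v (x 0) (x 1)| ^ 2 := by
    rw [integral_sub i4 i3, integral_sub i1 i2, integral_energy hξ, integral_energy_sq hξ, hp]
    simp
  rw [← h1, ← Real.norm_eq_abs]
  refine (norm_integral_le_of_norm_le_const (C := M ^ 6 * Real.exp (M ^ 2 * κ) *
    |gram v (x 0) (x 1)| ^ 3) (ae_of_all _ fun ω => ?_)).trans (by simp)
  have e : energy ξ v x ω * Real.exp (energy ξ v x ω) - energy ξ v x ω - energy ξ v x ω ^ 2 =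
      energy ξ v x ω * (Real.exp (energy ξ v x ω) - 1 - energy ξ v x ω) := by ring
  rw [e, Real.norm_eq_abs, abs_mul]
  calc |energy ξ v x ω| * |Real.exp (energy ξ v x ω) - 1 - energy ξ v x ω|
      ≤ |energy ξ v x ω| * (|energy ξ v x ω| ^ 2 * Real.exp |energy ξ v x ω|) :=
        mul_le_mul_of_nonneg_left (abs_exp_sub_one_sub_le _) (abs_nonneg _)
    _ = |energy ξ v x ω| ^ 3 * Real.exp |energy ξ v x ω| := by ring
    _ ≤ (M ^ 2 * |gram v (x 0) (x 1)|) ^ 3 * Real.exp (M ^ 2 * κ) := by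
        gcongr
        · exact hb' ω
        · exact hb ω
    _ = _ := by ring

/-- Integrates pointwise error bounds over replicas. -/
theorem abs_integral_sub_le_of_le {R : Type*} [Fintype R] {F G H : (R → X) → ℝ}
    (hF : Integrable F (Measure.pi fun _ => π)) (hG : Integrable G (Measure.pi fun _ => π))
    (hH : Integrable H (Measure.pi fun _ => π)) (h : ∀ x, |F x - G x| ≤ H x) :
    |∫ x, F x ∂(Measure.pi fun _ => π) - ∫ x, G x ∂(Measure.pi fun _ => π)| ≤
      ∫ x, H x ∂(Measure.pi fun _ => π) := by
  rw [← integral_sub hF hG, ← Real.norm_eq_abs]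
  exact norm_integral_le_of_norm_le hH (ae_of_all _ h)

theorem integrable_integral_exp_energy {R : Type*} [Fintype R] [LinearOrder R] (hξ : IsSpin P ξ M)
    (hv : IsField v κ) {g : (R → X) × (R → Ω) → ℝ} (hg : Measurable g) {B : ℝ}
    (hB : ∀ w, |g w| ≤ B) :
    Integrable (fun x => ∫ ω, g (x, ω) * Real.exp (energy ξ v x ω) ∂(Measure.pi fun _ : R => P))
      (Measure.pi fun _ => π) := by
  refine integrable_pi_of_bound (measurable_integral_pi_section
    (f := fun w => g w * Real.exp (energy ξ v w.1 w.2)) (hg.mul (measurable_energy hξ hv).exp))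
    (B := B * Real.exp (M ^ 2 * ((pairSet R).card * κ))) fun x => ?_
  rw [← Real.norm_eq_abs]
  refine (norm_integral_le_of_norm_le_const (C := B * Real.exp (M ^ 2 * ((pairSet R).card * κ)))
    (ae_of_all _ fun ω => ?_)).trans (by simp)
  rw [Real.norm_eq_abs, abs_mul, Real.abs_exp]
  exact mul_le_mul (hB _) (Real.exp_le_exp.2 ((le_abs_self _).trans
    (abs_energy_le_const hξ hv x ω))) (Real.exp_pos _).le ((abs_nonneg _).trans (hB (x, ω)))

theorem integral_colSq_eq (hξ : IsSpin P ξ M) (hv : IsField v κ) :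
    ∫ y, colSq P ξ v π y ∂gaussPi K 1 = ∫ x : Fin 2 → X, ∫ ω : Fin 2 → Ω,
      energy ξ v x ω * Real.exp (energy ξ v x ω) ∂(Measure.pi fun _ => P)
        ∂(Measure.pi fun _ => π) := by
  have hξm := hξ.meas
  have hvm := hv.meas
  unfold colSq
  rw [integral_finsetSum _ fun k _ => ((growth_integral_mul_lr π hξ hv
    (measurable_spin_mul hξ hv k) (abs_spin_mul_le hξ hv k)).pow 2).integrable_gauss]
  have h1 : ∀ k, ∫ y, (∫ z, (ξ z.2 * v z.1 k) * lr 1 (colField ξ v z) y ∂(π.prod P)) ^ 2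
      ∂gaussPi K 1 = ∫ x : Fin 2 → X, ∫ ω : Fin 2 → Ω,
      (∏ r, (ξ (ω r) * v (x r) k)) * Real.exp (energy ξ v x ω) ∂(Measure.pi fun _ => P)
        ∂(Measure.pi fun _ => π) := by
    intro k
    have := column_replica (R := Fin 2) (f := fun _ z => ξ z.2 * v z.1 k) π hξ hv
      (fun _ => measurable_spin_mul hξ hv k) (fun _ => abs_spin_mul_le hξ hv k)
    simpa only [Finset.prod_const, Finset.card_univ, Fintype.card_fin] using this
  simp_rw [h1]
  have hbd : ∀ k (w : (Fin 2 → X) × (Fin 2 → Ω)),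
      |∏ r, (ξ (w.2 r) * v (w.1 r) k)| ≤ ∏ _r : Fin 2, M * (κ + 1) := fun k w => by
    rw [Finset.abs_prod]
    exact Finset.prod_le_prod (fun _ _ => abs_nonneg _) fun r _ =>
      abs_spin_mul_le hξ hv k (w.1 r, w.2 r)
  rw [← integral_finsetSum _ fun k _ => integrable_integral_exp_energy π hξ hv
    (g := fun w : (Fin 2 → X) × (Fin 2 → Ω) => ∏ r, (ξ (w.2 r) * v (w.1 r) k))
    (by fun_prop) (hbd k)]
  refine integral_congr_ae (ae_of_all _ fun x => ?_)
  simp only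
  rw [← integral_finsetSum _ fun k _ => integrable_exp_energy_mul hξ hv x
    (g := fun ω => ∏ r, (ξ (ω r) * v (x r) k)) (by fun_prop) (fun ω => hbd k (x, ω))]
  refine integral_congr_ae (ae_of_all _ fun ω => ?_)
  simp only
  rw [← Finset.sum_mul, energy_fin_two, gram, Finset.mul_sum]
  congr 1
  refine Finset.sum_congr rfl fun k _ => ?_
  rw [Fin.prod_univ_two]
  ring

theorem column_colSq (hξ : IsSpin P ξ M) (hv : IsField v κ) :
    |∫ y, colSq P ξ v π y ∂gaussPi K 1 - gramMoment v π 2| ≤ colConst M κ * gramMoment v π 3 := by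
  rw [integral_colSq_eq π hξ hv, ← integral_gram_replica π hv 2 (show (0 : Fin 2) ≠ 1 by decide),
    ← integral_gram_replica π hv 3 (show (0 : Fin 2) ≠ 1 by decide), ← integral_const_mul]
  refine abs_integral_sub_le_of_le π ?_ (integrable_gram_replica π hv 2 _ _)
    ((integrable_gram_replica π hv 3 _ _).const_mul _) fun x => ?_
  · exact integrable_integral_exp_energy π hξ hv (g := fun w => energy ξ v w.1 w.2)
      (measurable_energy hξ hv) (fun w => abs_energy_le_const hξ hv w.1 w.2)
  · refine (abs_integral_energy_mul_exp_le hξ hv x).trans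
      (mul_le_mul_of_nonneg_right ?_ (by positivity))
    have := colConst_ge (c := 1) hξ.one_le hv.nonneg (j := 6) (by norm_num) (by norm_num)
    rw [one_mul] at this
    have h2 : 0 ≤ M ^ 6 * Real.exp (M ^ 2 * κ) :=
      mul_nonneg (pow_nonneg hξ.nonneg _) (Real.exp_pos _).le
    linarith

theorem integral_spin_four_mul_energy (hξ : IsSpin P ξ M) (x : Fin 4 → X) :
    ∫ ω : Fin 4 → Ω, (∏ r, ξ (ω r)) * (1 + energy ξ v x ω) ∂(Measure.pi fun _ => P) = 0 := by
  have hξm := hξ.meas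
  have hb : ∀ ω : Fin 4 → Ω, |∏ r, ξ (ω r)| ≤ ∏ _r : Fin 4, M := fun ω => by
    rw [Finset.abs_prod]
    exact Finset.prod_le_prod (fun _ _ => abs_nonneg _) fun r _ => hξ.bound _
  have h : ∀ ω : Fin 4 → Ω, (∏ r, ξ (ω r)) * (1 + energy ξ v x ω) = ∏ r, ξ (ω r) +
      ∑ p ∈ pairSet (Fin 4), (∏ r, ξ (ω r) ^ (1 + ((if r = p.1 then 1 else 0) +
        (if r = p.2 then 1 else 0)))) * gram v (x p.1) (x p.2) := by
    intro ω
    rw [mul_add, mul_one, energy, Finset.mul_sum]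
    congr 1
    refine Finset.sum_congr rfl fun p _ => ?_
    simp_rw [pow_add, Finset.prod_mul_distrib, pow_one]
    rw [prod_pow_ite (fun r => ξ (ω r)), prod_pow_ite (fun r => ξ (ω r))]
    ring
  have hi : ∀ p : Fin 4 × Fin 4, Integrable (fun ω : Fin 4 → Ω =>
      (∏ r, ξ (ω r) ^ (1 + ((if r = p.1 then 1 else 0) +
        (if r = p.2 then 1 else 0)))) * gram v (x p.1) (x p.2)) (Measure.pi fun _ => P) := by
    intro p
    refine Integrable.mul_const ?_ _
    refine integrable_pi_of_bound (by fun_prop) (B := ∏ r : Fin 4, M ^ (1 +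
      ((if r = p.1 then 1 else 0) + (if r = p.2 then 1 else 0)))) fun ω => ?_
    rw [Finset.abs_prod]
    refine Finset.prod_le_prod (fun _ _ => abs_nonneg _) fun r _ => ?_
    rw [abs_pow]
    exact pow_le_pow_left₀ (abs_nonneg _) (hξ.bound _) _
  simp_rw [h]
  rw [integral_add (integrable_pi_of_bound (by fun_prop) hb) (integrable_finsetSum _ fun p _ => hi p),
    integral_finsetSum _ fun p _ => hi p,
    integral_prod_eq_zero (fun _ => ξ) (r := (0 : Fin 4)) hξ.mean, zero_add]
  refine Finset.sum_eq_zero fun p _ => ?_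
  obtain ⟨r, h1, h2⟩ : ∃ r : Fin 4, r ≠ p.1 ∧ r ≠ p.2 := by
    generalize p.1 = i
    generalize p.2 = j
    revert i j
    decide
  rw [integral_mul_const, integral_prod_eq_zero (fun r ω => ξ ω ^ (1 + ((if r = p.1 then 1 else 0) +
        (if r = p.2 then 1 else 0)))) (r := r) (by simpa [h1, h2] using hξ.mean), zero_mul]

end Column
end SpikedWigner

namespace SpikedWigner

section Column

variable {X Ω K : Type*} [MeasurableSpace X] [MeasurableSpace Ω] [Fintype K]
variable {P : Measure Ω} {ξ : Ω → ℝ} {M κ : ℝ} {v : X → K → ℝ}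
variable (π : Measure X) [IsProbabilityMeasure π] [IsProbabilityMeasure P]

theorem abs_prod_spin_le {R : Type*} [Fintype R] (hξ : IsSpin P ξ M) (ω : R → Ω) :
    |∏ r, ξ (ω r)| ≤ M ^ Fintype.card R := by
  rw [Finset.abs_prod, ← Finset.card_univ, ← Finset.prod_const]
  exact Finset.prod_le_prod (fun _ _ => abs_nonneg _) fun r _ => hξ.bound _

theorem abs_integral_spin_four_le (hξ : IsSpin P ξ M) (hv : IsField v κ) (x : Fin 4 → X) :
    |∫ ω : Fin 4 → Ω, (∏ r, ξ (ω r)) * Real.exp (energy ξ v x ω) ∂(Measure.pi fun _ => P)| ≤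
      6 * M ^ 8 * Real.exp (6 * M ^ 2 * κ) *
        ∑ p ∈ pairSet (Fin 4), |gram v (x p.1) (x p.2)| ^ 2 := by
  have hξm := hξ.meas
  have hm := measurable_energy_section (R := Fin 4) hξ hv x
  have hc : (pairSet (Fin 4)).card = 6 := by decide
  have hb : ∀ ω : Fin 4 → Ω, |energy ξ v x ω| ≤ 6 * M ^ 2 * κ := fun ω => by
    have := abs_energy_le_const (R := Fin 4) hξ hv x ω
    rw [hc] at this
    push_cast at this
    linarith
  have hprod : ∀ ω : Fin 4 → Ω, |∏ r, ξ (ω r)| ≤ M ^ 4 := fun ω => by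
    simpa using abs_prod_spin_le hξ ω
  have i1 := integrable_exp_energy_mul (R := Fin 4) hξ hv x (g := fun ω => ∏ r, ξ (ω r))
    (by fun_prop) hprod
  have i2 : Integrable (fun ω : Fin 4 → Ω => (∏ r, ξ (ω r)) * (1 + energy ξ v x ω))
      (Measure.pi fun _ => P) := by
    refine integrable_pi_of_bound (by fun_prop) (B := M ^ 4 * (1 + 6 * M ^ 2 * κ)) fun ω => ?_
    rw [abs_mul]
    refine mul_le_mul (hprod ω) ?_ (abs_nonneg _) (pow_nonneg hξ.nonneg _)
    exact (abs_add_le _ _).trans (by rw [abs_one]; linarith [hb ω])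
  have h0 := integral_spin_four_mul_energy (v := v) hξ x
  have h1 : ∫ ω : Fin 4 → Ω, (∏ r, ξ (ω r)) * Real.exp (energy ξ v x ω) ∂(Measure.pi fun _ => P) =
      ∫ ω : Fin 4 → Ω, ((∏ r, ξ (ω r)) * Real.exp (energy ξ v x ω) -
        (∏ r, ξ (ω r)) * (1 + energy ξ v x ω)) ∂(Measure.pi fun _ => P) := by
    rw [integral_sub i1 i2, h0, sub_zero]
  rw [h1, ← Real.norm_eq_abs]
  refine (norm_integral_le_of_norm_le_const (C := _) (ae_of_all _ fun ω => ?_)).trans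
    (by rw [probReal_univ, mul_one])
  have h4 := cube_sum_le (pairSet (Fin 4)) (f := fun p => |gram v (x p.1) (x p.2)|)
        (fun _ => abs_nonneg _) 1
  rw [hc] at h4
  norm_num only [pow_one] at h4
  have h5 := hξ.nonneg
  rw [← mul_sub, Real.norm_eq_abs, abs_mul, ← sub_sub]
  calc |∏ r, ξ (ω r)| * |Real.exp (energy ξ v x ω) - 1 - energy ξ v x ω|
      ≤ M ^ 4 * (|energy ξ v x ω| ^ 2 * Real.exp |energy ξ v x ω|) :=
        mul_le_mul (hprod ω) (abs_exp_sub_one_sub_le _) (abs_nonneg _) (pow_nonneg h5 _)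
    _ ≤ M ^ 4 * ((M ^ 2 * ∑ p ∈ pairSet (Fin 4), |gram v (x p.1) (x p.2)|) ^ 2 *
          Real.exp (6 * M ^ 2 * κ)) := by
        gcongr
        · exact abs_energy_le (R := Fin 4) hξ x ω
        · exact hb ω
    _ = M ^ 8 * Real.exp (6 * M ^ 2 * κ) *
          (∑ p ∈ pairSet (Fin 4), |gram v (x p.1) (x p.2)|) ^ 2 := by ring
    _ ≤ M ^ 8 * Real.exp (6 * M ^ 2 * κ) *
          (6 * ∑ p ∈ pairSet (Fin 4), |gram v (x p.1) (x p.2)| ^ 2) :=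
        mul_le_mul_of_nonneg_left h4 (by positivity)
    _ = _ := by ring

theorem integral_colSq_sq_eq (hξ : IsSpin P ξ M) (hv : IsField v κ) :
    ∫ y, colSq P ξ v π y ^ 2 ∂gaussPi K 1 = ∫ x : Fin 4 → X,
      (gram v (x 0) (x 1) * gram v (x 2) (x 3)) * ∫ ω : Fin 4 → Ω,
      (∏ r, ξ (ω r)) * Real.exp (energy ξ v x ω) ∂(Measure.pi fun _ => P)
        ∂(Measure.pi fun _ => π) := by
  have hξm := hξ.meas
  have hvm := hv.meas
  set A : K → (K → ℝ) → ℝ := fun k y =>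
    ∫ z, (ξ z.2 * v z.1 k) * lr 1 (colField ξ v z) y ∂(π.prod P) with hA
  have hAg : ∀ k, ExpGrowth noiseSize (A k) := fun k => growth_integral_mul_lr π hξ hv
    (measurable_spin_mul hξ hv k) (abs_spin_mul_le hξ hv k)
  have h0 : ∀ y, colSq P ξ v π y ^ 2 = ∑ k, ∑ l, A k y ^ 2 * A l y ^ 2 := fun y => by
    rw [colSq, sq, Finset.sum_mul_sum]
  simp_rw [h0]
  have hAi : ∀ k l, Integrable (fun y => A k y ^ 2 * A l y ^ 2) (gaussPi K 1) := fun k l =>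
    (((hAg k).pow 2).mul ((hAg l).pow 2)).integrable_gauss
  rw [integral_finsetSum _ fun k _ => integrable_finsetSum _ fun l _ => hAi k l]
  simp_rw [integral_finsetSum _ fun l _ => hAi _ l]
  have h1 : ∀ k l, ∫ y, A k y ^ 2 * A l y ^ 2 ∂gaussPi K 1 = ∫ x : Fin 4 → X, ∫ ω : Fin 4 → Ω,
      (∏ r, (ξ (ω r) * v (x r) (![k, k, l, l] r))) * Real.exp (energy ξ v x ω)
        ∂(Measure.pi fun _ => P) ∂(Measure.pi fun _ => π) := by
    intro k l
    have := column_replica (R := Fin 4) (f := fun r z => ξ z.2 * v z.1 (![k, k, l, l] r)) π hξ hv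
      (fun r => measurable_spin_mul hξ hv _) (fun r => abs_spin_mul_le hξ hv _)
    rw [← this]
    refine integral_congr_ae (ae_of_all _ fun y => ?_)
    simp only [Fin.prod_univ_four, hA]
    simp
    ring
  simp_rw [h1]
  have hbd : ∀ k l (w : (Fin 4 → X) × (Fin 4 → Ω)),
      |∏ r, (ξ (w.2 r) * v (w.1 r) (![k, k, l, l] r))| ≤ ∏ _r : Fin 4, M * (κ + 1) := fun k l w => by
    rw [Finset.abs_prod]
    exact Finset.prod_le_prod (fun _ _ => abs_nonneg _) fun r _ =>
      abs_spin_mul_le hξ hv _ (w.1 r, w.2 r)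
  have hii := fun k l => integrable_integral_exp_energy π hξ hv
    (g := fun w : (Fin 4 → X) × (Fin 4 → Ω) => ∏ r, (ξ (w.2 r) * v (w.1 r) (![k, k, l, l] r)))
    (by fun_prop) (hbd k l)
  simp_rw [← integral_finsetSum _ fun l _ => hii _ l]
  rw [← integral_finsetSum _ fun k _ => integrable_finsetSum _ fun l _ => hii k l]
  refine integral_congr_ae (ae_of_all _ fun x => ?_)
  simp only
  have hij := fun k l => integrable_exp_energy_mul hξ hv x
    (g := fun ω => ∏ r, (ξ (ω r) * v (x r) (![k, k, l, l] r))) (by fun_prop)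
    (fun ω => hbd k l (x, ω))
  simp_rw [← integral_finsetSum _ fun l _ => hij _ l]
  rw [← integral_finsetSum _ fun k _ => integrable_finsetSum _ fun l _ => hij k l,
    ← integral_const_mul]
  refine integral_congr_ae (ae_of_all _ fun ω => ?_)
  simp only
  rw [gram, gram, Finset.sum_mul_sum, Finset.sum_mul]
  refine Finset.sum_congr rfl fun k _ => ?_
  rw [Finset.sum_mul]
  refine Finset.sum_congr rfl fun l _ => ?_
  simp only [Fin.prod_univ_four]
  simp
  ring

theorem column_colSq_sq (hξ : IsSpin P ξ M) (hv : IsField v κ) :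
    ∫ y, colSq P ξ v π y ^ 2 ∂gaussPi K 1 ≤ colConst M κ * gramMoment v π 4 := by
  have hc : (pairSet (Fin 4)).card = 6 := by decide
  rw [integral_colSq_sq_eq π hξ hv]
  have hM := hξ.nonneg
  set D := 6 * M ^ 8 * Real.exp (6 * M ^ 2 * κ) with hD
  have hD0 : 0 ≤ D := by positivity
  have h := norm_integral_le_of_norm_le (μ := Measure.pi fun _ : Fin 4 => π)
    (f := fun x => (gram v (x 0) (x 1) * gram v (x 2) (x 3)) * ∫ ω : Fin 4 → Ω,
      (∏ r, ξ (ω r)) * Real.exp (energy ξ v x ω) ∂(Measure.pi fun _ => P))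
    ((integrable_sum_gram (R := Fin 4) π hv 4).const_mul (6 * D)) (ae_of_all _ fun x => by
      rw [Real.norm_eq_abs, abs_mul, abs_mul]
      set S := ∑ p ∈ pairSet (Fin 4), |gram v (x p.1) (x p.2)| ^ 2 with hS
      have h1 := abs_integral_spin_four_le hξ hv x
      have h2 : |gram v (x 0) (x 1)| * |gram v (x 2) (x 3)| ≤ S := by
        have e1 : |gram v (x 0) (x 1)| ^ 2 ≤ S := Finset.single_le_sum
          (f := fun p : Fin 4 × Fin 4 => |gram v (x p.1) (x p.2)| ^ 2) (fun _ _ => by positivity)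
          (show ((0 : Fin 4), (1 : Fin 4)) ∈ pairSet (Fin 4) by decide)
        have e2 : |gram v (x 2) (x 3)| ^ 2 ≤ S := Finset.single_le_sum
          (f := fun p : Fin 4 × Fin 4 => |gram v (x p.1) (x p.2)| ^ 2) (fun _ _ => by positivity)
          (show ((2 : Fin 4), (3 : Fin 4)) ∈ pairSet (Fin 4) by decide)
        nlinarith [sq_nonneg (|gram v (x 0) (x 1)| - |gram v (x 2) (x 3)|)]
      have h3 := cube_sum_le (pairSet (Fin 4)) (f := fun p => |gram v (x p.1) (x p.2)| ^ 2)
        (fun _ => by positivity) 1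
      rw [hc, ← hS] at h3
      norm_num only [pow_one, ← pow_mul] at h3
      have hS0 : 0 ≤ S := Finset.sum_nonneg fun _ _ => by positivity
      calc _ ≤ S * (D * S) := mul_le_mul h2 h1 (abs_nonneg _) hS0
        _ = D * S ^ 2 := by ring
        _ ≤ D * (6 * ∑ p ∈ pairSet (Fin 4), |gram v (x p.1) (x p.2)| ^ 4) :=
          mul_le_mul_of_nonneg_left h3 hD0
        _ = _ := by ring)
  refine (le_abs_self _).trans (h.trans ?_)
  rw [integral_const_mul, integral_sum_gram π hv, hc, ← mul_assoc]
  refine mul_le_mul_of_nonneg_right ?_ (gramMoment_nonneg π 4)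
  refine le_trans (le_of_eq ?_) (colConst_ge (c := 6) hξ.one_le hv.nonneg (j := 8) (by norm_num)
    (by norm_num))
  rw [hD]
  push_cast
  ring

theorem colSq_nonneg (y : K → ℝ) : 0 ≤ colSq P ξ v π y := Finset.sum_nonneg fun _ _ => sq_nonneg _

theorem growth_colSq_div (hξ : IsSpin P ξ M) (hv : IsField v κ) :
    ExpGrowth noiseSize (fun y => colSq P ξ v π y / col P ξ v π y) := by
  simpa only [div_eq_mul_inv] using (growth_colSq π hξ hv).mul (expPos_col π hξ hv).inv.growth

theorem column_colSq_div (hξ : IsSpin P ξ M) (hv : IsField v κ) {k θ : ℝ} (hk : 0 < k)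
    (hθ : 0 < θ) :
    |∫ y, colSq P ξ v π y / col P ξ v π y ∂gaussPi K 1 - gramMoment v π 2| ≤
      colConst M κ * (gramMoment v π 3 + k * gramMoment v π 4 +
        (3 * gramMoment v π 3 / θ + θ) / k) := by
  have hpos := expPos_col π hξ hv
  have hb := col_sub_growth π hξ hv
  have hS := growth_colSq π hξ hv
  have hinv4 : ExpGrowth noiseSize (fun y => (col P ξ v π y ^ 4)⁻¹) := by
    simpa using hpos.inv.growth.pow 4
  have h1 := abs_le.1 (column_colSq π hξ hv)
  have h2 := column_colSq_sq π hξ hv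
  have h3 := column_four π hξ hv
  have h4 := column_inv_four π hξ hv
  have hpt : ∀ y, ‖colSq P ξ v π y / col P ξ v π y - colSq P ξ v π y‖ ≤
      k / 2 * colSq P ξ v π y ^ 2 + 1 / (4 * k * θ) * (col P ξ v π y - 1) ^ 4 +
        θ / (4 * k) * (col P ξ v π y ^ 4)⁻¹ := by
    intro y
    have ha := hpos.pos y
    have hs := colSq_nonneg (P := P) (ξ := ξ) (v := v) π y
    set a := col P ξ v π y
    set s := colSq P ξ v π y
    set t := |a - 1| / a with ht
    have e1 : ‖s / a - s‖ = s * t := by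
      rw [Real.norm_eq_abs, show s / a - s = s * (-(a - 1) / a) by field_simp; ring, abs_mul,
        abs_of_nonneg hs, abs_div, abs_neg, abs_of_pos ha]
    have e2 : s * t ≤ k / 2 * s ^ 2 + t ^ 2 / (2 * k) := by
      have : 0 ≤ (k * s - t) ^ 2 / (2 * k) := by positivity
      have e : (k * s - t) ^ 2 / (2 * k) = k / 2 * s ^ 2 + t ^ 2 / (2 * k) - s * t := by
        field_simp
        ring
      linarith
    have e3 : t ^ 2 ≤ 1 / (2 * θ) * (a - 1) ^ 4 + θ / 2 * (a ^ 4)⁻¹ := by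
      have h0 : 0 ≤ ((a - 1) ^ 2 - θ * (a ^ 2)⁻¹) ^ 2 / (2 * θ) := by positivity
      have e : ((a - 1) ^ 2 - θ * (a ^ 2)⁻¹) ^ 2 / (2 * θ) =
          1 / (2 * θ) * (a - 1) ^ 4 + θ / 2 * (a ^ 4)⁻¹ - t ^ 2 := by
        rw [ht, div_pow, sq_abs]
        field_simp
        ring
      linarith
    have e4 : t ^ 2 / (2 * k) ≤ (1 / (2 * θ) * (a - 1) ^ 4 + θ / 2 * (a ^ 4)⁻¹) / (2 * k) := by
      gcongr
    have e5 : (1 / (2 * θ) * (a - 1) ^ 4 + θ / 2 * (a ^ 4)⁻¹) / (2 * k) =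
        1 / (4 * k * θ) * (a - 1) ^ 4 + θ / (4 * k) * (a ^ 4)⁻¹ := by
      field_simp
      ring
    rw [e1]
    linarith
  have g1 := (ExpGrowth.const (N := noiseSize (K := K)) (k / 2)).mul (hS.pow 2)
  have g2 := (ExpGrowth.const (N := noiseSize (K := K)) (1 / (4 * k * θ))).mul (hb.pow 4)
  have g3 := (ExpGrowth.const (N := noiseSize (K := K)) (θ / (4 * k))).mul hinv4
  have h5 := norm_integral_le_of_norm_le ((g1.add g2).add g3).integrable_gauss (ae_of_all _ hpt)
  rw [integral_sub (growth_colSq_div π hξ hv).integrable_gauss hS.integrable_gauss,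
    integral_add (g1.add g2).integrable_gauss g3.integrable_gauss,
    integral_add g1.integrable_gauss g2.integrable_gauss, integral_const_mul, integral_const_mul,
    integral_const_mul, Real.norm_eq_abs] at h5
  have h6 := abs_le.1 h5
  have G3 := gramMoment_nonneg (v := v) π 3
  have G4 := gramMoment_nonneg (v := v) π 4
  have hD := one_le_colConst hξ.one_le hv.nonneg
  set D := colConst M κ
  set g3 := gramMoment v π 3
  set g4 := gramMoment v π 4
  have b1 : k / 2 * ∫ y, colSq P ξ v π y ^ 2 ∂gaussPi K 1 ≤ D * (k * g4) := by
    have := mul_le_mul_of_nonneg_left h2 (show 0 ≤ k / 2 by positivity)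
    have : 0 ≤ D * (k * g4) := by positivity
    linarith
  have b2 : 1 / (4 * k * θ) * ∫ y, (col P ξ v π y - 1) ^ 4 ∂gaussPi K 1 ≤
      D * (3 * g3 / θ / k) := by
    have := mul_le_mul_of_nonneg_left h3 (show 0 ≤ 1 / (4 * k * θ) by positivity)
    have e : 1 / (4 * k * θ) * (11 * D * g3) = D * (3 * g3 / θ / k) - D * (g3 / (4 * θ * k)) := by
      field_simp
      ring
    have : 0 ≤ D * (g3 / (4 * θ * k)) := by positivity
    linarith
  have b3 : θ / (4 * k) * ∫ y, (col P ξ v π y ^ 4)⁻¹ ∂gaussPi K 1 ≤ D * (θ / k) := by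
    have := mul_le_mul_of_nonneg_left h4 (show 0 ≤ θ / (4 * k) by positivity)
    have e : θ / (4 * k) * D = D * (θ / k) / 4 := by field_simp
    have : 0 ≤ D * (θ / k) := by positivity
    linarith
  have e : D * (g3 + k * g4 + (3 * g3 / θ + θ) / k) =
      D * g3 + D * (k * g4) + D * (3 * g3 / θ / k) + D * (θ / k) := by ring
  rw [e, abs_le]
  constructor <;> linarith [h1.1, h1.2, h6.1, h6.2]

theorem integral_colDiag_sub_sq_le (hξ : IsSpin P ξ M) (hv : IsField v κ) :
    ∫ y, (colDiag P ξ v π y - col P ξ v π y) ^ 2 ∂gaussPi K 1 ≤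
      colConst M κ * gramMoment v π 1 := by
  have hξm := hξ.meas
  have hM := hξ.one_le
  have hM0 := hξ.nonneg
  have hf : ∀ ω, |ξ ω ^ 2 - 1| ≤ M ^ 2 := fun ω => by
    have := hξ.sq_le ω
    rw [abs_le]
    constructor <;> nlinarith [sq_nonneg (ξ ω)]
  have hfm : Measurable fun z : X × Ω => ξ z.2 ^ 2 - 1 := by fun_prop
  have h0 : ∀ y, colDiag P ξ v π y - col P ξ v π y =
      ∫ z, (ξ z.2 ^ 2 - 1) * lr 1 (colField ξ v z) y ∂(π.prod P) := fun y => by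
    have hg := ((hξ.isField_colField hv).expPos_lr 1).growth
    rw [colDiag, col, ← integral_sub]
    · exact integral_congr_ae (ae_of_all _ fun z => by simp only; ring)
    · exact ((ExpGrowth.of_bound (N := fun w : (X × Ω) × (K → ℝ) => noiseSize w.2)
        (f := fun w => ξ w.1.2 ^ 2) (by fun_prop) (M ^ 2) fun w => by
          rw [abs_of_nonneg (sq_nonneg _)]; exact hξ.sq_le _).mul hg).integrable_section (π.prod P) y
    · exact hg.integrable_section (π.prod P) y
  have h1 := column_replica (R := Fin 2) (f := fun _ z => ξ z.2 ^ 2 - 1) π hξ hv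
      (fun _ => hfm) (fun _ z => hf z.2)
  simp only [Finset.prod_const, Finset.card_univ, Fintype.card_fin] at h1
  simp_rw [h0]
  rw [h1]
  have hc : (pairSet (Fin 2)).card = 1 := by decide
  have hp : pairSet (Fin 2) = {(0, 1)} := by decide
  have hprod : ∀ ω : Fin 2 → Ω, |∏ r, (ξ (ω r) ^ 2 - 1)| ≤ M ^ 4 := fun ω => by
    rw [Fin.prod_univ_two, abs_mul]
    calc _ ≤ M ^ 2 * M ^ 2 := mul_le_mul (hf _) (hf _) (abs_nonneg _) (by positivity)
      _ = M ^ 4 := by ring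
  have hmean : ∫ ω : Fin 2 → Ω, ∏ r, (ξ (ω r) ^ 2 - 1) ∂(Measure.pi fun _ => P) = 0 := by
    refine integral_prod_eq_zero (fun _ ω => ξ ω ^ 2 - 1) (r := (0 : Fin 2)) ?_
    rw [integral_sub _ (integrable_const _), hξ.second]
    · simp
    · exact Integrable.of_bound (by fun_prop) (M ^ 2) (ae_of_all _ fun ω => by
        rw [Real.norm_eq_abs, abs_of_nonneg (sq_nonneg _)]; exact hξ.sq_le _)
  have hpt : ∀ x : Fin 2 → X, ‖∫ ω : Fin 2 → Ω, (∏ r, (ξ (ω r) ^ 2 - 1)) *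
      Real.exp (energy ξ v x ω) ∂(Measure.pi fun _ => P)‖ ≤
      M ^ 6 * Real.exp (M ^ 2 * κ) * |gram v (x 0) (x 1)| ^ 1 := by
    intro x
    have e : ∫ ω : Fin 2 → Ω, (∏ r, (ξ (ω r) ^ 2 - 1)) *
        Real.exp (energy ξ v x ω) ∂(Measure.pi fun _ => P) = ∫ ω : Fin 2 → Ω,
        ((∏ r, (ξ (ω r) ^ 2 - 1)) * Real.exp (energy ξ v x ω) - ∏ r, (ξ (ω r) ^ 2 - 1))
          ∂(Measure.pi fun _ => P) := by
      rw [integral_sub (integrable_exp_energy_mul hξ hv x (g := fun ω => ∏ r, (ξ (ω r) ^ 2 - 1))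
        (by fun_prop) hprod) (integrable_pi_of_bound (by fun_prop) hprod), hmean, sub_zero]
    rw [e]
    refine (norm_integral_le_of_norm_le_const (C := _) (ae_of_all _ fun ω => ?_)).trans
      (by rw [probReal_univ, mul_one])
    have hb : |energy ξ v x ω| ≤ M ^ 2 * κ := by
      simpa [hc] using abs_energy_le_const (R := Fin 2) hξ hv x ω
    have hb' : |energy ξ v x ω| ≤ M ^ 2 * |gram v (x 0) (x 1)| := by
      simpa [hp] using abs_energy_le (R := Fin 2) hξ (v := v) x ω
    rw [← mul_sub_one, Real.norm_eq_abs, abs_mul]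
    calc _ ≤ M ^ 4 * (|energy ξ v x ω| * Real.exp |energy ξ v x ω|) :=
          mul_le_mul (hprod ω) (abs_exp_sub_one_le _) (abs_nonneg _) (by positivity)
      _ ≤ M ^ 4 * ((M ^ 2 * |gram v (x 0) (x 1)|) * Real.exp (M ^ 2 * κ)) := by gcongr
      _ = _ := by ring
  have h2 := norm_integral_le_of_norm_le (μ := Measure.pi fun _ : Fin 2 => π)
    ((integrable_gram_replica π hv 1 0 1).const_mul (M ^ 6 * Real.exp (M ^ 2 * κ)))
    (ae_of_all _ hpt)
  rw [integral_const_mul, integral_gram_replica π hv 1 (by decide)] at h2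
  refine (le_abs_self _).trans (h2.trans (mul_le_mul_of_nonneg_right ?_ (gramMoment_nonneg π 1)))
  have := colConst_ge (c := 1) hξ.one_le hv.nonneg (j := 6) (by norm_num) (by norm_num)
  rw [one_mul] at this
  have h3 : 0 ≤ M ^ 6 * Real.exp (M ^ 2 * κ) := by positivity
  linarith

theorem colDiag_bounds (hξ : IsSpin P ξ M) (hv : IsField v κ) (y : K → ℝ) :
    0 ≤ colDiag P ξ v π y ∧ colDiag P ξ v π y ≤ M ^ 2 * col P ξ v π y := by
  have hξm := hξ.meas
  have hg := ((hξ.isField_colField hv).expPos_lr 1).growth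
  refine ⟨integral_nonneg fun z => mul_nonneg (sq_nonneg _) (lr_pos _ _ _).le, ?_⟩
  rw [col, ← integral_const_mul]
  refine integral_mono ?_ ((hg.integrable_section (π.prod P) y).const_mul _) fun z =>
    mul_le_mul_of_nonneg_right (hξ.sq_le _) (lr_pos _ _ _).le
  exact ((ExpGrowth.of_bound (N := fun w : (X × Ω) × (K → ℝ) => noiseSize w.2)
        (f := fun w => ξ w.1.2 ^ 2) (by fun_prop) (M ^ 2) fun w => by
          rw [abs_of_nonneg (sq_nonneg _)]; exact hξ.sq_le _).mul hg).integrable_section (π.prod P) y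

theorem growth_colDiag_div (hξ : IsSpin P ξ M) (hv : IsField v κ) :
    ExpGrowth noiseSize (fun y => colDiag P ξ v π y ^ 2 / col P ξ v π y) := by
  simpa only [div_eq_mul_inv] using ((growth_colDiag π hξ hv).pow 2).mul
    (expPos_col π hξ hv).inv.growth

theorem column_colDiag_div (hξ : IsSpin P ξ M) (hv : IsField v κ) {θ : ℝ} (hθ : 0 < θ) :
    |∫ y, colDiag P ξ v π y ^ 2 / col P ξ v π y ∂gaussPi K 1 - 1| ≤
      M ^ 2 * (θ + colConst M κ * gramMoment v π 1 / θ) := by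
  have hM := hξ.one_le
  have hpos := expPos_col π hξ hv
  have hg := hpos.growth
  have hd := (growth_colDiag π hξ hv).sub hg
  have hpt : ∀ y, ‖colDiag P ξ v π y ^ 2 / col P ξ v π y - col P ξ v π y‖ ≤
      M ^ 2 * (θ + (colDiag P ξ v π y - col P ξ v π y) ^ 2 * θ⁻¹) := by
    intro y
    have ha := hpos.pos y
    obtain ⟨hb0, hb1⟩ := colDiag_bounds π hξ hv y
    set a := col P ξ v π y
    set b := colDiag P ξ v π y
    have e1 : b ^ 2 / a - a = (b - a) * ((b + a) / a) := by field_simp; ring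
    have e2 : (b + a) / a ≤ 2 * M ^ 2 := by
      rw [div_le_iff₀ ha]
      have : 1 * a ≤ M ^ 2 * a := mul_le_mul_of_nonneg_right (one_le_pow₀ hM) ha.le
      linarith
    have e3 : |b - a| ≤ (θ + (b - a) ^ 2 * θ⁻¹) / 2 := by
      have h0 : 0 ≤ (θ - |b - a|) ^ 2 * θ⁻¹ := by positivity
      have e : (θ - |b - a|) ^ 2 * θ⁻¹ = θ + (b - a) ^ 2 * θ⁻¹ - 2 * |b - a| := by
        rw [← sq_abs (b - a)]
        field_simp
        ring
      linarith
    have e4 : 0 ≤ (b + a) / a := div_nonneg (by linarith) ha.le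
    rw [e1, Real.norm_eq_abs, abs_mul, abs_of_nonneg e4]
    calc _ ≤ (θ + (b - a) ^ 2 * θ⁻¹) / 2 * (2 * M ^ 2) :=
          mul_le_mul e3 e2 e4 ((abs_nonneg _).trans e3)
      _ = _ := by ring
  have h1 := norm_integral_le_of_norm_le (((ExpGrowth.const (N := noiseSize (K := K)) (M ^ 2)).mul
    ((ExpGrowth.const θ).add ((hd.pow 2).mul (.const θ⁻¹)))).integrable_gauss) (ae_of_all _ hpt)
  rw [integral_sub (growth_colDiag_div π hξ hv).integrable_gauss hg.integrable_gauss,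
    integral_col π hξ hv, integral_const_mul, integral_add (integrable_const _)
    ((hd.pow 2).mul (.const θ⁻¹)).integrable_gauss, integral_mul_const, Real.norm_eq_abs] at h1
  refine h1.trans (mul_le_mul_of_nonneg_left ?_ (sq_nonneg _))
  simp only [integral_const, probReal_univ, smul_eq_mul, one_mul]
  rw [div_eq_mul_inv]
  have := mul_le_mul_of_nonneg_right (integral_colDiag_sub_sq_le π hξ hv) (inv_pos.2 hθ).le
  linarith

end Column
end SpikedWigner

namespace SpikedWigner

section Comparison

open scoped NNReal ENNReal

variable {X K K' : Type*} [MeasurableSpace X] [Fintype K] [Fintype K']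

/-- The partition function of a Gaussian field. -/
noncomputable def mix (h : ℝ≥0) (a : X → K → ℝ) (ν : Measure X) (y : K → ℝ) : ℝ :=
  ∫ x, lr h (a x) y ∂ν

variable {a : X → K → ℝ} {c : X → K' → ℝ} {A : ℝ} (ν : Measure X) [IsProbabilityMeasure ν]

theorem expPos_mix (ha : IsField a A) (h : ℝ≥0) : ExpPos noiseSize (mix h a ν) :=
  (ha.expPos_lr h).integral ν

theorem integral_mix (ha : IsField a A) (h : ℝ≥0) : ∫ y, mix h a ν y ∂gaussPi K h = 1 := by
  unfold mix
  rw [← integral_integral_swap (f := fun x y => lr h (a x) y)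
    ((ha.expPos_lr h).growth.integrable ((expIntegrable_gaussPi h).prod_snd ν))]
  simp [integral_lr]

theorem integral_mix_sq (ha : IsField a A) (h : ℝ≥0) :
    ∫ y, mix h a ν y ^ 2 ∂gaussPi K h = ∫ p, Real.exp (h * gram a p.1 p.2) ∂(ν.prod ν) := by
  have h1 := integral_prod_integral (R := Fin 2) (expIntegrable_gaussPi (K := K) h) ν
    (g := fun _ w => lr h (a w.1) w.2) (fun _ => (ha.expPos_lr h).growth)
  simp only [Fin.prod_univ_two, integral_lr_mul_lr] at h1
  rw [← integral_pi_pair ν (R := Fin 2) (g := fun p => Real.exp (h * gram a p.1 p.2))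
    ((ha.measurable_gram.const_mul _).exp) (show (0 : Fin 2) ≠ 1 by decide)]
  simp only [gram, ← h1, sq]
  rfl

theorem integral_pow_four_le {f : X → ℝ} (hf : Integrable f ν)
    (hf4 : Integrable (fun x => f x ^ 4) ν) : (∫ x, f x ∂ν) ^ 4 ≤ ∫ x, f x ^ 4 ∂ν := by
  set m := ∫ x, f x ∂ν with hm
  have h := integral_mono (μ := ν) (f := fun x => m ^ 4 + 4 * m ^ 3 * (f x - m)) (g := fun x => f x ^ 4)
    ((integrable_const _).add ((hf.sub (integrable_const _)).const_mul _)) hf4 fun x => by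
      have h1 : 0 ≤ (f x - m) ^ 2 * ((f x + m) ^ 2 + 2 * m ^ 2) := by positivity
      simp only
      nlinarith
  have i0 : Integrable (fun x => 4 * m ^ 3 * (f x - m)) ν :=
    (hf.sub (integrable_const _)).const_mul _
  rw [integral_add (integrable_const _) i0, integral_const_mul,
    integral_sub hf (integrable_const _), ← hm] at h
  simpa using h

theorem integral_lr_pow (h : ℝ≥0) (b : K → ℝ) (j : ℕ) :
    ∫ y, lr h b y ^ j ∂gaussPi K h =
      Real.exp (((j : ℝ) ^ 2 - j) / 2 * (h * ∑ k, b k ^ 2)) := by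
  have := integral_prod_lr (K := K) (Finset.univ : Finset (Fin j)) h (fun _ => b)
  simp only [Finset.prod_const, Finset.card_univ, Fintype.card_fin, Finset.sum_const,
    nsmul_eq_mul, mul_pow, ← Finset.mul_sum] at this
  rw [this]
  congr 1
  ring

theorem growth_lr (h : ℝ≥0) (b : K → ℝ) : ExpGrowth noiseSize (lr h b) :=
  ((expPos_lr (X := Unit) (K := K) h (a := fun _ => b) measurable_const
      (A := ∑ k, |b k|) fun _ k => Finset.single_le_sum (f := fun k => |b k|)
        (fun _ _ => abs_nonneg _) (Finset.mem_univ k)).growth.comp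
        (φ := fun y => ((), y)) (N' := noiseSize) (by fun_prop) (fun _ => le_rfl))

theorem integral_lr_sub_one_four_le (h : ℝ≥0) (b : K → ℝ) {w : ℝ} (hw : h * ∑ k, b k ^ 2 = w)
    (hw1 : w ≤ 1) : ∫ y, (lr h b y - 1) ^ 4 ∂gaussPi K h ≤ 78 * Real.exp 6 * w ^ 2 := by
  have hw0 : 0 ≤ w := by rw [← hw]; positivity
  have hg := growth_lr h b
  have i : ∀ j, Integrable (fun y => lr h b y ^ j) (gaussPi K h) := fun j =>
    (hg.pow j).integrable (expIntegrable_gaussPi h)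
  have i1 : Integrable (lr h b) (gaussPi K h) := hg.integrable (expIntegrable_gaussPi h)
  have e : ∀ y, (lr h b y - 1) ^ 4 = lr h b y ^ 4 - 4 * lr h b y ^ 3 + 6 * lr h b y ^ 2 -
      (4 * lr h b y - 1) := fun y => by ring
  simp_rw [e]
  have j1 : Integrable (fun y => lr h b y ^ 4 - 4 * lr h b y ^ 3) (gaussPi K h) :=
    (i 4).sub ((i 3).const_mul 4)
  have j2 : Integrable (fun y => lr h b y ^ 4 - 4 * lr h b y ^ 3 + 6 * lr h b y ^ 2)
    (gaussPi K h) := j1.add ((i 2).const_mul 6)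
  have j3 : Integrable (fun y => 4 * lr h b y - 1) (gaussPi K h) :=
    (i1.const_mul 4).sub (integrable_const _)
  rw [integral_sub j2 j3, integral_add j1 ((i 2).const_mul 6),
    integral_sub (i 4) ((i 3).const_mul 4), integral_sub (i1.const_mul 4) (integrable_const _),
    integral_const_mul, integral_const_mul, integral_const_mul, integral_lr_pow, integral_lr_pow,
    integral_lr_pow, integral_lr, hw]
  norm_num
  have key : ∀ t : ℝ, 0 ≤ t → t ≤ 6 → |Real.exp (t * w) - 1 - t * w| ≤ (t * w) ^ 2 * Real.exp 6 := by
    intro t ht ht6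
    refine (abs_exp_sub_one_sub_le _).trans ?_
    rw [sq_abs]
    have h0 : |t * w| ≤ 6 := by rw [abs_of_nonneg (by positivity)]; nlinarith
    gcongr
  have k6 := abs_le.1 (key 6 (by norm_num) le_rfl)
  have k3 := abs_le.1 (key 3 (by norm_num) (by norm_num))
  have k1 := abs_le.1 (key 1 (by norm_num) (by norm_num))
  rw [one_mul] at k1
  linarith [k6.2, k3.1, k1.2]

theorem integral_mix_sub_one_four_le (ha : IsField a A) (h : ℝ≥0) (hA : h * A ≤ 1) :
    ∫ y, (mix h a ν y - 1) ^ 4 ∂gaussPi K h ≤ 78 * Real.exp 6 * (h * A) ^ 2 := by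
  have hg := (ha.expPos_lr h).growth.sub (.const 1)
  have h1 : ∀ y, (mix h a ν y - 1) ^ 4 ≤ ∫ x, (lr h (a x) y - 1) ^ 4 ∂ν := fun y => by
    have := integral_pow_four_le ν (f := fun x => lr h (a x) y - 1) (hg.integrable_section ν y)
      ((hg.pow 4).integrable_section ν y)
    rw [integral_sub ((ha.expPos_lr h).growth.integrable_section ν y) (integrable_const _)] at this
    simpa [mix] using this
  have hm : ExpGrowth noiseSize fun y => (mix h a ν y - 1) ^ 4 :=
    ((expPos_mix ν ha h).growth.sub (.const 1)).pow 4
  refine (integral_mono (hm.integrable (expIntegrable_gaussPi h))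
    (((hg.pow 4).integral ν).integrable (expIntegrable_gaussPi h)) h1).trans ?_
  rw [← integral_integral_swap (f := fun x y => (lr h (a x) y - 1) ^ 4)
    ((hg.pow 4).integrable ((expIntegrable_gaussPi h).prod_snd ν))]
  have h2 : ∀ x, ‖∫ y, (lr h (a x) y - 1) ^ 4 ∂gaussPi K h‖ ≤ 78 * Real.exp 6 * (h * A) ^ 2 := by
    intro x
    rw [Real.norm_eq_abs, abs_of_nonneg (integral_nonneg fun _ => by positivity)]
    have hx : h * ∑ k, a x k ^ 2 ≤ h * A := mul_le_mul_of_nonneg_left (ha.sq_le x) h.coe_nonneg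
    refine (integral_lr_sub_one_four_le h (a x) rfl (hx.trans hA)).trans ?_
    gcongr
  have := norm_integral_le_of_norm_le_const (μ := ν) (ae_of_all _ h2)
  rw [probReal_univ, mul_one] at this
  exact (le_abs_self _).trans this

/-- Second order expansion of the fractional moments of the partition function. -/
theorem exists_abs_integral_mix_rpow_sub_le {p : ℝ} (hp : 0 < p) (hp1 : p < 1) (A : ℝ) :
    ∃ C : ℝ, 0 ≤ C ∧ ∀ (a : X → K → ℝ), IsField a A → ∀ (ν : Measure X) [IsProbabilityMeasure ν]
      (δ : ℝ) (h : ℝ≥0), 0 < δ → δ ≤ 1 → (h : ℝ) = δ ^ 2 → h * A ≤ 1 →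
      |∫ y, mix h a ν y ^ p ∂gaussPi K h - 1 + p * (1 - p) / 2 *
        (∫ q, Real.exp (h * gram a q.1 q.2) ∂(ν.prod ν) - 1)| ≤ C * δ ^ 3 := by
  obtain ⟨B, hB, hBp⟩ := exists_abs_rpow_sub_le hp hp1
  refine ⟨B * (|A| * Real.exp 1 + 78 * Real.exp 6 * A ^ 2) / 2, by positivity, ?_⟩
  intro a ha ν _ δ h hδ hδ1 hh hA
  have hA0 := ha.nonneg
  rw [abs_of_nonneg hA0]
  have hpos := expPos_mix ν ha h
  have hI : ∀ {f : (K → ℝ) → ℝ}, ExpGrowth noiseSize f → Integrable f (gaussPi K h) := fun hf =>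
    hf.integrable (expIntegrable_gaussPi h)
  have g1 := hpos.growth.sub (.const 1)
  have gp := (hpos.rpow p).growth
  have e2 : ∫ y, (mix h a ν y - 1) ^ 2 ∂gaussPi K h =
      ∫ q, Real.exp (h * gram a q.1 q.2) ∂(ν.prod ν) - 1 := by
    have e : ∀ y, (mix h a ν y - 1) ^ 2 = mix h a ν y ^ 2 - (2 * mix h a ν y - 1) := fun y => by ring
    simp_rw [e]
    have j1 : Integrable (fun y => 2 * mix h a ν y - 1) (gaussPi K h) :=
      hI (((ExpGrowth.const 2).mul hpos.growth).sub (.const 1))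
    rw [integral_sub (hI (hpos.growth.pow 2)) j1, integral_mix_sq ν ha h,
      integral_sub ((hI hpos.growth).const_mul 2) (integrable_const _), integral_const_mul,
      integral_mix ν ha h]
    norm_num
  have hle2 : ∫ y, (mix h a ν y - 1) ^ 2 ∂gaussPi K h ≤ A * Real.exp 1 * δ ^ 2 := by
    rw [e2]
    have hb : ∀ q : X × X, ‖Real.exp (h * gram a q.1 q.2) - 1‖ ≤ A * Real.exp 1 * δ ^ 2 := by
      intro q
      have h1 : |(h : ℝ) * gram a q.1 q.2| ≤ h * A := by
        rw [abs_mul, abs_of_nonneg h.coe_nonneg]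
        exact mul_le_mul_of_nonneg_left (ha.abs_gram_le _ _) h.coe_nonneg
      refine (abs_exp_sub_one_le _).trans ?_
      calc _ ≤ (h * A) * Real.exp 1 := by
            gcongr
            exact h1.trans hA
        _ = _ := by rw [hh]; ring
    have hi : Integrable (fun q : X × X => Real.exp (h * gram a q.1 q.2)) (ν.prod ν) := by
      refine Integrable.of_bound (ha.measurable_gram.const_mul _).exp.aestronglyMeasurable
        (A * Real.exp 1 * δ ^ 2 + 1) (ae_of_all _ fun q => ?_)
      have := hb q
      rw [Real.norm_eq_abs] at this ⊢
      rw [Real.abs_exp]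
      linarith [(abs_le.1 this).2]
    have := norm_integral_le_of_norm_le_const (μ := ν.prod ν) (ae_of_all _ hb)
    rw [integral_sub hi (integrable_const _), probReal_univ, mul_one] at this
    simpa using (le_abs_self _).trans this
  have hle4 : ∫ y, (mix h a ν y - 1) ^ 4 ∂gaussPi K h ≤ 78 * Real.exp 6 * A ^ 2 * δ ^ 4 := by
    refine (integral_mix_sub_one_four_le ν ha h hA).trans (le_of_eq ?_)
    rw [hh]; ring
  have e3 : ∫ y, (mix h a ν y ^ p - 1 - p * (mix h a ν y - 1) + p * (1 - p) / 2 *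
      (mix h a ν y - 1) ^ 2) ∂gaussPi K h = ∫ y, mix h a ν y ^ p ∂gaussPi K h - 1 +
      p * (1 - p) / 2 * (∫ q, Real.exp (h * gram a q.1 q.2) ∂(ν.prod ν) - 1) := by
    have g2 := (ExpGrowth.const (N := noiseSize (K := K)) p).mul g1
    have j1 : Integrable (fun y => mix h a ν y ^ p - 1) (gaussPi K h) := hI (gp.sub (.const 1))
    rw [integral_add (hI ((gp.sub (.const 1)).sub g2)) ((hI (g1.pow 2)).const_mul _),
      integral_sub j1 (hI g2), integral_sub (hI gp) (integrable_const _), integral_const_mul,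
      integral_const_mul, integral_sub (hI hpos.growth) (integrable_const _),
      integral_mix ν ha h, e2]
    simp
  have g4 := (((ExpGrowth.const (N := noiseSize (K := K)) δ).mul (g1.pow 2)).add
    ((g1.pow 4).mul (.const δ⁻¹))).mul (.const 2⁻¹)
  have h5 := norm_integral_le_of_norm_le ((hI g4).const_mul B)
    (f := fun y => mix h a ν y ^ p - 1 - p * (mix h a ν y - 1) + p * (1 - p) / 2 *
      (mix h a ν y - 1) ^ 2) (ae_of_all _ fun y => by
      refine (hBp _ (hpos.pos y).le).trans (mul_le_mul_of_nonneg_left ?_ hB)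
      simpa [div_eq_mul_inv] using abs_cube_le hδ (mix h a ν y - 1))
  rw [e3, integral_const_mul, integral_mul_const, integral_add ((hI (g1.pow 2)).const_mul δ)
    ((hI (g1.pow 4)).mul_const _), integral_const_mul, integral_mul_const, Real.norm_eq_abs] at h5
  refine h5.trans ?_
  have b1 := mul_le_mul_of_nonneg_left hle2 hδ.le
  have b2 := mul_le_mul_of_nonneg_right hle4 (inv_pos.2 hδ).le
  have b3 : 78 * Real.exp 6 * A ^ 2 * δ ^ 4 * δ⁻¹ = 78 * Real.exp 6 * A ^ 2 * δ ^ 3 := by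
    field_simp
  rw [b3] at b2
  have := mul_le_mul_of_nonneg_left (add_le_add b1 b2) hB
  linarith

end Comparison
end SpikedWigner

namespace SpikedWigner

section Comparison

open scoped NNReal ENNReal

variable {X K K' : Type*} [MeasurableSpace X] [Fintype K] [Fintype K']

theorem integrable_exp_gram {a : X → K → ℝ} {A : ℝ} (ha : IsField a A) (h : ℝ≥0) (ν : Measure X)
    [IsProbabilityMeasure ν] :
    Integrable (fun q : X × X => Real.exp (h * gram a q.1 q.2)) (ν.prod ν) := by
  refine Integrable.of_bound (ha.measurable_gram.const_mul _).exp.aestronglyMeasurable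
    (Real.exp (h * A)) (ae_of_all _ fun q => ?_)
  rw [Real.norm_eq_abs, Real.abs_exp]
  exact Real.exp_le_exp.2 (mul_le_mul_of_nonneg_left
    ((le_abs_self _).trans (ha.abs_gram_le _ _)) h.coe_nonneg)

theorem exp_sub_exp_le {s t A k h : ℝ} (hst : t ≤ s + k) (hs : |s| ≤ A) (hk : 0 ≤ k)
    (h0 : 0 ≤ h) (h1 : h ≤ 1) (hA : h * A ≤ 1) (hk1 : h * k ≤ 1) :
    Real.exp (h * t) - Real.exp (h * s) ≤ h * k + h ^ 2 * ((k ^ 2 + A * k) * Real.exp 1 +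
      A * k ^ 2 * Real.exp 1 ^ 2) := by
  have hA0 : 0 ≤ A := (abs_nonneg s).trans hs
  have e1 : Real.exp (h * t) ≤ Real.exp (h * s) * Real.exp (h * k) := by
    rw [← Real.exp_add, ← mul_add]
    exact Real.exp_le_exp.2 (mul_le_mul_of_nonneg_left hst h0)
  have hhs : |h * s| ≤ h * A := by
    rw [abs_mul, abs_of_nonneg h0]
    exact mul_le_mul_of_nonneg_left hs h0
  have e2 : Real.exp (h * s) ≤ 1 + h * A * Real.exp 1 := by
    have := (abs_le.1 (abs_exp_sub_one_le (h * s))).2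
    have h2 : |h * s| * Real.exp |h * s| ≤ h * A * Real.exp 1 :=
      mul_le_mul hhs (Real.exp_le_exp.2 (hhs.trans hA)) (Real.exp_pos _).le (by positivity)
    linarith
  have e3 : Real.exp (h * k) - 1 ≤ h * k + (h * k) ^ 2 * Real.exp 1 := by
    have := (abs_le.1 (abs_exp_sub_one_sub_le (h * k))).2
    have h2 : |h * k| ^ 2 * Real.exp |h * k| ≤ (h * k) ^ 2 * Real.exp 1 := by
      rw [sq_abs, abs_of_nonneg (by positivity)]
      gcongr
    linarith
  have e4 : 0 ≤ Real.exp (h * k) - 1 := by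
    have := Real.add_one_le_exp (h * k)
    have : 0 ≤ h * k := by positivity
    linarith
  have e5 := mul_le_mul e2 e3 e4 (by positivity)
  have e6 : h ^ 3 * (A * k ^ 2 * Real.exp 1 ^ 2) ≤ h ^ 2 * (A * k ^ 2 * Real.exp 1 ^ 2) :=
    mul_le_mul_of_nonneg_right (pow_le_pow_of_le_one h0 h1 (by norm_num)) (by positivity)
  calc Real.exp (h * t) - Real.exp (h * s) ≤ Real.exp (h * s) * (Real.exp (h * k) - 1) := by linarith
    _ ≤ _ := e5
    _ = h * k + h ^ 2 * ((k ^ 2 + A * k) * Real.exp 1) + h ^ 3 * (A * k ^ 2 * Real.exp 1 ^ 2) := by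
      ring
    _ ≤ _ := by linarith

set_option maxHeartbeats 1000000 in
/-- One step of the comparison of fractional moments for fields of small variance. -/
theorem exists_mix_rpow_step {p : ℝ} (hp : 0 < p) (hp1 : p < 1) {a : X → K → ℝ} {c : X → K' → ℝ}
    {A k : ℝ} (ha : IsField a A) (hc : IsField c A) (hk : 0 ≤ k)
    (hac : ∀ x x', gram c x x' ≤ gram a x x' + k) :
    ∃ C δ₀ : ℝ, 0 ≤ C ∧ 0 < δ₀ ∧ ∀ (ν : Measure X) [IsProbabilityMeasure ν] (δ : ℝ) (h : ℝ≥0),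
      0 < δ → δ ≤ δ₀ → (h : ℝ) = δ ^ 2 →
      ∫ y, mix h a ν y ^ p ∂gaussPi K h ≤
        Real.exp (p * (1 - p) / 2 * k * δ ^ 2 + C * δ ^ 3) *
          ∫ y, mix h c ν y ^ p ∂gaussPi K' h := by
  obtain ⟨C₁, hC₁, h₁⟩ := exists_abs_integral_mix_rpow_sub_le (X := X) (K := K) hp hp1 A
  obtain ⟨C₂, hC₂, h₂⟩ := exists_abs_integral_mix_rpow_sub_le (X := X) (K := K') hp hp1 A
  have hA := ha.nonneg
  set C₃ := (k ^ 2 + A * k) * Real.exp 1 + A * k ^ 2 * Real.exp 1 ^ 2 with hC₃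
  have hC₃0 : 0 ≤ C₃ := by positivity
  set C₄ := C₁ + C₂ + C₃ with hC₄
  set D := A * Real.exp 1 + C₂ with hD
  have hD0 : 0 ≤ D := by positivity
  have hC₄0 : 0 ≤ C₄ := by positivity
  have hpos : 0 < 1 + A + k + 2 * D := by positivity
  refine ⟨C₄ + 2 * D * (k + C₄), 1 / (1 + A + k + 2 * D), by positivity, by positivity, ?_⟩
  intro ν _ δ h hδ hδ0 hh
  have hδ1 : δ * (1 + A + k + 2 * D) ≤ 1 := by rwa [le_div_iff₀ hpos] at hδ0
  have hdA : 0 ≤ δ * A := by positivity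
  have hdk : 0 ≤ δ * k := by positivity
  have hdD : 0 ≤ δ * D := by positivity
  have hδ2 : δ ≤ 1 := by nlinarith
  have hsq : δ ^ 2 ≤ δ := by nlinarith
  have hA1 : h * A ≤ 1 := by rw [hh]; nlinarith
  have hk1 : h * k ≤ 1 := by rw [hh]; nlinarith
  have hD1 : D * δ ^ 2 ≤ 1 / 2 := by nlinarith
  have hh0 : (0 : ℝ) ≤ h := h.coe_nonneg
  have hh1 : (h : ℝ) ≤ 1 := by rw [hh]; nlinarith
  have b1 := abs_le.1 (h₁ a ha ν δ h hδ hδ2 hh hA1)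
  have b2 := abs_le.1 (h₂ c hc ν δ h hδ hδ2 hh hA1)
  set q := p * (1 - p) / 2 with hq
  have hq0 : 0 ≤ q := by rw [hq]; nlinarith
  have hq1 : q ≤ 1 := by rw [hq]; nlinarith
  set Ia := ∫ y, mix h a ν y ^ p ∂gaussPi K h
  set Ic := ∫ y, mix h c ν y ^ p ∂gaussPi K' h
  set Va := ∫ q, Real.exp (h * gram a q.1 q.2) ∂(ν.prod ν) with hVa
  set Vc := ∫ q, Real.exp (h * gram c q.1 q.2) ∂(ν.prod ν) with hVc
  have ia := integrable_exp_gram ha h ν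
  have ic := integrable_exp_gram hc h ν
  have d43 : δ ^ 4 ≤ δ ^ 3 := pow_le_pow_of_le_one hδ.le hδ2 (by norm_num)
  have d53 : δ ^ 5 ≤ δ ^ 3 := pow_le_pow_of_le_one hδ.le hδ2 (by norm_num)
  have d32 : δ ^ 3 ≤ δ ^ 2 := pow_le_pow_of_le_one hδ.le hδ2 (by norm_num)
  have hV : Vc - Va ≤ k * δ ^ 2 + C₃ * δ ^ 3 := by
    rw [hVc, hVa, ← integral_sub ic ia]
    have := integral_mono (μ := ν.prod ν) (ic.sub ia) (integrable_const _) fun w =>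
      exp_sub_exp_le (hac w.1 w.2) (ha.abs_gram_le w.1 w.2) hk hh0 hh1 hA1 hk1
    simp only [integral_const, probReal_univ, one_smul, ← hC₃] at this
    refine this.trans ?_
    have e := mul_le_mul_of_nonneg_left d43 hC₃0
    rw [hh, show (δ ^ 2) ^ 2 = δ ^ 4 by ring]
    linarith
  have hVc1 : Vc - 1 ≤ A * Real.exp 1 * δ ^ 2 := by
    have hb : ∀ w : X × X, Real.exp (h * gram c w.1 w.2) ≤ 1 + A * Real.exp 1 * δ ^ 2 := fun w => by
      have hhs : |h * gram c w.1 w.2| ≤ h * A := by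
        rw [abs_mul, abs_of_nonneg hh0]
        exact mul_le_mul_of_nonneg_left (hc.abs_gram_le _ _) hh0
      have := (abs_le.1 (abs_exp_sub_one_le (h * gram c w.1 w.2))).2
      have h2 : |h * gram c w.1 w.2| * Real.exp |h * gram c w.1 w.2| ≤ h * A * Real.exp 1 :=
        mul_le_mul hhs (Real.exp_le_exp.2 (hhs.trans hA1)) (Real.exp_pos _).le (by positivity)
      rw [hh] at h2 this
      rw [hh]
      linarith
    have := integral_mono (μ := ν.prod ν) ic (integrable_const _) hb
    simp only [integral_const, probReal_univ, one_smul] at this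
    linarith
  have hIa : Ia ≤ Ic + q * k * δ ^ 2 + C₄ * δ ^ 3 := by
    have : q * (Vc - Va) ≤ q * (k * δ ^ 2 + C₃ * δ ^ 3) := mul_le_mul_of_nonneg_left hV hq0
    have h3 : q * (C₃ * δ ^ 3) ≤ 1 * (C₃ * δ ^ 3) :=
      mul_le_mul_of_nonneg_right hq1 (by positivity)
    rw [hC₄]
    linarith [b1.2, b2.1]
  have hIc : 1 - D * δ ^ 2 ≤ Ic := by
    have : q * (Vc - 1) ≤ A * Real.exp 1 * δ ^ 2 := by
      have h3 : 0 ≤ A * Real.exp 1 * δ ^ 2 := by positivity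
      have h4 := mul_le_mul_of_nonneg_right hq1 h3
      have h5 := mul_le_mul_of_nonneg_left hVc1 hq0
      linarith
    have h4 := mul_le_mul_of_nonneg_left d32 hC₂
    rw [hD]
    linarith [b2.1]
  set r := q * k * δ ^ 2 + C₄ * δ ^ 3 with hr
  have hr0 : 0 ≤ r := by positivity
  set s := q * k * δ ^ 2 + (C₄ + 2 * D * (k + C₄)) * δ ^ 3 with hs
  have hrs : r * (1 + 2 * (D * δ ^ 2)) ≤ s := by
    have e1 : 2 * D * (q * k) * δ ^ 4 ≤ 2 * D * k * δ ^ 3 := by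
      have : 2 * D * (q * k) ≤ 2 * D * k := by
        have := mul_le_mul_of_nonneg_right hq1 (show 0 ≤ 2 * D * k by positivity)
        linarith
      exact mul_le_mul this d43 (by positivity) (by positivity)
    have e2 : 2 * D * C₄ * δ ^ 5 ≤ 2 * D * C₄ * δ ^ 3 :=
      mul_le_mul_of_nonneg_left d53 (by positivity)
    rw [hr, hs]
    linarith
  have hfin : Ic + r ≤ (1 + r * (1 + 2 * (D * δ ^ 2))) * Ic := by
    have hu : 0 ≤ D * δ ^ 2 := by positivity
    have h5 : 1 ≤ (1 + 2 * (D * δ ^ 2)) * Ic := by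
      have h6 := mul_le_mul_of_nonneg_left hIc (show 0 ≤ 1 + 2 * (D * δ ^ 2) by positivity)
      have h7 := mul_le_mul_of_nonneg_right hD1 hu
      linarith
    have h8 := mul_le_mul_of_nonneg_left h5 hr0
    linarith
  have hIc0 : 0 ≤ Ic := by linarith
  calc Ia ≤ Ic + r := by linarith
    _ ≤ (1 + r * (1 + 2 * (D * δ ^ 2))) * Ic := hfin
    _ ≤ Real.exp s * Ic := by
      refine mul_le_mul_of_nonneg_right ?_ hIc0
      linarith [Real.add_one_le_exp s]

theorem lintegral_weighted_rpow {a : X → K → ℝ} {A p : ℝ} (ha : IsField a A) (μ : Measure X)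
    [IsFiniteMeasure μ] [NeZero μ] {w : X → ℝ} (hw : Integrable (fun x => Real.exp (w x)) μ)
    {h : ℝ≥0} :
    ∫⁻ y, ENNReal.ofReal ((∫ x, Real.exp (w x) * lr h (a x) y ∂μ) ^ p) ∂gaussPi K h =
      ENNReal.ofReal ((∫ x, Real.exp (w x) ∂μ) ^ p *
        ∫ y, mix h a (μ.tilted w) y ^ p ∂gaussPi K h) := by
  have hprob : IsProbabilityMeasure (μ.tilted w) := isProbabilityMeasure_tilted hw
  set m := ∫ x, Real.exp (w x) ∂μ with hm
  have hm0 : 0 < m := integral_exp_pos hw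
  have hpos := expPos_mix (μ.tilted w) ha h
  have e : ∀ y, (∫ x, Real.exp (w x) * lr h (a x) y ∂μ) ^ p =
      m ^ p * mix h a (μ.tilted w) y ^ p := by
    intro y
    rw [← Real.mul_rpow hm0.le (hpos.pos y).le]
    congr 1
    rw [mix, integral_tilted, ← integral_const_mul]
    refine integral_congr_ae (ae_of_all _ fun x => ?_)
    simp only [smul_eq_mul, ← hm]
    field_simp
  simp_rw [e]
  rw [← integral_const_mul, ofReal_integral_eq_lintegral_ofReal]
  · exact ((hpos.rpow p).growth.integrable (expIntegrable_gaussPi h)).const_mul _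
  · exact ae_of_all _ fun y => mul_nonneg (Real.rpow_nonneg hm0.le _)
      (Real.rpow_nonneg (hpos.pos y).le _)

theorem exists_weighted_rpow_step {p : ℝ} (hp : 0 < p) (hp1 : p < 1) {a : X → K → ℝ}
    {c : X → K' → ℝ} {A k : ℝ} (ha : IsField a A) (hc : IsField c A) (hk : 0 ≤ k)
    (hac : ∀ x x', gram c x x' ≤ gram a x x' + k) (μ : Measure X) [IsFiniteMeasure μ] :
    ∃ C δ₀ : ℝ, 0 ≤ C ∧ 0 < δ₀ ∧ ∀ (w : X → ℝ), Integrable (fun x => Real.exp (w x)) μ →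
      ∀ (δ : ℝ) (h : ℝ≥0), 0 < δ → δ ≤ δ₀ → (h : ℝ) = δ ^ 2 →
      ∫⁻ y, ENNReal.ofReal ((∫ x, Real.exp (w x) * lr h (a x) y ∂μ) ^ p) ∂gaussPi K h ≤
        ENNReal.ofReal (Real.exp (p * (1 - p) / 2 * k * δ ^ 2 + C * δ ^ 3)) *
        ∫⁻ y, ENNReal.ofReal ((∫ x, Real.exp (w x) * lr h (c x) y ∂μ) ^ p) ∂gaussPi K' h := by
  obtain ⟨C, δ₀, hC, hδ₀, hstep⟩ := exists_mix_rpow_step hp hp1 ha hc hk hac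
  refine ⟨C, δ₀, hC, hδ₀, fun w hw δ h hδ hδ1 hh => ?_⟩
  rcases eq_or_ne μ 0 with rfl | hμ
  · simp [Real.zero_rpow hp.ne']
  have : NeZero μ := ⟨hμ⟩
  have hprob : IsProbabilityMeasure (μ.tilted w) := isProbabilityMeasure_tilted hw
  rw [lintegral_weighted_rpow ha μ hw, lintegral_weighted_rpow hc μ hw,
    ← ENNReal.ofReal_mul (Real.exp_pos _).le]
  have hm0 : 0 < ∫ x, Real.exp (w x) ∂μ := integral_exp_pos hw
  refine ENNReal.ofReal_le_ofReal ?_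
  have := mul_le_mul_of_nonneg_left (hstep (μ.tilted w) δ h hδ hδ1 hh)
    (Real.rpow_nonneg hm0.le p)
  linarith

theorem lr_add (u h : ℝ≥0) (b y z : K → ℝ) : lr (u + h) b (y + z) = lr u b y * lr h b z := by
  rw [lr, lr, lr, ← Real.exp_add]
  congr 1
  simp only [Pi.add_apply, mul_add, Finset.sum_add_distrib, NNReal.coe_add]
  ring

/-- The fractional power of the partition function with two independent fields. -/
noncomputable def twoFieldPow (a : X → K → ℝ) (c : X → K' → ℝ) (μ : Measure X) (p : ℝ)
    (u v : ℝ≥0) (y : K → ℝ) (y' : K' → ℝ) : ℝ≥0∞ :=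
  ENNReal.ofReal ((∫ x, lr u (a x) y * lr v (c x) y' ∂μ) ^ p)

theorem measurable_twoFieldPow {a : X → K → ℝ} {c : X → K' → ℝ} (ha : Measurable a)
    (hc : Measurable c) (μ : Measure X) [IsFiniteMeasure μ] (p : ℝ) (u v : ℝ≥0) :
    Measurable fun w : (K → ℝ) × (K' → ℝ) => twoFieldPow a c μ p u v w.1 w.2 := by
  unfold twoFieldPow
  refine ENNReal.measurable_ofReal.comp (Measurable.pow_const ?_ p)
  refine StronglyMeasurable.measurable (StronglyMeasurable.integral_prod_right'
    (f := fun w : ((K → ℝ) × (K' → ℝ)) × X => lr u (a w.2) w.1.1 * lr v (c w.2) w.1.2) ?_)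
  refine Measurable.stronglyMeasurable ?_
  fun_prop

theorem measurable_twoFieldPow_comp {Y : Type*} [MeasurableSpace Y] {a : X → K → ℝ}
    {c : X → K' → ℝ} (ha : Measurable a) (hc : Measurable c) (μ : Measure X) [IsFiniteMeasure μ]
    (p : ℝ) (u v : ℝ≥0) {f : Y → K → ℝ} {g : Y → K' → ℝ} (hf : Measurable f) (hg : Measurable g) :
    Measurable fun y => twoFieldPow a c μ p u v (f y) (g y) :=
  Measurable.comp (g := fun w : (K → ℝ) × (K' → ℝ) => twoFieldPow a c μ p u v w.1 w.2)
    (f := fun y => (f y, g y)) (measurable_twoFieldPow ha hc μ p u v) (hf.prodMk hg)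

theorem measurable_lintegral_twoFieldPow {a : X → K → ℝ} {c : X → K' → ℝ} (ha : Measurable a)
    (hc : Measurable c) (μ : Measure X) [IsFiniteMeasure μ] (p : ℝ) (u v s : ℝ≥0) :
    Measurable fun y : K → ℝ => ∫⁻ y', twoFieldPow a c μ p u v y y' ∂gaussPi K' s :=
  (measurable_twoFieldPow ha hc μ p u v).lintegral_prod_right'

/-- The fractional moment of the partition function with two independent fields. -/
noncomputable def twoFieldMoment (a : X → K → ℝ) (c : X → K' → ℝ) (μ : Measure X) (p : ℝ)
    (u v : ℝ≥0) : ℝ≥0∞ :=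
  ∫⁻ y, ∫⁻ y', twoFieldPow a c μ p u v y y' ∂gaussPi K' v ∂gaussPi K u

theorem integrable_lr_mul_lr {a : X → K → ℝ} {c : X → K' → ℝ} {A : ℝ} (ha : IsField a A)
    (hc : IsField c A) (μ : Measure X) [IsFiniteMeasure μ] (u v : ℝ≥0) (y : K → ℝ) (y' : K' → ℝ) :
    Integrable (fun x => lr u (a x) y * lr v (c x) y') μ := by
  have h1 : ExpGrowth (fun w : X × ((K → ℝ) × (K' → ℝ)) => noiseSize w.2.1 + noiseSize w.2.2)
      (fun w => lr u (a w.1) w.2.1 * lr v (c w.1) w.2.2) := by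
    refine ExpGrowth.mul ?_ ?_
    · refine (ha.expPos_lr u).growth.comp (φ := fun w : X × ((K → ℝ) × (K' → ℝ)) => (w.1, w.2.1))
        (by fun_prop) fun w => ?_
      rw [abs_of_nonneg (show 0 ≤ noiseSize w.2.1 by unfold noiseSize; positivity),
        abs_of_nonneg (by unfold noiseSize; positivity)]
      exact le_add_of_nonneg_right (by unfold noiseSize; positivity)
    · refine (hc.expPos_lr v).growth.comp (φ := fun w : X × ((K → ℝ) × (K' → ℝ)) => (w.1, w.2.2))
        (by fun_prop) fun w => ?_
      rw [abs_of_nonneg (show 0 ≤ noiseSize w.2.2 by unfold noiseSize; positivity),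
        abs_of_nonneg (by unfold noiseSize; positivity)]
      exact le_add_of_nonneg_left (by unfold noiseSize; positivity)
  exact ExpGrowth.integrable_section (N := fun w : (K → ℝ) × (K' → ℝ) =>
    noiseSize w.1 + noiseSize w.2) h1 μ (y, y')

theorem twoFieldMoment_exchange {a : X → K → ℝ} {c : X → K' → ℝ} {A p : ℝ} (ha : IsField a A)
    (hc : IsField c A) (μ : Measure X) [IsFiniteMeasure μ] (u v h : ℝ≥0) {E : ℝ≥0∞}
    (hE : ∀ (w : X → ℝ), Integrable (fun x => Real.exp (w x)) μ →
      ∫⁻ y, ENNReal.ofReal ((∫ x, Real.exp (w x) * lr h (a x) y ∂μ) ^ p) ∂gaussPi K h ≤ E *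
        ∫⁻ y, ENNReal.ofReal ((∫ x, Real.exp (w x) * lr h (c x) y ∂μ) ^ p) ∂gaussPi K' h) :
    twoFieldMoment a c μ p (u + h) v ≤ E * twoFieldMoment a c μ p u (v + h) := by
  have ham := ha.meas
  have hcm := hc.meas
  have hswap : ∀ y : K → ℝ,
      ∫⁻ z, ∫⁻ y', twoFieldPow a c μ p (u + h) v (y + z) y' ∂gaussPi K' v ∂gaussPi K h =
      ∫⁻ y', ∫⁻ z, twoFieldPow a c μ p (u + h) v (y + z) y' ∂gaussPi K h ∂gaussPi K' v := fun y =>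
    lintegral_lintegral_swap (measurable_twoFieldPow_comp ham hcm μ p (u + h) v
      (f := fun w : (K → ℝ) × (K' → ℝ) => y + w.1) (g := Prod.snd)
      (measurable_const.add measurable_fst) measurable_snd).aemeasurable
  have hadd : ∀ y : K → ℝ, ∫⁻ y', twoFieldPow a c μ p u (v + h) y y' ∂gaussPi K' (v + h) =
      ∫⁻ y', ∫⁻ z, twoFieldPow a c μ p u (v + h) y (y' + z) ∂gaussPi K' h ∂gaussPi K' v := fun y =>
    lintegral_gaussPi_add v h (measurable_twoFieldPow_comp ham hcm μ p u (v + h)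
      measurable_const measurable_id)
  have hpt : ∀ (y : K → ℝ) (y' : K' → ℝ),
      ∫⁻ z, twoFieldPow a c μ p (u + h) v (y + z) y' ∂gaussPi K h ≤
        E * ∫⁻ z, twoFieldPow a c μ p u (v + h) y (y' + z) ∂gaussPi K' h := by
    intro y y'
    have hw : ∀ x, lr u (a x) y * lr v (c x) y' =
        Real.exp (Real.log (lr u (a x) y * lr v (c x) y')) := fun x =>
      (Real.exp_log (mul_pos (lr_pos _ _ _) (lr_pos _ _ _))).symm
    have hi : Integrable (fun x => Real.exp (Real.log (lr u (a x) y * lr v (c x) y'))) μ := by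
      simp_rw [← hw]
      exact integrable_lr_mul_lr ha hc μ u v y y'
    have := hE _ hi
    simp_rw [← hw] at this
    refine le_of_eq_of_le ?_ (this.trans (le_of_eq ?_))
    · refine lintegral_congr fun z => ?_
      rw [twoFieldPow]
      congr 2
      refine integral_congr_ae (ae_of_all _ fun x => ?_)
      simp only [lr_add]
      ring
    · congr 1
      refine lintegral_congr fun z => ?_
      rw [twoFieldPow]
      congr 2
      refine integral_congr_ae (ae_of_all _ fun x => ?_)
      simp only [lr_add]
      ring
  calc twoFieldMoment a c μ p (u + h) v
      = ∫⁻ y, ∫⁻ z, ∫⁻ y', twoFieldPow a c μ p (u + h) v (y + z) y' ∂gaussPi K' v ∂gaussPi K h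
          ∂gaussPi K u :=
        lintegral_gaussPi_add u h (measurable_lintegral_twoFieldPow ham hcm μ p (u + h) v v)
    _ ≤ ∫⁻ y, E * ∫⁻ y', twoFieldPow a c μ p u (v + h) y y' ∂gaussPi K' (v + h) ∂gaussPi K u := by
        refine lintegral_mono fun y => ?_
        rw [hswap y, hadd y, ← lintegral_const_mul]
        · exact lintegral_mono fun y' => hpt y y'
        · exact Measurable.lintegral_prod_right' (measurable_twoFieldPow_comp ham hcm μ p u (v + h)
            (f := fun _ : (K' → ℝ) × (K' → ℝ) => y) (g := fun w => w.1 + w.2)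
            measurable_const (measurable_fst.add measurable_snd))
    _ = E * twoFieldMoment a c μ p u (v + h) :=
        lintegral_const_mul _ (measurable_lintegral_twoFieldPow ham hcm μ p u (v + h) (v + h))

theorem gaussPi_zero : gaussPi K 0 = Measure.dirac 0 := by
  have := Measure.pi_map_pi (μ := fun _ : K => gaussianReal 0 1) (f := fun _ _ => (0 : ℝ))
      (fun k => by fun_prop)
  simp only [Measure.map_const, measure_univ, one_smul] at this
  rw [gaussPi, gaussianReal_zero_var]
  exact this.symm

/-- Kahane's comparison inequality for fractional moments. -/
theorem lintegral_rpow_le_of_gram_le {a : X → K → ℝ} {c : X → K' → ℝ} {A k p : ℝ} (hp : 0 < p)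
    (hp1 : p < 1) (ha : IsField a A) (hc : IsField c A) (hk : 0 ≤ k)
    (hac : ∀ x x', gram c x x' ≤ gram a x x' + k) (μ : Measure X) [IsFiniteMeasure μ] :
    ∫⁻ y, ENNReal.ofReal ((∫ x, lr 1 (a x) y ∂μ) ^ p) ∂gaussPi K 1 ≤
      ENNReal.ofReal (Real.exp (p * (1 - p) / 2 * k)) *
        ∫⁻ y, ENNReal.ofReal ((∫ x, lr 1 (c x) y ∂μ) ^ p) ∂gaussPi K' 1 := by
  obtain ⟨C, δ₀, hC, hδ₀, hstep⟩ := exists_weighted_rpow_step hp hp1 ha hc hk hac μ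
  have hl : ∀ b : K → ℝ, lr 0 b 0 = 1 := fun b => by simp [lr]
  have hl' : ∀ b : K' → ℝ, lr 0 b 0 = 1 := fun b => by simp [lr]
  have h0 : twoFieldMoment a c μ p 1 0 =
      ∫⁻ y, ENNReal.ofReal ((∫ x, lr 1 (a x) y ∂μ) ^ p) ∂gaussPi K 1 := by
    unfold twoFieldMoment
    rw [gaussPi_zero]
    refine lintegral_congr fun y => ?_
    rw [lintegral_dirac' _ (measurable_twoFieldPow_comp ha.meas hc.meas μ p 1 0
      (f := fun _ => y) (g := fun y' => y') measurable_const measurable_id), twoFieldPow]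
    simp only [hl', mul_one]
  have h1 : twoFieldMoment a c μ p 0 1 =
      ∫⁻ y, ENNReal.ofReal ((∫ x, lr 1 (c x) y ∂μ) ^ p) ∂gaussPi K' 1 := by
    unfold twoFieldMoment
    rw [gaussPi_zero, lintegral_dirac'
      _ (measurable_lintegral_twoFieldPow ha.meas hc.meas μ p 0 1 1)]
    simp only [twoFieldPow, hl, one_mul]
  rw [← h0, ← h1]
  have hn : ∀ n : ℕ, 0 < n → 1 / √n ≤ δ₀ → twoFieldMoment a c μ p 1 0 ≤
      ENNReal.ofReal (Real.exp (p * (1 - p) / 2 * k + C * (1 / √n))) *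
        twoFieldMoment a c μ p 0 1 := by
    intro n hn hδ
    have hn0 : (0 : ℝ) < n := by exact_mod_cast hn
    have hsq : √(n : ℝ) ^ 2 = n := Real.sq_sqrt hn0.le
    have hsn : 0 < √(n : ℝ) := Real.sqrt_pos.2 hn0
    set E := ENNReal.ofReal (Real.exp (p * (1 - p) / 2 * k * (1 / √(n : ℝ)) ^ 2 +
      C * (1 / √(n : ℝ)) ^ 3)) with hE
    have hit : ∀ (j : ℕ) (v : ℝ≥0), twoFieldMoment a c μ p (j * (n : ℝ≥0)⁻¹) v ≤
        E ^ j * twoFieldMoment a c μ p 0 (v + j * (n : ℝ≥0)⁻¹) := by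
      intro j
      induction j with
      | zero => intro v; simp
      | succ j ih =>
        intro v
        have e1 : ((j + 1 : ℕ) : ℝ≥0) * (n : ℝ≥0)⁻¹ = j * (n : ℝ≥0)⁻¹ + (n : ℝ≥0)⁻¹ := by
          push_cast; ring
        rw [e1]
        refine (twoFieldMoment_exchange ha hc μ _ v (n : ℝ≥0)⁻¹ (E := E) fun w hw =>
          hstep w hw (1 / √(n : ℝ)) (n : ℝ≥0)⁻¹ (by positivity) hδ ?_).trans ?_
        · rw [div_pow, hsq]; simp
        · rw [pow_succ', mul_assoc]
          refine mul_le_mul_right ((ih _).trans (le_of_eq ?_)) _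
          rw [add_assoc, add_comm (n : ℝ≥0)⁻¹]
    have := hit n 0
    rw [mul_inv_cancel₀ (by exact_mod_cast hn.ne'), zero_add] at this
    refine this.trans (le_of_eq ?_)
    congr 1
    rw [hE, ← ENNReal.ofReal_pow (Real.exp_pos _).le, ← Real.exp_nat_mul]
    congr 2
    have : (n : ℝ) * (1 / √(n : ℝ)) ^ 2 = 1 := by rw [div_pow, hsq]; field_simp
    calc _ = p * (1 - p) / 2 * k * (n * (1 / √(n : ℝ)) ^ 2) +
          C * (1 / √(n : ℝ)) * (n * (1 / √(n : ℝ)) ^ 2) := by ring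
      _ = _ := by rw [this]; ring
  have ht : Tendsto (fun n : ℕ => 1 / √(n : ℝ)) atTop (𝓝 0) := by
    simp only [one_div]
    exact tendsto_inv_atTop_zero.comp (Real.tendsto_sqrt_atTop.comp tendsto_natCast_atTop_atTop)
  have ht2 : Tendsto (fun n : ℕ => ENNReal.ofReal (Real.exp (p * (1 - p) / 2 * k + C * (1 / √(n : ℝ)))) *
      twoFieldMoment a c μ p 0 1) atTop (𝓝 (ENNReal.ofReal (Real.exp (p * (1 - p) / 2 * k)) *
      twoFieldMoment a c μ p 0 1)) := by
    refine ENNReal.Tendsto.mul_const ?_ (Or.inl ?_)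
    · refine ENNReal.tendsto_ofReal ((Real.continuous_exp.tendsto _).comp ?_)
      simpa using (ht.const_mul C).const_add (p * (1 - p) / 2 * k)
    · simp [Real.exp_pos]
  refine ge_of_tendsto ht2 ?_
  filter_upwards [eventually_gt_atTop 0, ht.eventually_le_const hδ₀] with n h1 h2
  exact hn n h1 h2

end Comparison
end SpikedWigner



namespace SpikedWigner
open scoped NNReal ENNReal

section Bounded
variable {Z Z' : Type*} [MeasurableSpace Z] [MeasurableSpace Z'] {f g : Z → ℝ}

/-- Bounded measurable functions. -/
def BddMeas (f : Z → ℝ) : Prop := Measurable f ∧ ∃ B : ℝ, ∀ z, |f z| ≤ B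

theorem BddMeas.const (c : ℝ) : BddMeas fun _ : Z => c := ⟨measurable_const, |c|, fun _ => le_rfl⟩

theorem BddMeas.mul (hf : BddMeas f) (hg : BddMeas g) : BddMeas fun z => f z * g z := by
  obtain ⟨hfm, B, hB⟩ := hf
  obtain ⟨hgm, C, hC⟩ := hg
  refine ⟨hfm.mul hgm, B * C, fun z => ?_⟩
  rw [abs_mul]
  exact mul_le_mul (hB z) (hC z) (abs_nonneg _) ((abs_nonneg _).trans (hB z))

theorem BddMeas.add (hf : BddMeas f) (hg : BddMeas g) : BddMeas fun z => f z + g z := by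
  obtain ⟨hfm, B, hB⟩ := hf
  obtain ⟨hgm, C, hC⟩ := hg
  exact ⟨hfm.add hgm, B + C, fun z => (abs_add_le _ _).trans (add_le_add (hB z) (hC z))⟩

theorem BddMeas.abs (hf : BddMeas f) : BddMeas fun z => |f z| := by
  obtain ⟨hfm, B, hB⟩ := hf
  exact ⟨hfm.abs, B, fun z => by rw [abs_abs]; exact hB z⟩

theorem BddMeas.pow (hf : BddMeas f) (k : ℕ) : BddMeas fun z => f z ^ k := by
  obtain ⟨hfm, B, hB⟩ := hf
  exact ⟨hfm.pow_const k, B ^ k, fun z => by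
    rw [abs_pow]; exact pow_le_pow_left₀ (abs_nonneg _) (hB z) k⟩

theorem BddMeas.sum {ι : Type*} (s : Finset ι) {F : ι → Z → ℝ} (h : ∀ i, BddMeas (F i)) :
    BddMeas fun z => ∑ i ∈ s, F i z := by
  choose hm B hB using h
  exact ⟨Finset.measurable_sum s fun i _ => hm i, ∑ i ∈ s, B i, fun z =>
    (Finset.abs_sum_le_sum_abs _ _).trans (Finset.sum_le_sum fun i _ => hB i z)⟩

theorem BddMeas.comp (hf : BddMeas f) {φ : Z' → Z} (hφ : Measurable φ) :
    BddMeas fun z => f (φ z) := ⟨hf.1.comp hφ, hf.2.imp fun _ h z => h (φ z)⟩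

theorem BddMeas.indicator (hf : BddMeas f) {s : Set Z} (hs : MeasurableSet s) :
    BddMeas (s.indicator f) := by
  obtain ⟨hfm, B, hB⟩ := hf
  refine ⟨hfm.indicator hs, B, fun z => ?_⟩
  by_cases h : z ∈ s
  · simpa [h] using hB z
  · simpa [h] using (abs_nonneg _).trans (hB z)

theorem BddMeas.integrable (hf : BddMeas f) (μ : Measure Z) [IsFiniteMeasure μ] :
    Integrable f μ := by
  obtain ⟨hfm, B, hB⟩ := hf
  exact Integrable.of_bound hfm.aestronglyMeasurable B (ae_of_all _ hB)

theorem BddMeas.growth (hf : BddMeas f) {N : Z → ℝ} : ExpGrowth N f := by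
  obtain ⟨hfm, B, hB⟩ := hf
  exact ExpGrowth.of_bound hfm B hB

end Bounded

section Channel
variable {X X' K K' : Type*} [MeasurableSpace X] [MeasurableSpace X'] [Fintype K] [Fintype K']
variable {a : X → K → ℝ} {A : ℝ} {f g : X × X → ℝ}

/-- The unnormalized two-replica average of `f`. -/
noncomputable def numer (a : X → K → ℝ) (ν : Measure X) (f : X × X → ℝ) (y : K → ℝ) : ℝ :=
  ∫ p, f p * (lr 1 (a p.1) y * lr 1 (a p.2) y) ∂(ν.prod ν)

/-- The average of `f` over two independent posterior samples and over the observation. -/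
noncomputable def gibbs (a : X → K → ℝ) (ν : Measure X) (f : X × X → ℝ) : ℝ :=
  ∫ y, numer a ν f y / mix 1 a ν y ∂gaussPi K 1

theorem growth_lr_pair (ha : IsField a A) (hf : BddMeas f) :
    ExpGrowth (fun w : (X × X) × (K → ℝ) => noiseSize w.2)
      (fun w => f w.1 * (lr 1 (a w.1.1) w.2 * lr 1 (a w.1.2) w.2)) := by
  refine (hf.comp (φ := fun w : (X × X) × (K → ℝ) => w.1) measurable_fst).growth.mul
    (ExpGrowth.mul ?_ ?_)
  · exact (ha.expPos_lr 1).growth.comp (φ := fun w : (X × X) × (K → ℝ) => (w.1.1, w.2))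
      (by fun_prop) fun w => le_rfl
  · exact (ha.expPos_lr 1).growth.comp (φ := fun w : (X × X) × (K → ℝ) => (w.1.2, w.2))
      (by fun_prop) fun w => le_rfl

variable (ν : Measure X) [IsProbabilityMeasure ν]

theorem growth_numer (ha : IsField a A) (hf : BddMeas f) : ExpGrowth noiseSize (numer a ν f) :=
  (growth_lr_pair ha hf).integral (ν.prod ν)

theorem growth_numer_div (ha : IsField a A) (hf : BddMeas f) :
    ExpGrowth noiseSize fun y => numer a ν f y / mix 1 a ν y := by
  simp only [div_eq_mul_inv]
  exact (growth_numer ν ha hf).mul (expPos_mix ν ha 1).inv.growth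

theorem mix_pos (ha : IsField a A) (y : K → ℝ) : 0 < mix 1 a ν y := (expPos_mix ν ha 1).pos y

theorem integrable_numer_div (ha : IsField a A) (hf : BddMeas f) :
    Integrable (fun y => numer a ν f y / mix 1 a ν y) (gaussPi K 1) :=
  (growth_numer_div ν ha hf).integrable (expIntegrable_gaussPi 1)

theorem integrable_lr_pair (ha : IsField a A) (hf : BddMeas f) (y : K → ℝ) :
    Integrable (fun p : X × X => f p * (lr 1 (a p.1) y * lr 1 (a p.2) y)) (ν.prod ν) :=
  (growth_lr_pair ha hf).integrable_section (ν.prod ν) y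

theorem numer_add (ha : IsField a A) (hf : BddMeas f) (hg : BddMeas g) (y : K → ℝ) :
    numer a ν (fun p => f p + g p) y = numer a ν f y + numer a ν g y := by
  unfold numer
  rw [← integral_add (integrable_lr_pair ν ha hf y) (integrable_lr_pair ν ha hg y)]
  simp only [add_mul]

theorem numer_const_mul (c : ℝ) (y : K → ℝ) :
    numer a ν (fun p => c * f p) y = c * numer a ν f y := by
  unfold numer
  rw [← integral_const_mul]
  simp only [mul_assoc]

theorem numer_one (y : K → ℝ) : numer a ν (fun _ => 1) y = mix 1 a ν y ^ 2 := by
  unfold numer mix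
  simp only [one_mul]
  rw [integral_prod_mul (fun x => lr 1 (a x) y) (fun x => lr 1 (a x) y), sq]

theorem numer_mono (ha : IsField a A) (hf : BddMeas f) (hg : BddMeas g) (hfg : ∀ p, f p ≤ g p)
    (y : K → ℝ) : numer a ν f y ≤ numer a ν g y :=
  integral_mono (integrable_lr_pair ν ha hf y) (integrable_lr_pair ν ha hg y) fun p =>
    mul_le_mul_of_nonneg_right (hfg p) (mul_pos (lr_pos _ _ _) (lr_pos _ _ _)).le

theorem gibbs_add (ha : IsField a A) (hf : BddMeas f) (hg : BddMeas g) :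
    gibbs a ν (fun p => f p + g p) = gibbs a ν f + gibbs a ν g := by
  unfold gibbs
  rw [← integral_add (integrable_numer_div ν ha hf) (integrable_numer_div ν ha hg)]
  simp only [numer_add ν ha hf hg, add_div]

theorem gibbs_const_mul (c : ℝ) : gibbs a ν (fun p => c * f p) = c * gibbs a ν f := by
  unfold gibbs
  rw [← integral_const_mul]
  simp only [numer_const_mul, mul_div_assoc]

theorem gibbs_mono (ha : IsField a A) (hf : BddMeas f) (hg : BddMeas g) (hfg : ∀ p, f p ≤ g p) :
    gibbs a ν f ≤ gibbs a ν g :=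
  integral_mono (integrable_numer_div ν ha hf) (integrable_numer_div ν ha hg) fun y =>
    div_le_div_of_nonneg_right (numer_mono ν ha hf hg hfg y) (mix_pos ν ha y).le

theorem gibbs_one (ha : IsField a A) : gibbs a ν (fun _ => 1) = 1 := by
  unfold gibbs
  refine (integral_congr_ae (ae_of_all _ fun y => ?_)).trans (integral_mix ν ha 1)
  have := mix_pos ν ha y
  simp only [numer_one]
  field_simp

theorem gibbs_zero : gibbs a ν (fun _ => 0) = 0 := by
  simp [gibbs, numer]

theorem gibbs_nonneg (ha : IsField a A) (hf : BddMeas f) (h : ∀ p, 0 ≤ f p) :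
    0 ≤ gibbs a ν f := by
  rw [← gibbs_zero (a := a) ν]
  exact gibbs_mono ν ha (BddMeas.const 0) hf h

theorem gibbs_sum {ι : Type*} (s : Finset ι) (ha : IsField a A) {F : ι → X × X → ℝ}
    (hF : ∀ i, BddMeas (F i)) :
    gibbs a ν (fun p => ∑ i ∈ s, F i p) = ∑ i ∈ s, gibbs a ν (F i) := by
  induction s using Finset.cons_induction with
  | empty => simp [gibbs_zero]
  | cons i s hi ih =>
    simp only [Finset.sum_cons]
    rw [gibbs_add ν ha (hF i) (BddMeas.sum s hF), ih]

theorem integral_numer (ha : IsField a A) (hf : BddMeas f) :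
    ∫ y, numer a ν f y ∂gaussPi K 1 = ∫ p, f p * Real.exp (gram a p.1 p.2) ∂(ν.prod ν) := by
  unfold numer
  rw [← integral_integral_swap (f := fun p y => f p * (lr 1 (a p.1) y * lr 1 (a p.2) y))
    ((growth_lr_pair ha hf).integrable ((expIntegrable_gaussPi 1).prod_snd (ν.prod ν)))]
  refine integral_congr_ae (ae_of_all _ fun p => ?_)
  simp only
  rw [integral_const_mul, integral_lr_mul_lr]
  simp [gram]

/-- Cauchy–Schwarz comparison with the second moment. -/
theorem gibbs_le_second_moment (ha : IsField a A) (hf : BddMeas f) {t : ℝ} (ht : 0 < t) :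
    gibbs a ν f ≤ t / 2 * ∫ p, f p ^ 2 * Real.exp (gram a p.1 p.2) ∂(ν.prod ν) + 1 / (2 * t) := by
  rw [← integral_numer ν ha (hf.pow 2)]
  have hi := (growth_numer ν ha (hf.pow 2)).integrable (expIntegrable_gaussPi 1)
  have h1 : t / 2 * ∫ y, numer a ν (fun p => f p ^ 2) y ∂gaussPi K 1 + 1 / (2 * t) =
      ∫ y, (t / 2 * numer a ν (fun p => f p ^ 2) y + 1 / (2 * t)) ∂gaussPi K 1 := by
    rw [integral_add (hi.const_mul _) (integrable_const _), integral_const_mul]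
    simp
  rw [h1]
  refine integral_mono (integrable_numer_div ν ha hf) ((hi.const_mul _).add (integrable_const _))
    fun y => ?_
  have hL := mix_pos ν ha y
  simp only
  rw [div_le_iff₀ hL]
  have h2 : numer a ν f y ≤ numer a ν (fun p => t / 2 * mix 1 a ν y * f p ^ 2 +
      1 / (2 * t * mix 1 a ν y) * 1) y := by
    refine numer_mono ν ha hf (((BddMeas.const _).mul (hf.pow 2)).add
      ((BddMeas.const _).mul (BddMeas.const 1))) (fun p => ?_) y
    have h3 : t / 2 * mix 1 a ν y * f p ^ 2 + 1 / (2 * t * mix 1 a ν y) * 1 - f p =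
        (t * mix 1 a ν y * f p - 1) ^ 2 / (2 * t * mix 1 a ν y) := by
      field_simp; ring
    have : 0 ≤ (t * mix 1 a ν y * f p - 1) ^ 2 / (2 * t * mix 1 a ν y) := by positivity
    linarith
  rw [numer_add ν ha ((BddMeas.const _).mul (hf.pow 2)) ((BddMeas.const _).mul (BddMeas.const 1)),
    numer_const_mul, numer_const_mul, numer_one] at h2
  refine h2.trans (le_of_eq ?_)
  field_simp

/-- The posterior law given the observation `y`. -/
noncomputable def posterior (a : X → K → ℝ) (ν : Measure X) (y : K → ℝ) : Measure X :=
  ν.tilted fun x => Real.log (lr 1 (a x) y)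

theorem integrable_lr_section (ha : IsField a A) (y : K → ℝ) :
    Integrable (fun x => lr 1 (a x) y) ν :=
  (ha.expPos_lr 1).growth.integrable_section ν y

theorem isProbabilityMeasure_posterior (ha : IsField a A) (y : K → ℝ) :
    IsProbabilityMeasure (posterior a ν y) := by
  refine isProbabilityMeasure_tilted ?_
  simp only [Real.exp_log (lr_pos _ _ _)]
  exact integrable_lr_section ν ha y

theorem integral_posterior (g : X → ℝ) (y : K → ℝ) :
    ∫ x, g x ∂posterior a ν y = (∫ x, g x * lr 1 (a x) y ∂ν) / mix 1 a ν y := by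
  unfold posterior mix
  rw [integral_tilted, ← integral_div]
  simp only [Real.exp_log (lr_pos _ _ _), smul_eq_mul]
  refine integral_congr_ae (ae_of_all _ fun x => ?_)
  simp only
  ring

theorem integral_posterior_prod (ha : IsField a A) (hf : BddMeas f) (y : K → ℝ) :
    ∫ p, f p ∂((posterior a ν y).prod (posterior a ν y)) = numer a ν f y / mix 1 a ν y ^ 2 := by
  have := isProbabilityMeasure_posterior ν ha y
  rw [integral_prod f (hf.integrable ((posterior a ν y).prod (posterior a ν y))),
    integral_posterior]
  simp only [integral_posterior]
  unfold numer
  rw [integral_prod _ (integrable_lr_pair ν ha hf y), sq, ← div_div]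
  congr 1
  rw [← integral_div]
  refine integral_congr_ae (ae_of_all _ fun x => ?_)
  simp only
  rw [div_mul_eq_mul_div, ← integral_mul_const]
  congr 1
  refine integral_congr_ae (ae_of_all _ fun x' => ?_)
  simp only
  ring

theorem mix_mul_integral_posterior_prod (ha : IsField a A) (hf : BddMeas f) (y : K → ℝ) :
    mix 1 a ν y * ∫ p, f p ∂((posterior a ν y).prod (posterior a ν y)) =
      numer a ν f y / mix 1 a ν y := by
  have := mix_pos ν ha y
  rw [integral_posterior_prod ν ha hf]
  field_simp

/-- Reparametrization invariance of the partition function. -/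
theorem mix_reparam {a' : X' → K' → ℝ} {ν' : Measure X'} {φ : X → X'} (hφ : MeasurePreserving φ ν ν')
    (e : K' ≃ K) (h : ∀ x k, a' (φ x) k = a x (e k)) (ha' : Measurable a') (y : K → ℝ) :
    mix 1 a' ν' (fun k => y (e k)) = mix 1 a ν y := by
  unfold mix
  have hm : Measurable fun x' => lr 1 (a' x') (fun k => y (e k)) := by fun_prop
  rw [← hφ.map_eq, integral_map hφ.measurable.aemeasurable hm.aestronglyMeasurable]
  refine integral_congr_ae (ae_of_all _ fun x => ?_)
  simp only [lr, h]
  rw [Equiv.sum_comp e fun k => a x k * y k, Equiv.sum_comp e fun k => a x k ^ 2]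

theorem numer_reparam {a' : X' → K' → ℝ} {ν' : Measure X'} [IsProbabilityMeasure ν'] {φ : X → X'}
    (hφ : MeasurePreserving φ ν ν')
    (e : K' ≃ K) (h : ∀ x k, a' (φ x) k = a x (e k)) (ha' : Measurable a') {f' : X' × X' → ℝ}
    (hf' : Measurable f') (y : K → ℝ) :
    numer a' ν' f' (fun k => y (e k)) = numer a ν (fun p => f' (φ p.1, φ p.2)) y := by
  unfold numer
  have hm : Measurable fun p : X' × X' => f' p * (lr 1 (a' p.1) (fun k => y (e k)) *
      lr 1 (a' p.2) (fun k => y (e k))) := by fun_prop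
  rw [← (hφ.prod hφ).map_eq, integral_map (hφ.prod hφ).measurable.aemeasurable
    hm.aestronglyMeasurable]
  refine integral_congr_ae (ae_of_all _ fun p => ?_)
  simp only [lr, h, Prod.map]
  rw [Equiv.sum_comp e fun k => a p.1 k * y k, Equiv.sum_comp e fun k => a p.1 k ^ 2,
    Equiv.sum_comp e fun k => a p.2 k * y k, Equiv.sum_comp e fun k => a p.2 k ^ 2]

theorem measurePreserving_gaussPi_equiv (e : K' ≃ K) (v : ℝ≥0) :
    MeasurePreserving (fun (y : K → ℝ) (k : K') => y (e k)) (gaussPi K v) (gaussPi K' v) := by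
  have := measurePreserving_piCongrLeft (fun _ : K' => gaussianReal 0 v) e.symm
  convert this using 1 <;> [ext y k; rfl; rfl]
  simp [MeasurableEquiv.piCongrLeft, Equiv.piCongrLeft_apply]

theorem gibbs_reparam {a' : X' → K' → ℝ} {ν' : Measure X'} [IsProbabilityMeasure ν'] {φ : X → X'}
    (hφ : MeasurePreserving φ ν ν')
    (e : K' ≃ K) (h : ∀ x k, a' (φ x) k = a x (e k)) {A' : ℝ} (ha' : IsField a' A')
    {f' : X' × X' → ℝ} (hf' : BddMeas f') :
    gibbs a' ν' f' = gibbs a ν (fun p => f' (φ p.1, φ p.2)) := by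
  have hm := (growth_numer_div ν' ha' hf').1
  unfold gibbs
  have he := measurePreserving_gaussPi_equiv e 1
  rw [← he.map_eq, integral_map he.measurable.aemeasurable hm.aestronglyMeasurable]
  simp only [numer_reparam ν hφ e h ha'.meas hf'.1, mix_reparam ν hφ e h ha'.meas]

end Channel
end SpikedWigner



namespace SpikedWigner
open scoped NNReal ENNReal

section Extension
variable {X Ω K J : Type*} [MeasurableSpace X] [MeasurableSpace Ω] [Fintype K] [Fintype J]
variable {a : X → K → ℝ} {A : ℝ} {P : Measure Ω} {ξ : Ω → ℝ} {M κ : ℝ} {v : X → J → ℝ}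

/-- The channel `a` extended by an independent column. -/
def extField (a : X → K → ℝ) (ξ : Ω → ℝ) (v : X → J → ℝ) (z : X × Ω) : K ⊕ J → ℝ :=
  Sum.elim (a z.1) (colField ξ v z)

theorem isField_extField (ha : IsField a A) (hξ : IsSpin P ξ M) (hv : IsField v κ) :
    IsField (extField a ξ v) (A + M ^ 2 * κ) where
  meas := by
    have h1 := ha.meas
    have h2 := (hξ.isField_colField hv).meas
    rw [measurable_pi_iff]
    rintro (k | k)
    · simp only [extField, Sum.elim_inl]
      fun_prop
    · simp only [extField, Sum.elim_inr]
      fun_prop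
  nonneg := add_nonneg ha.nonneg (hξ.isField_colField hv).nonneg
  sq_le z := by
    simp only [Fintype.sum_sum_type, extField, Sum.elim_inl, Sum.elim_inr]
    exact add_le_add (ha.sq_le _) ((hξ.isField_colField hv).sq_le _)

theorem lr_sumElim (u : ℝ≥0) (b y : K → ℝ) (c y' : J → ℝ) :
    lr u (Sum.elim b c) (Sum.elim y y') = lr u b y * lr u c y' := by
  simp only [lr, ← Real.exp_add, Fintype.sum_sum_type, Sum.elim_inl, Sum.elim_inr]
  congr 1
  ring

theorem measurePreserving_sumElim (u : ℝ≥0) :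
    MeasurePreserving (fun w : (K → ℝ) × (J → ℝ) => (Sum.elim w.1 w.2 : K ⊕ J → ℝ))
      ((gaussPi K u).prod (gaussPi J u)) (gaussPi (K ⊕ J) u) := by
  have := measurePreserving_sumPiEquivProdPi_symm (X := fun _ : K ⊕ J => ℝ)
    (fun _ : K ⊕ J => gaussianReal 0 u)
  convert this using 1
  · ext w k
    rcases k with k | k <;> rfl
  · rfl
  · rfl

theorem integrable_sumElim {u : ℝ≥0} {f : (K ⊕ J → ℝ) → ℝ} (hf : Integrable f (gaussPi (K ⊕ J) u)) :
    Integrable (fun w : (K → ℝ) × (J → ℝ) => f (Sum.elim w.1 w.2))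
      ((gaussPi K u).prod (gaussPi J u)) :=
  (measurePreserving_sumElim u).integrable_comp_of_integrable hf

theorem integral_gaussPi_sum {u : ℝ≥0} {f : (K ⊕ J → ℝ) → ℝ}
    (hf : Integrable f (gaussPi (K ⊕ J) u)) :
    ∫ w, f w ∂gaussPi (K ⊕ J) u = ∫ y, ∫ y', f (Sum.elim y y') ∂gaussPi J u ∂gaussPi K u := by
  have h := measurePreserving_sumElim (K := K) (J := J) u
  have hf' : AEStronglyMeasurable f (((gaussPi K u).prod (gaussPi J u)).map
      fun w : (K → ℝ) × (J → ℝ) => (Sum.elim w.1 w.2 : K ⊕ J → ℝ)) := by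
    rw [h.map_eq]; exact hf.1
  conv_lhs => rw [← h.map_eq]
  rw [integral_map h.measurable.aemeasurable hf', integral_prod _ (integrable_sumElim hf)]

variable (ν : Measure X) [IsProbabilityMeasure ν] [IsProbabilityMeasure P]

theorem integrable_mul_lr_col (hξ : IsSpin P ξ M) (hv : IsField v κ) (π : Measure X)
    [IsProbabilityMeasure π] {g : X × Ω → ℝ} (hg : BddMeas g) (y' : J → ℝ) :
    Integrable (fun z => g z * lr 1 (colField ξ v z) y') (π.prod P) := by
  refine ExpGrowth.integrable_section (N := noiseSize)
    (h := fun w : (X × Ω) × (J → ℝ) => g w.1 * lr 1 (colField ξ v w.1) w.2) ?_ (π.prod P) y'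
  exact (hg.comp (φ := fun w : (X × Ω) × (J → ℝ) => w.1) measurable_fst).growth.mul
    ((hξ.isField_colField hv).expPos_lr 1).growth

theorem integrable_mul_lr_ext (ha : IsField a A) (hξ : IsSpin P ξ M) (hv : IsField v κ)
    {g : X × Ω → ℝ} (hg : BddMeas g) (y : K → ℝ) (y' : J → ℝ) :
    Integrable (fun z => g z * (lr 1 (a z.1) y * lr 1 (colField ξ v z) y')) (ν.prod P) := by
  simp only [← lr_sumElim]
  refine ExpGrowth.integrable_section (N := noiseSize)
    (h := fun w : (X × Ω) × (K ⊕ J → ℝ) => g w.1 * lr 1 (extField a ξ v w.1) w.2) ?_ (ν.prod P)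
    (Sum.elim y y')
  exact (hg.comp (φ := fun w : (X × Ω) × (K ⊕ J → ℝ) => w.1) measurable_fst).growth.mul
    ((isField_extField ha hξ hv).expPos_lr 1).growth

theorem integral_mul_lr_ext (ha : IsField a A) (hξ : IsSpin P ξ M) (hv : IsField v κ)
    {g : X × Ω → ℝ} (hg : BddMeas g) (y : K → ℝ) (y' : J → ℝ) :
    ∫ z, g z * lr 1 (extField a ξ v z) (Sum.elim y y') ∂(ν.prod P) =
      mix 1 a ν y * ∫ z, g z * lr 1 (colField ξ v z) y' ∂((posterior a ν y).prod P) := by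
  have := isProbabilityMeasure_posterior ν ha y
  have hm := mix_pos ν ha y
  simp only [extField, lr_sumElim]
  rw [integral_prod _ (integrable_mul_lr_ext ν ha hξ hv hg y y'),
    integral_prod _ (integrable_mul_lr_col hξ hv (posterior a ν y) hg y'), integral_posterior]
  rw [mul_div_cancel₀ _ hm.ne']
  refine integral_congr_ae (ae_of_all _ fun x => ?_)
  simp only
  rw [← integral_mul_const]
  refine integral_congr_ae (ae_of_all _ fun ω => ?_)
  simp only
  ring

theorem mix_extField (ha : IsField a A) (hξ : IsSpin P ξ M) (hv : IsField v κ) (y : K → ℝ)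
    (y' : J → ℝ) : mix 1 (extField a ξ v) (ν.prod P) (Sum.elim y y') =
      mix 1 a ν y * col P ξ v (posterior a ν y) y' := by
  have := integral_mul_lr_ext ν ha hξ hv (BddMeas.const 1) y y'
  simp only [one_mul] at this
  exact this

theorem numer_sum_mul {ι : Type*} (s : Finset ι) (ha : IsField a A) {g : ι → X → ℝ}
    (hg : ∀ i, BddMeas (g i)) (y : K → ℝ) :
    numer a ν (fun p => ∑ i ∈ s, g i p.1 * g i p.2) y =
      ∑ i ∈ s, (∫ x, g i x * lr 1 (a x) y ∂ν) ^ 2 := by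
  unfold numer
  simp only [Finset.sum_mul]
  rw [integral_finsetSum]
  · refine Finset.sum_congr rfl fun i _ => ?_
    rw [sq, ← integral_prod_mul (fun x => g i x * lr 1 (a x) y) (fun x => g i x * lr 1 (a x) y)]
    refine integral_congr_ae (ae_of_all _ fun p => ?_)
    simp only
    ring
  · intro i _
    exact integrable_lr_pair ν ha (((hg i).comp measurable_fst).mul ((hg i).comp measurable_snd)) y

theorem bddMeas_sum_mul {ι Z : Type*} [MeasurableSpace Z] (s : Finset ι) {g : ι → Z → ℝ}
    (hg : ∀ i, BddMeas (g i)) : BddMeas (fun p : Z × Z => ∑ i ∈ s, g i p.1 * g i p.2) :=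
  BddMeas.sum s fun i => ((hg i).comp measurable_fst).mul ((hg i).comp measurable_snd)

/-- The replica average of a sum of products in the extended channel. -/
theorem gibbs_extField {ι : Type*} (s : Finset ι) (ha : IsField a A) (hξ : IsSpin P ξ M)
    (hv : IsField v κ) {g : ι → X × Ω → ℝ} (hg : ∀ i, BddMeas (g i)) :
    gibbs (extField a ξ v) (ν.prod P) (fun p => ∑ i ∈ s, g i p.1 * g i p.2) =
      ∫ y, mix 1 a ν y * ∫ y', (∑ i ∈ s,
        (∫ z, g i z * lr 1 (colField ξ v z) y' ∂((posterior a ν y).prod P)) ^ 2) /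
          col P ξ v (posterior a ν y) y' ∂gaussPi J 1 ∂gaussPi K 1 ∧
    Integrable (fun y => mix 1 a ν y * ∫ y', (∑ i ∈ s,
        (∫ z, g i z * lr 1 (colField ξ v z) y' ∂((posterior a ν y).prod P)) ^ 2) /
          col P ξ v (posterior a ν y) y' ∂gaussPi J 1) (gaussPi K 1) := by
  have hE := isField_extField ha hξ hv
  have hi := integrable_numer_div (ν.prod P) hE (bddMeas_sum_mul s hg)
  have hpt : ∀ (y : K → ℝ) (y' : J → ℝ),
      numer (extField a ξ v) (ν.prod P) (fun p => ∑ i ∈ s, g i p.1 * g i p.2) (Sum.elim y y') /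
        mix 1 (extField a ξ v) (ν.prod P) (Sum.elim y y') = mix 1 a ν y * ((∑ i ∈ s,
        (∫ z, g i z * lr 1 (colField ξ v z) y' ∂((posterior a ν y).prod P)) ^ 2) /
          col P ξ v (posterior a ν y) y') := by
    intro y y'
    have := isProbabilityMeasure_posterior ν ha y
    have hm := mix_pos ν ha y
    have hc := (expPos_col (posterior a ν y) hξ hv).pos y'
    rw [numer_sum_mul _ s hE hg, mix_extField ν ha hξ hv]
    simp only [integral_mul_lr_ext ν ha hξ hv (hg _), mul_pow, ← Finset.mul_sum]
    field_simp
  constructor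
  · unfold gibbs
    rw [integral_gaussPi_sum hi]
    simp only [hpt, integral_const_mul]
  · have := (integrable_sumElim hi).integral_prod_left
    simp only [hpt, integral_const_mul] at this
    exact this

/-- The mutual information carried by the channel, up to the Gaussian normalization. -/
noncomputable def info (a : X → K → ℝ) (ν : Measure X) : ℝ :=
  ∫ y, mix 1 a ν y * Real.log (mix 1 a ν y) ∂gaussPi K 1

theorem integrable_mix_log (ha : IsField a A) :
    Integrable (fun y => mix 1 a ν y * Real.log (mix 1 a ν y)) (gaussPi K 1) :=
  ((expPos_mix ν ha 1).growth.mul (expPos_mix ν ha 1).log).integrable (expIntegrable_gaussPi 1)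

theorem integrable_mix (ha : IsField a A) : Integrable (mix 1 a ν) (gaussPi K 1) :=
  (expPos_mix ν ha 1).growth.integrable (expIntegrable_gaussPi 1)

/-- The chain rule for the information. -/
theorem info_extField (ha : IsField a A) (hξ : IsSpin P ξ M) (hv : IsField v κ) :
    info (extField a ξ v) (ν.prod P) = info a ν +
      ∫ y, mix 1 a ν y * ∫ y', col P ξ v (posterior a ν y) y' *
        Real.log (col P ξ v (posterior a ν y) y') ∂gaussPi J 1 ∂gaussPi K 1 ∧
    Integrable (fun y => mix 1 a ν y * ∫ y', col P ξ v (posterior a ν y) y' *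
        Real.log (col P ξ v (posterior a ν y) y') ∂gaussPi J 1) (gaussPi K 1) := by
  have hE := isField_extField ha hξ hv
  have hi := integrable_mix_log (ν.prod P) hE
  have hpt : ∀ (y : K → ℝ), ∫ y', mix 1 (extField a ξ v) (ν.prod P) (Sum.elim y y') *
      Real.log (mix 1 (extField a ξ v) (ν.prod P) (Sum.elim y y')) ∂gaussPi J 1 =
      mix 1 a ν y * Real.log (mix 1 a ν y) + mix 1 a ν y *
      ∫ y', col P ξ v (posterior a ν y) y' *
        Real.log (col P ξ v (posterior a ν y) y') ∂gaussPi J 1 := by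
    intro y
    have := isProbabilityMeasure_posterior ν ha y
    have hm := mix_pos ν ha y
    have hcp := expPos_col (posterior a ν y) hξ hv
    have h1 : ∀ y', mix 1 (extField a ξ v) (ν.prod P) (Sum.elim y y') *
      Real.log (mix 1 (extField a ξ v) (ν.prod P) (Sum.elim y y')) =
      mix 1 a ν y * Real.log (mix 1 a ν y) * col P ξ v (posterior a ν y) y' +
      mix 1 a ν y * (col P ξ v (posterior a ν y) y' *
        Real.log (col P ξ v (posterior a ν y) y')) := by
      intro y'
      rw [mix_extField ν ha hξ hv, Real.log_mul hm.ne' (hcp.pos y').ne']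
      ring
    simp only [h1]
    rw [integral_add ((hcp.growth.integrable (expIntegrable_gaussPi 1)).const_mul _)
      (((hcp.growth.mul hcp.log).integrable (expIntegrable_gaussPi 1)).const_mul _),
      integral_const_mul, integral_const_mul, integral_col _ hξ hv, mul_one]
  have hi2 := (integrable_sumElim hi).integral_prod_left
  simp only [hpt] at hi2
  have hi3 : Integrable (fun y => mix 1 a ν y * ∫ y', col P ξ v (posterior a ν y) y' *
        Real.log (col P ξ v (posterior a ν y) y') ∂gaussPi J 1) (gaussPi K 1) := by
    have := hi2.sub (integrable_mix_log ν ha)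
    refine this.congr (ae_of_all _ fun y => ?_)
    simp
  refine ⟨?_, hi3⟩
  unfold info
  rw [integral_gaussPi_sum hi]
  simp only [hpt]
  rw [integral_add (integrable_mix_log ν ha) hi3]

theorem abs_integral_mix_mul_sub_le (ha : IsField a A) {f g : X × X → ℝ} (hf : BddMeas f)
    (hg : BddMeas g) {Φ : (K → ℝ) → ℝ}
    (hΦ : Integrable (fun y => mix 1 a ν y * Φ y) (gaussPi K 1))
    (h : ∀ y, |Φ y - ∫ p, f p ∂((posterior a ν y).prod (posterior a ν y))| ≤
      ∫ p, g p ∂((posterior a ν y).prod (posterior a ν y))) :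
    |∫ y, mix 1 a ν y * Φ y ∂gaussPi K 1 - gibbs a ν f| ≤ gibbs a ν g := by
  unfold gibbs
  rw [← integral_sub hΦ (integrable_numer_div ν ha hf)]
  refine (abs_integral_le_integral_abs).trans (integral_mono
    (hΦ.sub (integrable_numer_div ν ha hf)).abs (integrable_numer_div ν ha hg) fun y => ?_)
  simp only
  rw [← mix_mul_integral_posterior_prod ν ha hf, ← mix_mul_integral_posterior_prod ν ha hg,
    ← mul_sub, abs_mul, abs_of_pos (mix_pos ν ha y)]
  exact mul_le_mul_of_nonneg_left (h y) (mix_pos ν ha y).le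

theorem bddMeas_gram (hv : IsField v κ) : BddMeas fun p : X × X => gram v p.1 p.2 :=
  ⟨hv.measurable_gram, κ, fun _ => hv.abs_gram_le _ _⟩

/-- The replica average of a power of the Gram function. -/
noncomputable def gibbsGram (a : X → K → ℝ) (ν : Measure X) (v : X → J → ℝ) (k : ℕ) : ℝ :=
  gibbs a ν fun p => |gram v p.1 p.2| ^ k

theorem abs_integral_mix_mul_sub_gibbsGram_le (ha : IsField a A) (hv : IsField v κ) (d c : ℕ → ℝ)
    (m : ℕ) {Φ : (K → ℝ) → ℝ} (hΦ : Integrable (fun y => mix 1 a ν y * Φ y) (gaussPi K 1))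
    (h : ∀ y, |Φ y - ∑ k ∈ Finset.range m, d k * gramMoment v (posterior a ν y) k| ≤
      ∑ k ∈ Finset.range m, c k * gramMoment v (posterior a ν y) k) :
    |∫ y, mix 1 a ν y * Φ y ∂gaussPi K 1 - ∑ k ∈ Finset.range m, d k * gibbsGram a ν v k| ≤
      ∑ k ∈ Finset.range m, c k * gibbsGram a ν v k := by
  have hb : ∀ (c : ℕ → ℝ) (k : ℕ), BddMeas fun p : X × X => c k * |gram v p.1 p.2| ^ k := fun c k =>
    (BddMeas.const _).mul ((bddMeas_gram hv).abs.pow k)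
  have hs : ∀ c : ℕ → ℝ, gibbs a ν (fun p => ∑ k ∈ Finset.range m, c k * |gram v p.1 p.2| ^ k) =
      ∑ k ∈ Finset.range m, c k * gibbsGram a ν v k := fun c => by
    rw [gibbs_sum ν _ ha (hb c)]
    exact Finset.sum_congr rfl fun k _ => gibbs_const_mul ν _
  have hp : ∀ (c : ℕ → ℝ) (y), ∫ p, ∑ k ∈ Finset.range m, c k * |gram v p.1 p.2| ^ k
      ∂((posterior a ν y).prod (posterior a ν y)) =
      ∑ k ∈ Finset.range m, c k * gramMoment v (posterior a ν y) k := fun c y => by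
    have := isProbabilityMeasure_posterior ν ha y
    rw [integral_finsetSum _ fun k _ => (hb c k).integrable _]
    exact Finset.sum_congr rfl fun k _ => integral_const_mul _ _
  rw [← hs, ← hs]
  refine abs_integral_mix_mul_sub_le ν ha (BddMeas.sum _ (hb d)) (BddMeas.sum _ (hb c)) hΦ ?_
  intro y
  rw [hp, hp]
  exact h y

theorem gramMoment_zero (π : Measure X) [IsProbabilityMeasure π] : gramMoment v π 0 = 1 := by
  simp [gramMoment]

theorem gibbsGram_zero (ha : IsField a A) : gibbsGram a ν v 0 = 1 := by
  simp only [gibbsGram, pow_zero]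
  exact gibbs_one ν ha

theorem abs_info_extField_sub_le (ha : IsField a A) (hξ : IsSpin P ξ M) (hv : IsField v κ) {θ : ℝ}
    (hθ : 0 < θ) (hθ1 : θ ≤ 1) :
    |info (extField a ξ v) (ν.prod P) - info a ν - gibbsGram a ν v 2 / 4| ≤
      100 * colConst M κ * (θ * gibbsGram a ν v 2 + gibbsGram a ν v 3 / θ) := by
  obtain ⟨h1, h2⟩ := info_extField ν ha hξ hv
  have := abs_integral_mix_mul_sub_gibbsGram_le ν ha hv (fun k => if k = 2 then 1 / 4 else 0)
    (fun k => if k = 2 then 100 * colConst M κ * θ else if k = 3 then 100 * colConst M κ / θ else 0)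
    4 h2 fun y => by
      have := isProbabilityMeasure_posterior ν ha y
      have := column_kl (posterior a ν y) hξ hv hθ hθ1
      simp only [Finset.sum_range_succ, Finset.sum_range_zero]
      norm_num
      convert this using 1
      · congr 2; ring
      · ring
  simp only [Finset.sum_range_succ, Finset.sum_range_zero] at this
  norm_num at this
  rw [h1]
  convert this using 1
  · congr 1; ring
  · ring

theorem abs_gibbs_extField_cross_sub_le (ha : IsField a A) (hξ : IsSpin P ξ M) (hv : IsField v κ)
    {k θ : ℝ} (hk : 0 < k) (hθ : 0 < θ) :
    |gibbs (extField a ξ v) (ν.prod P)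
        (fun p => ξ p.1.2 * ξ p.2.2 * gram v p.1.1 p.2.1) - gibbsGram a ν v 2| ≤
      colConst M κ * (gibbsGram a ν v 3 + k * gibbsGram a ν v 4 +
        (3 * gibbsGram a ν v 3 / θ + θ) / k) := by
  have hg : ∀ j, BddMeas fun z : X × Ω => ξ z.2 * v z.1 j := fun j => by
    refine BddMeas.mul ⟨hξ.meas.comp measurable_snd, M, fun z => hξ.bound _⟩
      ⟨by have := hv.meas; fun_prop, √κ, fun z => ?_⟩
    exact Real.abs_le_sqrt ((Finset.single_le_sum (f := fun j => v z.1 j ^ 2)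
      (fun _ _ => sq_nonneg _) (Finset.mem_univ j)).trans (hv.sq_le z.1))
  obtain ⟨h1, h2⟩ := gibbs_extField ν Finset.univ ha hξ hv hg
  have h3 : (fun p : (X × Ω) × (X × Ω) => ξ p.1.2 * ξ p.2.2 * gram v p.1.1 p.2.1) =
      fun p => ∑ j, ξ p.1.2 * v p.1.1 j * (ξ p.2.2 * v p.2.1 j) := by
    ext p
    rw [gram, Finset.mul_sum]
    exact Finset.sum_congr rfl fun j _ => by ring
  have := abs_integral_mix_mul_sub_gibbsGram_le ν ha hv (fun k => if k = 2 then 1 else 0)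
    (fun j => colConst M κ * (if j = 3 then 1 + 3 / θ / k else if j = 4 then k else
      if j = 0 then θ / k else 0))
    5 h2 fun y => by
      have := isProbabilityMeasure_posterior ν ha y
      have := column_colSq_div (posterior a ν y) hξ hv hk hθ
      simp only [Finset.sum_range_succ, Finset.sum_range_zero, gramMoment_zero]
      norm_num
      convert this using 1
      · rfl
      · ring
  simp only [Finset.sum_range_succ, Finset.sum_range_zero, gibbsGram_zero ν ha] at this
  norm_num at this
  rw [h3, h1]
  convert this using 1
  ring

theorem abs_gibbs_extField_diag_sub_le (ha : IsField a A) (hξ : IsSpin P ξ M) (hv : IsField v κ)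
    {θ : ℝ} (hθ : 0 < θ) :
    |gibbs (extField a ξ v) (ν.prod P) (fun p => (ξ p.1.2 * ξ p.2.2) ^ 2) - 1| ≤
      M ^ 2 * (θ + colConst M κ * gibbsGram a ν v 1 / θ) := by
  have hg : ∀ _ : Unit, BddMeas fun z : X × Ω => ξ z.2 ^ 2 := fun _ =>
    BddMeas.pow ⟨hξ.meas.comp measurable_snd, M, fun z => hξ.bound _⟩ 2
  obtain ⟨h1, h2⟩ := gibbs_extField ν Finset.univ ha hξ hv hg
  have h3 : (fun p : (X × Ω) × (X × Ω) => (ξ p.1.2 * ξ p.2.2) ^ 2) =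
      fun p => ∑ _j : Unit, ξ p.1.2 ^ 2 * ξ p.2.2 ^ 2 := by
    ext p
    simp [mul_pow]
  have := abs_integral_mix_mul_sub_gibbsGram_le ν ha hv (fun k => if k = 0 then 1 else 0)
    (fun j => M ^ 2 * (if j = 1 then colConst M κ / θ else if j = 0 then θ else 0))
    2 h2 fun y => by
      have := isProbabilityMeasure_posterior ν ha y
      have := column_colDiag_div (posterior a ν y) hξ hv hθ
      simp only [Finset.sum_range_succ, Finset.sum_range_zero, gramMoment_zero,
        Finset.univ_unique, Finset.sum_singleton]
      norm_num
      convert this using 1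
      · rfl
      · ring
  simp only [Finset.sum_range_succ, Finset.sum_range_zero, gibbsGram_zero ν ha] at this
  norm_num at this
  rw [h3, h1]
  norm_num
  convert this using 1
  ring

end Extension
end SpikedWigner



namespace SpikedWigner
open scoped NNReal ENNReal

section PairSystem
variable {Ω : Type*} [MeasurableSpace Ω] {P : Measure Ω} {ξ : Ω → ℝ} {M β : ℝ} {n : ℕ}

/-- The signal of the pair observations. -/
noncomputable def pairField (β : ℝ) (ξ : Ω → ℝ) (n : ℕ) (x : Fin n → Ω) (p : Pairs n) : ℝ :=
  √β * (ξ (x p.1.1) * ξ (x p.1.2))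

/-- The vector of rescaled spins. -/
noncomputable def spinField (β : ℝ) (ξ : Ω → ℝ) (n : ℕ) (x : Fin n → Ω) (k : Fin n) : ℝ :=
  √β * ξ (x k)

/-- The prior law of the spike. -/
noncomputable def prior (P : Measure Ω) (n : ℕ) : Measure (Fin n → Ω) := Measure.pi fun _ => P

instance [IsProbabilityMeasure P] : IsProbabilityMeasure (prior P n) := by
  unfold prior; infer_instance

/-- The (unnormalized) overlap of two configurations. -/
def overlap (ξ : Ω → ℝ) (n : ℕ) (p : (Fin n → Ω) × (Fin n → Ω)) : ℝ :=
  ∑ i, ξ (p.1 i) * ξ (p.2 i)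

theorem IsSpin.measurable_pairField (hξ : IsSpin P ξ M) : Measurable (pairField β ξ n) := by
  have := hξ.meas
  unfold pairField
  fun_prop

theorem IsSpin.abs_pairField_le (hξ : IsSpin P ξ M) (x : Fin n → Ω) (p : Pairs n) :
    |pairField β ξ n x p| ≤ √β * M ^ 2 := by
  rw [pairField, abs_mul, abs_mul, abs_of_nonneg (Real.sqrt_nonneg _), sq]
  have h := hξ.bound
  have := hξ.nonneg
  gcongr <;> apply h

theorem IsSpin.isField_pairField (hξ : IsSpin P ξ M) (β : ℝ) (n : ℕ) :
    IsField (pairField β ξ n) (∑ _p : Pairs n, (√β * M ^ 2) ^ 2) where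
  meas := hξ.measurable_pairField
  nonneg := by positivity
  sq_le x := Finset.sum_le_sum fun p _ => by
    rw [← sq_abs]
    exact pow_le_pow_left₀ (abs_nonneg _) (hξ.abs_pairField_le x p) 2

theorem IsSpin.isField_spinField (hξ : IsSpin P ξ M) (hβ : 0 ≤ β) (n : ℕ) :
    IsField (spinField β ξ n) (n * β * M ^ 2) where
  meas := by
    have := hξ.meas
    unfold spinField
    fun_prop
  nonneg := by positivity
  sq_le x := by
    have h : ∀ k ∈ Finset.univ, spinField β ξ n x k ^ 2 ≤ β * M ^ 2 := fun k _ => by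
      rw [spinField, mul_pow, Real.sq_sqrt hβ]
      exact mul_le_mul_of_nonneg_left (hξ.sq_le _) hβ
    refine (Finset.sum_le_card_nsmul _ _ _ h).trans (le_of_eq ?_)
    simp [mul_assoc]

theorem gram_spinField (hβ : 0 ≤ β) (x x' : Fin n → Ω) :
    gram (spinField β ξ n) x x' = β * overlap ξ n (x, x') := by
  simp only [gram, spinField, overlap, Finset.mul_sum]
  refine Finset.sum_congr rfl fun i _ => ?_
  calc √β * ξ (x i) * (√β * ξ (x' i)) = √β * √β * (ξ (x i) * ξ (x' i)) := by ring
    _ = _ := by rw [Real.mul_self_sqrt hβ]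

theorem IsSpin.bddMeas_overlap (hξ : IsSpin P ξ M) : BddMeas (overlap ξ n) := by
  have h : ∀ i : Fin n, BddMeas fun x : Fin n → Ω => ξ (x i) := fun i =>
    ⟨hξ.meas.comp (measurable_pi_apply i), M, fun x => hξ.bound _⟩
  exact bddMeas_sum_mul Finset.univ h

theorem IsSpin.abs_overlap_le (hξ : IsSpin P ξ M) (p : (Fin n → Ω) × (Fin n → Ω)) :
    |overlap ξ n p| ≤ n * M ^ 2 := by
  refine (Finset.abs_sum_le_sum_abs _ _).trans ?_
  have : ∀ i ∈ Finset.univ, |ξ (p.1 i) * ξ (p.2 i)| ≤ M ^ 2 := fun i _ => by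
    rw [abs_mul, sq]
    exact mul_le_mul (hξ.bound _) (hξ.bound _) (abs_nonneg _) hξ.nonneg
  refine (Finset.sum_le_card_nsmul _ _ _ this).trans (le_of_eq ?_)
  simp

/-- The two-replica average in the system with `n` spins and pair coupling `β`. -/
noncomputable def avg (P : Measure Ω) (ξ : Ω → ℝ) (β : ℝ) (n : ℕ)
    (f : (Fin n → Ω) × (Fin n → Ω) → ℝ) : ℝ :=
  gibbs (pairField β ξ n) (prior P n) f

/-- Append a last coordinate. -/
def snocSpin (z : (Fin n → Ω) × Ω) : Fin (n + 1) → Ω := Fin.snoc (α := fun _ => Ω) z.1 z.2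

theorem snocSpin_castSucc (z : (Fin n → Ω) × Ω) (i : Fin n) : snocSpin z i.castSucc = z.1 i := by
  simp [snocSpin]

theorem snocSpin_last (z : (Fin n → Ω) × Ω) : snocSpin z (Fin.last n) = z.2 := by
  simp [snocSpin]

/-- The pairs of `n + 1` indices are the pairs of the first `n` indices and the pairs with last
index `n`. -/
def extendPair : Pairs n ⊕ Fin n → Pairs (n + 1)
  | .inl p => ⟨(p.1.1.castSucc, p.1.2.castSucc), by simpa using p.2⟩
  | .inr i => ⟨(i.castSucc, Fin.last n), Fin.castSucc_lt_last i⟩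

theorem bijective_extendPair : Function.Bijective (extendPair (n := n)) := by
  constructor
  · rintro (p | i) (q | j) h
    · simp only [extendPair, Subtype.mk.injEq, Prod.mk.injEq, Fin.castSucc_inj] at h
      congr 1
      exact Subtype.ext (Prod.ext h.1 h.2)
    · simp only [extendPair, Subtype.mk.injEq, Prod.mk.injEq] at h
      exact absurd h.2 (Fin.castSucc_lt_last _).ne
    · simp only [extendPair, Subtype.mk.injEq, Prod.mk.injEq] at h
      exact absurd h.2.symm (Fin.castSucc_lt_last _).ne
    · simp only [extendPair, Subtype.mk.injEq, Prod.mk.injEq, Fin.castSucc_inj] at h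
      rw [h.1]
  · rintro ⟨⟨i, j⟩, hij⟩
    simp only at hij
    induction j using Fin.lastCases with
    | last =>
      refine ⟨.inr (i.castPred hij.ne), ?_⟩
      simp [extendPair]
    | cast j =>
      have hi : i ≠ Fin.last n := (hij.trans (Fin.castSucc_lt_last j)).ne
      refine ⟨.inl ⟨(i.castPred hi, j), ?_⟩, ?_⟩
      · rw [← Fin.castSucc_lt_castSucc_iff]
        simpa using hij
      · simp [extendPair]

/-- The permutation of pairs induced by a permutation of the indices. -/
def permPair (σ : Equiv.Perm (Fin n)) (p : Pairs n) : Pairs n :=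
  if h : σ p.1.1 < σ p.1.2 then ⟨(σ p.1.1, σ p.1.2), h⟩ else
    ⟨(σ p.1.2, σ p.1.1), lt_of_le_of_ne (not_lt.1 h) fun h' => p.2.ne' (σ.injective h')⟩

theorem sym2_permPair (σ : Equiv.Perm (Fin n)) (p : Pairs n) :
    s((permPair σ p).1.1, (permPair σ p).1.2) = Sym2.map σ s(p.1.1, p.1.2) := by
  unfold permPair
  split_ifs
  · rfl
  · exact Sym2.eq_swap

theorem sym2_pair_injective : Function.Injective fun p : Pairs n => s(p.1.1, p.1.2) := by
  rintro ⟨⟨i, j⟩, hij⟩ ⟨⟨k, l⟩, hkl⟩ h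
  simp only [Sym2.eq_iff] at h
  rcases h with ⟨rfl, rfl⟩ | ⟨rfl, rfl⟩
  · rfl
  · exact absurd hij (not_lt.2 hkl.le)

theorem bijective_permPair (σ : Equiv.Perm (Fin n)) : Function.Bijective (permPair σ) := by
  rw [← Finite.injective_iff_bijective]
  intro p q h
  apply sym2_pair_injective
  apply Sym2.map.injective σ.injective
  rw [← sym2_permPair, ← sym2_permPair, h]

theorem pairField_comp_perm (σ : Equiv.Perm (Fin n)) (x : Fin n → Ω) (p : Pairs n) :
    pairField β ξ n (fun i => x (σ i)) p = pairField β ξ n x (permPair σ p) := by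
  simp only [pairField, permPair]
  split_ifs
  · rfl
  · simp only; ring

variable [IsProbabilityMeasure P]

theorem measurePreserving_comp_perm (σ : Equiv.Perm (Fin n)) :
    MeasurePreserving (fun (x : Fin n → Ω) (i : Fin n) => x (σ i)) (prior P n) (prior P n) := by
  have := measurePreserving_piCongrLeft (fun _ : Fin n => P) σ.symm
  convert this using 1
  · ext x i
    simp [MeasurableEquiv.piCongrLeft, Equiv.piCongrLeft_apply]
  · rfl
  · rfl

theorem measurePreserving_snocSpin :
    MeasurePreserving (snocSpin (Ω := Ω) (n := n)) ((prior P n).prod P) (prior P (n + 1)) := by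
  have h := (measurePreserving_piFinSuccAbove (fun _ : Fin (n + 1) => P) (Fin.last n)).symm
  have := h.comp (Measure.measurePreserving_swap (μ := Measure.pi fun _ : Fin n => P) (ν := P))
  convert this using 1
  · ext z i
    induction i using Fin.lastCases with
    | last => simp [snocSpin_last, MeasurableEquiv.piFinSuccAbove, Fin.insertNthEquiv]
    | cast i => simp [snocSpin_castSucc, MeasurableEquiv.piFinSuccAbove, Fin.insertNthEquiv]
  · rfl
  · rfl

theorem avg_perm (hξ : IsSpin P ξ M) (σ : Equiv.Perm (Fin n))
    {f : (Fin n → Ω) × (Fin n → Ω) → ℝ} (hf : BddMeas f) :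
    avg P ξ β n f = avg P ξ β n fun p => f (fun i => p.1 (σ i), fun i => p.2 (σ i)) :=
  gibbs_reparam (prior P n) (measurePreserving_comp_perm σ)
    (Equiv.ofBijective _ (bijective_permPair σ)) (pairField_comp_perm σ)
    (hξ.isField_pairField β n) hf

theorem pairField_snocSpin (z : (Fin n → Ω) × Ω) (k : Pairs (n + 1)) :
    pairField β ξ (n + 1) (snocSpin z) k = extField (pairField β ξ n) ξ (spinField β ξ n) z
      ((Equiv.ofBijective _ bijective_extendPair).symm k) := by
  obtain ⟨k, rfl⟩ := (Equiv.ofBijective _ (bijective_extendPair (n := n))).surjective k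
  rw [Equiv.symm_apply_apply]
  rcases k with p | i
  · simp [extField, extendPair, pairField, snocSpin_castSucc]
  · simp only [extField, extendPair, pairField, snocSpin_castSucc, Equiv.ofBijective_apply,
      snocSpin_last, Sum.elim_inr, colField, spinField]
    ring

theorem avg_succ (hξ : IsSpin P ξ M)
    {f : (Fin (n + 1) → Ω) × (Fin (n + 1) → Ω) → ℝ} (hf : BddMeas f) :
    avg P ξ β (n + 1) f = gibbs (extField (pairField β ξ n) ξ (spinField β ξ n))
      ((prior P n).prod P) fun p => f (snocSpin p.1, snocSpin p.2) :=
  gibbs_reparam ((prior P n).prod P) measurePreserving_snocSpin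
    (Equiv.ofBijective _ (bijective_extendPair (n := n))).symm pairField_snocSpin
    (hξ.isField_pairField β (n + 1)) hf

theorem info_succ (hξ : IsSpin P ξ M) :
    info (pairField β ξ (n + 1)) (prior P (n + 1)) =
      info (extField (pairField β ξ n) ξ (spinField β ξ n)) ((prior P n).prod P) := by
  have hm := (integrable_mix_log (prior P (n + 1)) (hξ.isField_pairField β (n + 1))).1
  unfold info
  have he := measurePreserving_gaussPi_equiv
    (Equiv.ofBijective _ (bijective_extendPair (n := n))).symm 1
  rw [← he.map_eq] at hm ⊢
  rw [integral_map he.measurable.aemeasurable hm]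
  simp only [mix_reparam ((prior P n).prod P) measurePreserving_snocSpin
    (Equiv.ofBijective _ (bijective_extendPair (n := n))).symm pairField_snocSpin
    hξ.measurable_pairField]

theorem overlap_snocSpin (p : ((Fin n → Ω) × Ω) × ((Fin n → Ω) × Ω)) :
    overlap ξ (n + 1) (snocSpin p.1, snocSpin p.2) =
      overlap ξ n (p.1.1, p.2.1) + ξ p.1.2 * ξ p.2.2 := by
  simp only [overlap, Fin.sum_univ_castSucc, snocSpin_castSucc, snocSpin_last]

theorem overlap_perm (σ : Equiv.Perm (Fin n)) (p : (Fin n → Ω) × (Fin n → Ω)) :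
    overlap ξ n (fun i => p.1 (σ i), fun i => p.2 (σ i)) = overlap ξ n p :=
  Equiv.sum_comp σ fun i => ξ (p.1 i) * ξ (p.2 i)

/-- The second moment of the overlap by exchangeability. -/
theorem avg_overlap_sq_succ (hξ : IsSpin P ξ M) (hβ : 0 ≤ β) :
    avg P ξ β (n + 1) (fun p => overlap ξ (n + 1) p ^ 2) = (n + 1) *
      (gibbs (extField (pairField β ξ n) ξ (spinField β ξ n)) ((prior P n).prod P)
        (fun p => ξ p.1.2 * ξ p.2.2 * overlap ξ n (p.1.1, p.2.1)) +
      gibbs (extField (pairField β ξ n) ξ (spinField β ξ n)) ((prior P n).prod P)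
        (fun p => (ξ p.1.2 * ξ p.2.2) ^ 2)) := by
  have hs : ∀ i : Fin (n + 1), BddMeas fun p : (Fin (n + 1) → Ω) × (Fin (n + 1) → Ω) =>
      ξ (p.1 i) * ξ (p.2 i) := fun i =>
    BddMeas.mul ⟨by have := hξ.meas; fun_prop, M, fun p => hξ.bound _⟩
      ⟨by have := hξ.meas; fun_prop, M, fun p => hξ.bound _⟩
  have hso : ∀ i : Fin (n + 1), BddMeas fun p : (Fin (n + 1) → Ω) × (Fin (n + 1) → Ω) =>
      ξ (p.1 i) * ξ (p.2 i) * overlap ξ (n + 1) p := fun i => (hs i).mul hξ.bddMeas_overlap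
  have h1 : (fun p : (Fin (n + 1) → Ω) × (Fin (n + 1) → Ω) => overlap ξ (n + 1) p ^ 2) =
      fun p => ∑ i, ξ (p.1 i) * ξ (p.2 i) * overlap ξ (n + 1) p := by
    ext p
    rw [← Finset.sum_mul, sq]
    rfl
  have h2 : ∀ i : Fin (n + 1),
      avg P ξ β (n + 1) (fun p => ξ (p.1 i) * ξ (p.2 i) * overlap ξ (n + 1) p) =
      avg P ξ β (n + 1)
        (fun p => ξ (p.1 (Fin.last n)) * ξ (p.2 (Fin.last n)) * overlap ξ (n + 1) p) := by
    intro i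
    rw [avg_perm hξ (Equiv.swap i (Fin.last n)) (hso (Fin.last n))]
    simp only [overlap_perm, Equiv.swap_apply_right]
  have h3 : avg P ξ β (n + 1) (fun p => overlap ξ (n + 1) p ^ 2) =
      ∑ i : Fin (n + 1), avg P ξ β (n + 1) (fun p => ξ (p.1 i) * ξ (p.2 i) *
        overlap ξ (n + 1) p) := by
    rw [h1]
    exact gibbs_sum _ _ (hξ.isField_pairField β (n + 1)) hso
  rw [h3, Finset.sum_congr rfl fun i _ => h2 i, Finset.sum_const, Finset.card_univ,
    Fintype.card_fin, nsmul_eq_mul, avg_succ hξ (hso _)]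
  push_cast
  congr 1
  have hE := isField_extField (hξ.isField_pairField β n) hξ (hξ.isField_spinField hβ n)
  have hl : BddMeas fun p : ((Fin n → Ω) × Ω) × ((Fin n → Ω) × Ω) => ξ p.1.2 * ξ p.2.2 :=
    BddMeas.mul ⟨by have := hξ.meas; fun_prop, M, fun p => hξ.bound _⟩
      ⟨by have := hξ.meas; fun_prop, M, fun p => hξ.bound _⟩
  rw [← gibbs_add _ hE (hl.mul (hξ.bddMeas_overlap.comp
    (φ := fun p : ((Fin n → Ω) × Ω) × ((Fin n → Ω) × Ω) => (p.1.1, p.2.1)) (by fun_prop)))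
    (hl.pow 2)]
  congr 1
  ext p
  rw [overlap_snocSpin, snocSpin_last, snocSpin_last]
  ring

end PairSystem
end SpikedWigner



namespace SpikedWigner
open scoped NNReal ENNReal

section Recursion
variable {Ω : Type*} [MeasurableSpace Ω] {P : Measure Ω} {ξ : Ω → ℝ} {M β : ℝ} {n : ℕ}

/-- Uniform control of the fourth moment of the overlap for couplings `n β ≤ l`. -/
def OverlapBound (P : Measure Ω) (ξ : Ω → ℝ) (l C : ℝ) : Prop :=
  ∀ n : ℕ, 1 ≤ n → ∀ β : ℝ, 0 < β → n * β ≤ l →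
    avg P ξ β n (fun p => overlap ξ n p ^ 4) ≤ C * (n : ℝ) ^ 2

/-- The normalized second moment of the overlap. -/
noncomputable def overlapVar (P : Measure Ω) (ξ : Ω → ℝ) (β : ℝ) (n : ℕ) : ℝ :=
  avg P ξ β n (fun p => overlap ξ n p ^ 2) / n

theorem IsField.mono {X K : Type*} [MeasurableSpace X] [Fintype K] {v : X → K → ℝ} {κ κ' : ℝ}
    (hv : IsField v κ) (h : κ ≤ κ') : IsField v κ' :=
  ⟨hv.meas, hv.nonneg.trans h, fun x => (hv.sq_le x).trans h⟩

variable [IsProbabilityMeasure P]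

theorem pow_le_pow_four_add_one {x : ℝ} (hx : 0 ≤ x) {k : ℕ} (hk : k ≤ 4) : x ^ k ≤ x ^ 4 + 1 := by
  rcases le_total x 1 with h | h
  · exact (pow_le_one₀ hx h).trans (le_add_of_nonneg_left (by positivity))
  · exact (pow_le_pow_right₀ h hk).trans (le_add_of_nonneg_right zero_le_one)

theorem OverlapBound.avg_pow_le {l C : ℝ} (h : OverlapBound P ξ l C) (hξ : IsSpin P ξ M)
    (hn : 1 ≤ n) (hβ : 0 < β) (hl : n * β ≤ l) {ε : ℝ} (hnε : n * ε ^ 4 = 1) {k : ℕ}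
    (hk : k ≤ 4) : avg P ξ β n (fun p => (ε ^ 2 * |overlap ξ n p|) ^ k) ≤ C + 1 := by
  have hF := hξ.isField_pairField β n
  have hb : ∀ k, BddMeas fun p : (Fin n → Ω) × (Fin n → Ω) => (ε ^ 2 * |overlap ξ n p|) ^ k :=
    fun k => ((BddMeas.const _).mul hξ.bddMeas_overlap.abs).pow k
  calc avg P ξ β n (fun p => (ε ^ 2 * |overlap ξ n p|) ^ k)
      ≤ avg P ξ β n (fun p => (ε ^ 2) ^ 4 * overlap ξ n p ^ 4 + 1) := by
        refine gibbs_mono _ hF (hb k) (((BddMeas.const _).mul (hξ.bddMeas_overlap.pow 4)).add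
          (BddMeas.const 1)) fun p => ?_
        refine (pow_le_pow_four_add_one (by positivity) hk).trans (le_of_eq ?_)
        rw [mul_pow, ← abs_pow, abs_of_nonneg (by positivity : 0 ≤ overlap ξ n p ^ 4)]
    _ = (ε ^ 2) ^ 4 * avg P ξ β n (fun p => overlap ξ n p ^ 4) + 1 := by
        unfold avg
        rw [gibbs_add _ hF ((BddMeas.const _).mul (hξ.bddMeas_overlap.pow 4)) (BddMeas.const 1),
          gibbs_const_mul, gibbs_one _ hF]
    _ ≤ (ε ^ 2) ^ 4 * (C * (n : ℝ) ^ 2) + 1 := by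
        gcongr
        exact h n hn β hβ hl
    _ = C * (n * ε ^ 4) ^ 2 + 1 := by ring
    _ = C + 1 := by rw [hnε]; ring

theorem gibbsGram_spinField (hβ : 0 ≤ β) (k : ℕ) :
    gibbsGram (pairField β ξ n) (prior P n) (spinField β ξ n) k =
      β ^ k * avg P ξ β n (fun p => |overlap ξ n p| ^ k) := by
  unfold gibbsGram avg
  rw [← gibbs_const_mul]
  congr 1
  ext p
  rw [gram_spinField hβ, abs_mul, abs_of_nonneg hβ, mul_pow]

theorem OverlapBound.gibbsGram_le {l C : ℝ} (h : OverlapBound P ξ l C) (hξ : IsSpin P ξ M)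
    (hn : 1 ≤ n) (hβ : 0 < β) (hl : n * β ≤ l) {ε : ℝ} (hε : 0 < ε) (hnε : n * ε ^ 4 = 1) {k : ℕ}
    (hk : k ≤ 4) : gibbsGram (pairField β ξ n) (prior P n) (spinField β ξ n) k ≤
      (n * β) ^ k * ε ^ (2 * k) * (C + 1) := by
  have h1 := h.avg_pow_le hξ hn hβ hl hnε hk
  have h2 : avg P ξ β n (fun p => (ε ^ 2 * |overlap ξ n p|) ^ k) =
      ε ^ (2 * k) * avg P ξ β n (fun p => |overlap ξ n p| ^ k) := by
    unfold avg
    rw [← gibbs_const_mul]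
    simp only [mul_pow, pow_mul]
  have hβ' : β = n * β * ε ^ 4 := by linear_combination (-β) * hnε
  rw [gibbsGram_spinField hβ.le]
  calc β ^ k * avg P ξ β n (fun p => |overlap ξ n p| ^ k)
      = (n * β * ε ^ 4) ^ k * avg P ξ β n (fun p => |overlap ξ n p| ^ k) := by rw [← hβ']
    _ = (n * β) ^ k * ε ^ (2 * k) * (ε ^ (2 * k) * avg P ξ β n (fun p => |overlap ξ n p| ^ k)) := by
        ring
    _ ≤ _ := by
        rw [← h2]
        gcongr

theorem gibbsGram_two (hβ : 0 ≤ β) (hn : 1 ≤ n) :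
    gibbsGram (pairField β ξ n) (prior P n) (spinField β ξ n) 2 =
      β * (n * β * overlapVar P ξ β n) := by
  have : (n : ℝ) ≠ 0 := by positivity
  rw [gibbsGram_spinField hβ, overlapVar]
  simp only [sq_abs]
  field_simp

theorem gibbsGram_nonneg {X K J : Type*} [MeasurableSpace X] [Fintype K] [Fintype J]
    {a : X → K → ℝ} {A κ : ℝ} (ν : Measure X) [IsProbabilityMeasure ν] (ha : IsField a A)
    {v : X → J → ℝ} (hv : IsField v κ) (k : ℕ) : 0 ≤ gibbsGram a ν v k :=
  gibbs_nonneg ν ha ((bddMeas_gram hv).abs.pow k) fun _ => by positivity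

/-- The approximate recursion for the normalized second moment of the overlap. -/
theorem OverlapBound.abs_overlapVar_succ_sub_le {l C : ℝ} (h : OverlapBound P ξ l C)
    (hξ : IsSpin P ξ M) (hl1 : l ≤ 1) (hC : 0 ≤ C) (hn : 1 ≤ n) (hβ : 0 < β) (hl : n * β ≤ l)
    {ε : ℝ} (hε : 0 < ε) (hε1 : ε ≤ 1) (hnε : n * ε ^ 4 = 1) :
    |overlapVar P ξ β (n + 1) - n * β * overlapVar P ξ β n - 1| ≤
      (colConst M (M ^ 2) * (5 * (C + 1) + 1) +
        M ^ 2 * (1 + colConst M (M ^ 2) * (C + 1))) * ε := by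
  set b := n * β with hb
  set c := colConst M (M ^ 2) with hc
  have hc1 : 1 ≤ c := one_le_colConst hξ.one_le (sq_nonneg _)
  have hn0 : (0 : ℝ) < n := by exact_mod_cast hn
  have hb0 : 0 < b := by positivity
  have hb1 : b ≤ 1 := hl.trans hl1
  have hβ' : β = b * ε ^ 4 := by rw [hb]; linear_combination (-β) * hnε
  have ha := hξ.isField_pairField β n
  have hv : IsField (spinField β ξ n) (M ^ 2) := (hξ.isField_spinField hβ.le n).mono (by
    have : 0 ≤ M ^ 2 := sq_nonneg _
    exact mul_le_of_le_one_left this hb1)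
  have hG := fun k (hk : k ≤ 4) => h.gibbsGram_le hξ hn hβ hl hε hnε hk
  have hG3 := hG 3 (by norm_num)
  have hG4 := hG 4 (by norm_num)
  have hG1 := hG 1 (by norm_num)
  have hcross := abs_gibbs_extField_cross_sub_le (prior P n) ha hξ hv
    (k := (b * ε ^ 3)⁻¹) (θ := ε ^ 2) (by positivity) (by positivity)
  have hdiag := abs_gibbs_extField_diag_sub_le (prior P n) ha hξ hv hε
  rw [gibbsGram_two hβ.le hn, ← hb] at hcross
  set E := extField (pairField β ξ n) ξ (spinField β ξ n) with hE
  set X := gibbs E ((prior P n).prod P) (fun p => ξ p.1.2 * ξ p.2.2 * overlap ξ n (p.1.1, p.2.1))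
    with hX
  have h1 : gibbs E ((prior P n).prod P)
      (fun p => ξ p.1.2 * ξ p.2.2 * gram (spinField β ξ n) p.1.1 p.2.1) = β * X := by
    rw [hX, ← gibbs_const_mul]
    congr 1
    ext p
    rw [gram_spinField hβ.le]
    ring
  rw [h1, ← mul_sub, abs_mul, abs_of_pos hβ] at hcross
  have h2 : overlapVar P ξ β (n + 1) = X +
      gibbs E ((prior P n).prod P) (fun p => (ξ p.1.2 * ξ p.2.2) ^ 2) := by
    rw [overlapVar, avg_overlap_sq_succ hξ hβ.le]
    push_cast
    rw [mul_div_cancel_left₀ _ (by positivity : (n : ℝ) + 1 ≠ 0)]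
  have hx : |X - b * overlapVar P ξ β n| ≤ c * (5 * (C + 1) + 1) * ε := by
    refine le_of_mul_le_mul_left (hcross.trans ?_) hβ
    set D := C + 1 with hD
    have hD0 : 0 < D := by positivity
    calc _ ≤ c * (b ^ 3 * ε ^ (2 * 3) * D + (b * ε ^ 3)⁻¹ * (b ^ 4 * ε ^ (2 * 4) * D) +
          (3 * (b ^ 3 * ε ^ (2 * 3) * D) / ε ^ 2 + ε ^ 2) / (b * ε ^ 3)⁻¹) := by
          gcongr
      _ = β * (c * (b ^ 2 * ε ^ 2 * D + b ^ 2 * ε * D + 3 * b ^ 3 * ε ^ 3 * D + ε)) := by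
          rw [hβ']
          field_simp
          ring
      _ ≤ β * (c * (1 * ε * D + 1 * ε * D + 3 * 1 * ε * D + ε)) := by
          have e2 : ε ^ 2 ≤ ε := by nlinarith
          have e3 : ε ^ 3 ≤ ε := by nlinarith
          have b2 : b ^ 2 ≤ 1 := pow_le_one₀ hb0.le hb1
          have b3 : b ^ 3 ≤ 1 := pow_le_one₀ hb0.le hb1
          gcongr
      _ = _ := by ring
  have hy : |gibbs E ((prior P n).prod P) (fun p => (ξ p.1.2 * ξ p.2.2) ^ 2) - 1| ≤
      M ^ 2 * (1 + c * (C + 1)) * ε := by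
    refine hdiag.trans ?_
    calc _ ≤ M ^ 2 * (ε + c * (b ^ 1 * ε ^ (2 * 1) * (C + 1)) / ε) := by
          gcongr
      _ = M ^ 2 * (1 + c * (b * (C + 1))) * ε := by
          field_simp
          ring
      _ ≤ M ^ 2 * (1 + c * (1 * (C + 1))) * ε := by gcongr
      _ = _ := by ring
  calc _ = |(X - b * overlapVar P ξ β n) +
        (gibbs E ((prior P n).prod P) (fun p => (ξ p.1.2 * ξ p.2.2) ^ 2) - 1)| := by
        rw [h2]; congr 1; ring
    _ ≤ _ := (abs_add_le _ _).trans (add_le_add hx hy)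
    _ = _ := by ring

/-- The increment of the information. -/
theorem OverlapBound.abs_info_succ_sub_le {l C : ℝ} (h : OverlapBound P ξ l C)
    (hξ : IsSpin P ξ M) (hl1 : l ≤ 1) (hn : 1 ≤ n) (hβ : 0 < β) (hl : n * β ≤ l)
    {ε : ℝ} (hε : 0 < ε) (hε1 : ε ≤ 1) (hnε : n * ε ^ 4 = 1) :
    |info (pairField β ξ (n + 1)) (prior P (n + 1)) - info (pairField β ξ n) (prior P n) -
      β * (n * β * overlapVar P ξ β n) / 4| ≤ 200 * colConst M (M ^ 2) * (C + 1) * ε * β := by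
  set b := n * β with hb
  set c := colConst M (M ^ 2) with hc
  have hc1 : 1 ≤ c := one_le_colConst hξ.one_le (sq_nonneg _)
  have hn0 : (0 : ℝ) < n := by exact_mod_cast hn
  have hb0 : 0 < b := by positivity
  have hb1 : b ≤ 1 := hl.trans hl1
  have hβ' : β = b * ε ^ 4 := by rw [hb]; linear_combination (-β) * hnε
  have ha := hξ.isField_pairField β n
  have hv : IsField (spinField β ξ n) (M ^ 2) := (hξ.isField_spinField hβ.le n).mono (by
    have : 0 ≤ M ^ 2 := sq_nonneg _
    exact mul_le_of_le_one_left this hb1)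
  have hG := fun k (hk : k ≤ 4) => h.gibbsGram_le hξ hn hβ hl hε hnε hk
  have hG2 := hG 2 (by norm_num)
  have hG3 := hG 3 (by norm_num)
  have hD0 : 0 ≤ C + 1 := by
    have := (gibbsGram_nonneg (prior P n) ha hv 2).trans hG2
    exact nonneg_of_mul_nonneg_right this (by positivity)
  have hkl := abs_info_extField_sub_le (prior P n) ha hξ hv hε hε1
  rw [gibbsGram_two hβ.le hn, ← hb, ← info_succ hξ] at hkl
  refine hkl.trans ?_
  rw [gibbsGram_two hβ.le hn, ← hb] at hG2
  set D := C + 1 with hD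
  calc _ ≤ 100 * c * (ε * (b ^ 2 * ε ^ (2 * 2) * D) + b ^ 3 * ε ^ (2 * 3) * D / ε) := by
        gcongr
    _ = 100 * c * D * β * ε * (b + b ^ 2) := by
        rw [hβ']
        field_simp
        ring
    _ ≤ 100 * c * D * β * ε * (1 + 1) := by
        have b2 : b ^ 2 ≤ 1 := pow_le_one₀ hb0.le hb1
        gcongr
    _ = _ := by ring

end Recursion
end SpikedWigner



namespace SpikedWigner
open scoped NNReal ENNReal

section Limit

/-- The solution of `e (n + 1) = q * e n + r n`. -/
noncomputable def recSeq (q : ℝ) (r : ℕ → ℝ) (e : ℝ) : ℕ → ℝ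
  | 0 => e
  | n + 1 => q * recSeq q r e n + r n

theorem recSeq_nonneg {q e : ℝ} {r : ℕ → ℝ} (hq : 0 ≤ q) (hr : ∀ n, 0 ≤ r n) (he : 0 ≤ e) (n : ℕ) :
    0 ≤ recSeq q r e n := by
  induction n with
  | zero => exact he
  | succ n ih => exact add_nonneg (mul_nonneg hq ih) (hr n)

theorem tendsto_recSeq {q e : ℝ} {r : ℕ → ℝ} (hq : 0 ≤ q) (hq1 : q < 1) (hr0 : ∀ n, 0 ≤ r n)
    (he : 0 ≤ e) (hr : Tendsto r atTop (𝓝 0)) : Tendsto (recSeq q r e) atTop (𝓝 0) := by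
  rw [Metric.tendsto_atTop]
  intro ε hε
  have h1 : 0 < ε * (1 - q) / 2 := by have := sub_pos.2 hq1; positivity
  obtain ⟨N, hN⟩ := (hr.eventually_lt_const h1).exists_forall_of_atTop
  have hk : ∀ k, recSeq q r e (N + k) ≤ q ^ k * recSeq q r e N + ε / 2 := by
    intro k
    induction k with
    | zero =>
      have := half_pos hε
      simp only [pow_zero, one_mul, add_zero]
      linarith
    | succ k ih =>
      have := hN (N + k) (Nat.le_add_right _ _)
      calc recSeq q r e (N + (k + 1)) = q * recSeq q r e (N + k) + r (N + k) := rfl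
        _ ≤ q * (q ^ k * recSeq q r e N + ε / 2) + ε * (1 - q) / 2 := by gcongr
        _ = _ := by ring
  have ht : Tendsto (fun k => q ^ k * recSeq q r e N) atTop (𝓝 0) := by
    simpa using (tendsto_pow_atTop_nhds_zero_of_lt_one hq hq1).mul_const (recSeq q r e N)
  obtain ⟨K, hK⟩ := (ht.eventually_lt_const (half_pos hε)).exists_forall_of_atTop
  refine ⟨N + K, fun n hn => ?_⟩
  obtain ⟨k, rfl⟩ := Nat.exists_eq_add_of_le (le_of_add_le_left hn : N ≤ n)
  have h2 := hK k (by omega)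
  rw [Real.dist_eq, sub_zero, abs_of_nonneg (recSeq_nonneg hq hr0 he _)]
  linarith [hk k]

/-- The scale `n ^ (-1/4)`. -/
noncomputable def quarter (n : ℕ) : ℝ := (√(√n))⁻¹

theorem quarter_pos {n : ℕ} (hn : 1 ≤ n) : 0 < quarter n := by
  have : (0 : ℝ) < n := by exact_mod_cast hn
  unfold quarter; positivity

theorem quarter_le_one {n : ℕ} (hn : 1 ≤ n) : quarter n ≤ 1 := by
  have : (1 : ℝ) ≤ n := by exact_mod_cast hn
  unfold quarter
  exact inv_le_one_of_one_le₀ (Real.one_le_sqrt.2 (Real.one_le_sqrt.2 this))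

theorem mul_quarter_pow_four {n : ℕ} (hn : 1 ≤ n) : n * quarter n ^ 4 = 1 := by
  have h : (0 : ℝ) < n := by exact_mod_cast hn
  have : √(√(n : ℝ)) ^ 4 = n := by
    rw [show √(√(n : ℝ)) ^ 4 = (√(√(n : ℝ)) ^ 2) ^ 2 by ring, Real.sq_sqrt (Real.sqrt_nonneg _),
      Real.sq_sqrt h.le]
  rw [quarter, inv_pow, this, mul_inv_cancel₀ h.ne']

theorem tendsto_quarter : Tendsto quarter atTop (𝓝 0) :=
  tendsto_inv_atTop_zero.comp (Real.tendsto_sqrt_atTop.comp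
    (Real.tendsto_sqrt_atTop.comp tendsto_natCast_atTop_atTop))

/-- The limiting information. -/
noncomputable def limitInfo (t : ℝ) : ℝ := 1 / 4 * (-Real.log (1 - t) - t)

theorem abs_limitInfo_sub_le {b β l : ℝ} (hβ : 0 < β) (hl : b + β ≤ l) (hl1 : l < 1) :
    |limitInfo (b + β) - limitInfo b - β * (b * (1 / (1 - b))) / 4| ≤ β ^ 2 / (1 - l) ^ 2 / 4 := by
  have h1 : 0 < 1 - b := by linarith
  have h2 : 0 < 1 - (b + β) := by linarith
  have h3 : 0 < 1 - l := by linarith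
  set y := (1 - (b + β)) / (1 - b) with hy
  have hy0 : 0 < y := by positivity
  have hlog : Real.log y = Real.log (1 - (b + β)) - Real.log (1 - b) :=
    Real.log_div h2.ne' h1.ne'
  have hu := Real.log_le_sub_one_of_pos hy0
  have hd := Real.one_sub_inv_le_log_of_pos hy0
  have e1 : limitInfo (b + β) - limitInfo b - β * (b * (1 / (1 - b))) / 4 =
      (1 / 4) * (-Real.log y - (1 - y)) := by
    rw [limitInfo, limitInfo, hlog, hy]
    field_simp
    ring
  have e2 : y⁻¹ - 1 - (1 - y) = β ^ 2 / ((1 - b) * (1 - (b + β))) := by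
    rw [hy]
    field_simp
    ring
  have e3 : β ^ 2 / ((1 - b) * (1 - (b + β))) ≤ β ^ 2 / (1 - l) ^ 2 := by
    rw [sq (1 - l)]
    gcongr
    all_goals linarith
  rw [e1, abs_of_nonneg (by linarith)]
  linarith

variable {Ω : Type*} [MeasurableSpace Ω] {P : Measure Ω} {ξ : Ω → ℝ} {M : ℝ}
variable [IsProbabilityMeasure P]

theorem info_one (β : ℝ) : info (pairField β ξ 1) (prior P 1) = 0 := by
  have : IsEmpty (Pairs 1) := ⟨fun p => by
    have := p.2
    omega⟩
  simp [info, mix, lr]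

theorem exists_tendsto_overlapVar {l C : ℝ} (h : OverlapBound P ξ l C) (hξ : IsSpin P ξ M)
    (hl0 : 0 ≤ l) (hl1 : l < 1) (hC : 0 ≤ C) : ∃ e : ℕ → ℝ, Tendsto e atTop (𝓝 0) ∧ (∀ n, 0 ≤ e n) ∧
      ∀ (n : ℕ) (β : ℝ), 0 < β → (n + 1 : ℕ) * β ≤ l →
        |overlapVar P ξ β (n + 1) - 1 / (1 - (n + 1 : ℕ) * β)| ≤ e n := by
  have hc1 : 1 ≤ colConst M (M ^ 2) := one_le_colConst hξ.one_le (sq_nonneg _)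
  set K := colConst M (M ^ 2) * (5 * (C + 1) + 1) + M ^ 2 * (1 + colConst M (M ^ 2) * (C + 1))
    with hK
  have hK0 : 0 ≤ K := by positivity
  have h1l : 0 < 1 - l := by linarith
  set r : ℕ → ℝ := fun n => K * quarter (n + 1) + 1 / (1 - l) ^ 2 * (1 / ((n : ℝ) + 1)) with hr
  have hq0 : ∀ n, 0 ≤ r n := fun n => by
    have := quarter_pos (n := n + 1) (by omega)
    simp only [hr]; positivity
  have hrt : Tendsto r atTop (𝓝 0) := by
    have h1 := (tendsto_quarter.comp (tendsto_add_atTop_nat 1)).const_mul K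
    have h2 := (tendsto_one_div_add_atTop_nhds_zero_nat (𝕜 := ℝ)).const_mul (1 / (1 - l) ^ 2)
    have h3 := h1.add h2
    simp only [mul_zero, add_zero] at h3
    exact h3
  have hE : 0 ≤ C + 1 + 1 / (1 - l) := by positivity
  refine ⟨recSeq l r (C + 1 + 1 / (1 - l)), tendsto_recSeq hl0 hl1 hq0 hE hrt,
    recSeq_nonneg hl0 hq0 hE, fun n β hβ => ?_⟩
  induction n with
  | zero =>
    intro hl
    simp only [zero_add, Nat.cast_one, one_mul] at hl ⊢
    have h1 := h.avg_pow_le hξ le_rfl hβ (by simpa using hl) (ε := 1) (by norm_num) (k := 2)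
      (by norm_num)
    simp only [one_pow, one_mul, sq_abs] at h1
    have h0 : 0 ≤ avg P ξ β 1 (fun p => overlap ξ 1 p ^ 2) :=
      gibbs_nonneg _ (hξ.isField_pairField β 1) (hξ.bddMeas_overlap.pow 2) fun _ => sq_nonneg _
    have h2 : 1 / (1 - β) ≤ 1 / (1 - l) := by gcongr
    have h3 : 0 ≤ 1 / (1 - β) := by have : 0 < 1 - β := by linarith
                                    positivity
    have h4 : overlapVar P ξ β 1 = avg P ξ β 1 (fun p => overlap ξ 1 p ^ 2) := by
      simp [overlapVar]
    rw [h4, recSeq, abs_le]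
    constructor <;> linarith
  | succ n ih =>
    intro hl
    have hl' : (n + 1 : ℕ) * β + β ≤ l := by push_cast at hl ⊢; linarith
    have hlb : (n + 1 : ℕ) * β ≤ l := by linarith
    have ih := ih hlb
    have hs := h.abs_overlapVar_succ_sub_le hξ hl1.le hC (n := n + 1) (by omega) hβ hlb
      (quarter_pos (by omega)) (quarter_le_one (by omega)) (mul_quarter_pow_four (by omega))
    have e1 : ((n + 1 + 1 : ℕ) : ℝ) * β = (n + 1 : ℕ) * β + β := by push_cast; ring
    rw [e1]
    have hb0 : 0 ≤ ((n + 1 : ℕ) : ℝ) * β := by positivity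
    have hβn : ((n + 1 : ℕ) : ℝ) * β ≤ 1 := by linarith
    set b := ((n + 1 : ℕ) : ℝ) * β with hb
    have p1 : 0 < 1 - b := by linarith
    have p2 : 0 < 1 - (b + β) := by linarith
    have hd : 1 / (1 - (b + β)) - 1 / (1 - b) ≤ 1 / (1 - l) ^ 2 * (1 / ((n : ℝ) + 1)) := by
      have : 1 / (1 - (b + β)) - 1 / (1 - b) = β / ((1 - b) * (1 - (b + β))) := by
        field_simp; ring
      rw [this]
      calc β / ((1 - b) * (1 - (b + β))) ≤ β / ((1 - l) * (1 - l)) := by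
            gcongr
        _ = 1 / (1 - l) ^ 2 * β := by field_simp
        _ ≤ _ := by
          gcongr
          rw [le_div_iff₀ (by positivity)]
          push_cast at hb
          linarith
    have hd0 : 0 ≤ 1 / (1 - (b + β)) - 1 / (1 - b) := by
      have : 1 / (1 - b) ≤ 1 / (1 - (b + β)) := by gcongr; linarith
      linarith
    have hid : 1 + b * (1 / (1 - b)) = 1 / (1 - b) := by field_simp; ring
    calc |overlapVar P ξ β (n + 1 + 1) - 1 / (1 - (b + β))|
        = |(overlapVar P ξ β (n + 1 + 1) - b * overlapVar P ξ β (n + 1) - 1) +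
          b * (overlapVar P ξ β (n + 1) - 1 / (1 - b)) +
          (-(1 / (1 - (b + β)) - 1 / (1 - b)))| := by
          congr 1; linear_combination hid
      _ ≤ K * quarter (n + 1) + b * recSeq l r (C + 1 + 1 / (1 - l)) n +
          1 / (1 - l) ^ 2 * (1 / ((n : ℝ) + 1)) := by
          refine (abs_add_le _ _).trans (add_le_add ((abs_add_le _ _).trans (add_le_add hs ?_)) ?_)
          · rw [abs_mul, abs_of_nonneg hb0]
            gcongr
          · rw [abs_neg, abs_of_nonneg hd0]
            exact hd
      _ ≤ K * quarter (n + 1) + l * recSeq l r (C + 1 + 1 / (1 - l)) n +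
          1 / (1 - l) ^ 2 * (1 / ((n : ℝ) + 1)) := by
          have := recSeq_nonneg hl0 hq0 hE n
          gcongr
      _ = _ := by rw [recSeq]; ring

/-- The information converges when the overlap is uniformly controlled. -/
theorem OverlapBound.tendsto_info {l C : ℝ} (h : OverlapBound P ξ l C) (hξ : IsSpin P ξ M)
    (hl0 : 0 < l) (hl1 : l < 1) (hC : 0 ≤ C) :
    Tendsto (fun N : ℕ => info (pairField (l / N) ξ N) (prior P N)) atTop (𝓝 (limitInfo l)) := by
  obtain ⟨e, he, he0, hw⟩ := exists_tendsto_overlapVar h hξ hl0.le hl1 hC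
  have hc1 : 1 ≤ colConst M (M ^ 2) := one_le_colConst hξ.one_le (sq_nonneg _)
  have h1l : 0 < 1 - l := by linarith
  set K := 200 * colConst M (M ^ 2) * (C + 1) with hK
  have hK0 : 0 ≤ K := by positivity
  set R : ℕ → ℝ := fun n => e n / 4 + K * quarter (n + 1) +
    1 / (1 - l) ^ 2 / 4 * (1 / ((n : ℝ) + 1)) with hR
  have hR0 : ∀ n, 0 ≤ R n := fun n => by
    have := quarter_pos (n := n + 1) (by omega)
    have := he0 n
    simp only [hR]; positivity
  have hRt : Tendsto R atTop (𝓝 0) := by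
    have h1 := (tendsto_quarter.comp (tendsto_add_atTop_nat 1)).const_mul K
    have h2 := (tendsto_one_div_add_atTop_nhds_zero_nat (𝕜 := ℝ)).const_mul (1 / (1 - l) ^ 2 / 4)
    have h3 := ((he.div_const 4).add h1).add h2
    simp only [mul_zero, add_zero, zero_div] at h3
    exact h3
  have hstep : ∀ (β : ℝ), 0 < β → ∀ N : ℕ, ((N + 1 : ℕ) : ℝ) * β ≤ l →
      |info (pairField β ξ (N + 1)) (prior P (N + 1)) - limitInfo ((N + 1 : ℕ) * β)| ≤
        |limitInfo β| + β * ∑ n ∈ Finset.range N, R n := by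
    intro β hβ N
    induction N with
    | zero =>
      intro _
      simp [info_one]
    | succ N ih =>
      intro hl
      have e1 : ((N + 1 + 1 : ℕ) : ℝ) * β = (N + 1 : ℕ) * β + β := by push_cast; ring
      rw [e1] at hl ⊢
      have hlb : ((N + 1 : ℕ) : ℝ) * β ≤ l := by linarith
      have ih := ih hlb
      have hi := h.abs_info_succ_sub_le hξ hl1.le (n := N + 1) (by omega) hβ hlb
        (quarter_pos (by omega)) (quarter_le_one (by omega)) (mul_quarter_pow_four (by omega))
      have hw' := hw N β hβ hlb
      have hb0 : 0 ≤ ((N + 1 : ℕ) : ℝ) * β := by positivity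
      have hβn : ((N + 1 : ℕ) : ℝ) * β ≤ 1 := by linarith
      have hg := abs_limitInfo_sub_le hβ hl hl1
      set b := ((N + 1 : ℕ) : ℝ) * β with hb
      rw [Finset.sum_range_succ]
      have hw2 : |β * (b * overlapVar P ξ β (N + 1)) / 4 - β * (b * (1 / (1 - b))) / 4| ≤
          β * (e N / 4) := by
        rw [show β * (b * overlapVar P ξ β (N + 1)) / 4 - β * (b * (1 / (1 - b))) / 4 =
          β * (b * ((overlapVar P ξ β (N + 1) - 1 / (1 - b)) / 4)) by ring, abs_mul,
          abs_of_pos hβ, abs_mul, abs_of_nonneg hb0, abs_div, abs_of_pos (by norm_num : (0:ℝ) < 4)]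
        have := abs_nonneg (overlapVar P ξ β (N + 1) - 1 / (1 - b))
        gcongr
        calc _ ≤ 1 * (|overlapVar P ξ β (N + 1) - 1 / (1 - b)| / 4) := by gcongr
          _ ≤ _ := by rw [one_mul]; gcongr
      have hg2 : β ^ 2 / (1 - l) ^ 2 / 4 ≤
          β * (1 / (1 - l) ^ 2 / 4 * (1 / ((N : ℝ) + 1))) := by
        have : β ≤ 1 / ((N : ℝ) + 1) := by
          rw [le_div_iff₀ (by positivity)]
          push_cast at hb
          linarith
        calc β ^ 2 / (1 - l) ^ 2 / 4 = β * (1 / (1 - l) ^ 2 / 4 * β) := by ring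
          _ ≤ _ := by gcongr
      simp only [hR]
      have a1 := abs_le.1 ih
      have a2 := abs_le.1 hi
      have a3 := abs_le.1 hw2
      have a4 := abs_le.1 hg
      rw [abs_le]
      simp only [hR] at a1
      constructor <;> linarith
  rw [← tendsto_add_atTop_iff_nat 1, tendsto_iff_dist_tendsto_zero]
  have hces := (hRt.cesaro.comp (tendsto_add_atTop_nat 1)).const_mul l
  have hdiv : Tendsto (fun N : ℕ => l / ((N + 1 : ℕ) : ℝ)) atTop (𝓝 0) :=
    (tendsto_const_div_atTop_nhds_zero_nat l).comp (tendsto_add_atTop_nat 1)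
  have hlim : Tendsto limitInfo (𝓝 0) (𝓝 0) := by
    have : ContinuousAt limitInfo 0 := by
      unfold limitInfo
      refine ContinuousAt.mul continuousAt_const (ContinuousAt.sub (ContinuousAt.neg
        (ContinuousAt.log (by fun_prop) (by norm_num))) continuousAt_id)
    have h0 : limitInfo 0 = 0 := by simp [limitInfo]
    simpa [ContinuousAt, h0] using this
  have hb := (hlim.comp hdiv).abs.add hces
  simp only [abs_zero, mul_zero, add_zero] at hb
  refine squeeze_zero (fun _ => dist_nonneg) (fun N => ?_) hb
  have hN : (0 : ℝ) < (N + 1 : ℕ) := by positivity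
  have := hstep (l / (N + 1 : ℕ)) (by positivity) N (by rw [mul_div_cancel₀ _ hN.ne'])
  rw [mul_div_cancel₀ _ hN.ne'] at this
  rw [Real.dist_eq]
  refine this.trans ?_
  simp only [Function.comp]
  refine add_le_add le_rfl ?_
  have hsum : ∑ n ∈ Finset.range N, R n ≤ ∑ n ∈ Finset.range (N + 1), R n := by
    rw [Finset.sum_range_succ]
    linarith [hR0 N]
  calc l / (N + 1 : ℕ) * ∑ n ∈ Finset.range N, R n ≤
      l / (N + 1 : ℕ) * ∑ n ∈ Finset.range (N + 1), R n := by gcongr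
    _ = _ := by rw [div_eq_mul_inv, mul_assoc]

end Limit
end SpikedWigner



namespace SpikedWigner
open scoped NNReal ENNReal

section SubGaussian
variable {Z : Type*} [MeasurableSpace Z] {μ : Measure Z} [IsProbabilityMeasure μ] {T : Z → ℝ}

/-- Gaussian control of the moment generating function of a sum of `n` variables near zero. -/
def SubGaussianNear (μ : Measure Z) (T : Z → ℝ) (n : ℕ) (δ t₀ : ℝ) : Prop :=
  ∀ t : ℝ, |t| ≤ t₀ → ∫ z, Real.exp (t * T z) ∂μ ≤ Real.exp (n * ((1 + δ) * t ^ 2 / 2))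

theorem BddMeas.exp {f : Z → ℝ} (hf : BddMeas f) : BddMeas fun z => Real.exp (f z) := by
  obtain ⟨hm, B, hB⟩ := hf
  refine ⟨Real.measurable_exp.comp hm, Real.exp B, fun z => ?_⟩
  rw [abs_of_pos (Real.exp_pos _)]
  exact Real.exp_le_exp.2 ((le_abs_self _).trans (hB z))

theorem one_le_exp_add_exp {t s x : ℝ} (ht : 0 ≤ t) (hx : s ≤ |x|) :
    1 ≤ Real.exp (-(t * s)) * (Real.exp (t * x) + Real.exp (-t * x)) := by
  have h1 : Real.exp (t * |x|) ≤ Real.exp (t * x) + Real.exp (-t * x) := by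
    rcases abs_cases x with ⟨h, _⟩ | ⟨h, _⟩
    · rw [h]; linarith [Real.exp_pos (-t * x)]
    · rw [h, mul_neg, ← neg_mul]; linarith [Real.exp_pos (t * x)]
  have h2 : Real.exp (t * s) ≤ Real.exp (t * |x|) :=
    Real.exp_le_exp.2 (mul_le_mul_of_nonneg_left hx ht)
  rw [Real.exp_neg, inv_mul_eq_div, le_div_iff₀ (Real.exp_pos _)]
  linarith

theorem SubGaussianNear.integral_exp_add_exp_le {n : ℕ} {δ t₀ : ℝ} (h : SubGaussianNear μ T n δ t₀)
    (hT : BddMeas T) {t s : ℝ} (ht : 0 ≤ t) (ht0 : t ≤ t₀) :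
    ∫ z, Real.exp (-(t * s)) * (Real.exp (t * T z) + Real.exp (-t * T z)) ∂μ ≤
      2 * Real.exp (n * ((1 + δ) * t ^ 2 / 2) - t * s) := by
  have h1 := h t (by rwa [abs_of_nonneg ht])
  have h2 := h (-t) (by rwa [abs_neg, abs_of_nonneg ht])
  have hi : ∀ t : ℝ, Integrable (fun z => Real.exp (t * T z)) μ := fun t =>
    ((BddMeas.const t).mul hT).exp.integrable μ
  rw [integral_const_mul, integral_add (hi _) (hi _)]
  rw [neg_sq] at h2
  calc _ ≤ Real.exp (-(t * s)) * (Real.exp (n * ((1 + δ) * t ^ 2 / 2)) +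
        Real.exp (n * ((1 + δ) * t ^ 2 / 2))) := by gcongr
    _ = _ := by rw [sub_eq_neg_add, Real.exp_add]; ring

theorem SubGaussianNear.measureReal_le {n : ℕ} {δ t₀ ε : ℝ} (h : SubGaussianNear μ T n δ t₀)
    (hT : BddMeas T) (hδ : 0 ≤ δ) (hε : 0 ≤ ε) (hε0 : ε ≤ t₀) :
    μ.real {z | ε * n < |T z|} ≤ 2 * Real.exp (-(n * (ε ^ 2 / (2 * (1 + δ))))) := by
  have h1 : 0 < 1 + δ := by positivity
  have ht : ε / (1 + δ) ≤ t₀ := (div_le_self hε (by linarith)).trans hε0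
  have hm : MeasurableSet {z | ε * n < |T z|} := measurableSet_lt measurable_const hT.1.abs
  rw [← integral_indicator_one hm]
  refine (integral_mono (((BddMeas.const 1).indicator hm).integrable μ)
    (g := fun z => Real.exp (-(ε / (1 + δ) * (ε * n))) *
      (Real.exp (ε / (1 + δ) * T z) + Real.exp (-(ε / (1 + δ)) * T z))) ?_ fun z => ?_).trans
    ((h.integral_exp_add_exp_le hT (s := ε * n) (by positivity) ht).trans (le_of_eq ?_))
  · exact ((BddMeas.const _).mul (((BddMeas.const _).mul hT).exp.add
      ((BddMeas.const _).mul hT).exp)).integrable μ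
  · by_cases hz : z ∈ {z | ε * n < |T z|}
    · simp only [hz, Set.indicator_of_mem]
      exact one_le_exp_add_exp (by positivity) (le_of_lt hz)
    · simp only [hz, not_false_eq_true, Set.indicator_of_notMem]
      positivity
  · congr 2
    field_simp
    ring

/-- The truncated exponential moment of the square. -/
theorem SubGaussianNear.integral_exp_sq_le {n : ℕ} (hn : 1 ≤ n) {δ t₀ ε c : ℝ}
    (h : SubGaussianNear μ T n δ t₀) (hT : BddMeas T) (hδ : 0 ≤ δ) (hε : 0 ≤ ε) (hε0 : ε ≤ t₀)
    (hc : 0 ≤ c) (hcδ : c < 1 / (1 + δ)) :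
    ∫ z, {z | |T z| ≤ ε * n}.indicator (fun z => Real.exp (c * T z ^ 2 / (2 * n))) z ∂μ ≤
      2 * Real.exp (c / 2) / (1 - Real.exp (c / 2 - 1 / (1 + δ) / 2)) := by
  have h1 : 0 < 1 + δ := by positivity
  have hn0 : (0 : ℝ) < n := by exact_mod_cast hn
  have hm : MeasurableSet {z | |T z| ≤ ε * n} := measurableSet_le hT.1.abs measurable_const
  set q := Real.exp (c / 2 - 1 / (1 + δ) / 2) with hq
  have hq1 : q < 1 := by rw [hq, Real.exp_lt_one_iff]; linarith
  have hq0 : 0 < q := Real.exp_pos _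
  set s : ℕ → ℝ := fun k => √(k * n) with hs
  set t : ℕ → ℝ := fun k => √(k * n) / (n * (1 + δ)) with ht
  set K := ⌊ε ^ 2 * n⌋₊ + 1 with hK
  have hss : ∀ k : ℕ, s k ^ 2 = k * n := fun k => Real.sq_sqrt (by positivity)
  have ht0 : ∀ k, 0 ≤ t k := fun k => by simp only [ht]; positivity
  set G : ℕ → Z → ℝ := fun k z => Real.exp (c * (k + 1) / 2) * (Real.exp (-(t k * s k)) *
    (Real.exp (t k * T z) + Real.exp (-t k * T z))) with hG
  have hGb : ∀ k, BddMeas (G k) := fun k => (BddMeas.const _).mul ((BddMeas.const _).mul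
    (((BddMeas.const _).mul hT).exp.add ((BddMeas.const _).mul hT).exp))
  have hG0 : ∀ k z, 0 ≤ G k z := fun k z => by simp only [hG]; positivity
  have hsq : BddMeas fun z => c * T z ^ 2 / (2 * n) := by
    simp only [div_eq_mul_inv]
    exact ((BddMeas.const _).mul (hT.pow 2)).mul (BddMeas.const _)
  have hpt : ∀ z, {z | |T z| ≤ ε * n}.indicator (fun z => Real.exp (c * T z ^ 2 / (2 * n))) z ≤
      ∑ k ∈ Finset.range K, G k z := by
    intro z
    by_cases hz : z ∈ {z | |T z| ≤ ε * n}
    · rw [Set.indicator_of_mem hz]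
      have hz' : |T z| ≤ ε * n := hz
      have hTn : 0 ≤ T z ^ 2 / n := by positivity
      have hle : T z ^ 2 / n ≤ ε ^ 2 * n := by
        rw [div_le_iff₀ hn0, ← sq_abs]
        calc |T z| ^ 2 ≤ (ε * n) ^ 2 := pow_le_pow_left₀ (abs_nonneg _) hz' 2
          _ = _ := by ring
      have hkm : ⌊T z ^ 2 / n⌋₊ ∈ Finset.range K := by
        rw [Finset.mem_range, hK]
        exact Nat.lt_succ_of_le (Nat.floor_le_floor hle)
      refine le_trans ?_ (Finset.single_le_sum (f := fun k => G k z) (fun k _ => hG0 k z) hkm)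
      set k := ⌊T z ^ 2 / n⌋₊ with hk
      have hk1 : (k : ℝ) ≤ T z ^ 2 / n := Nat.floor_le hTn
      have hk2 : T z ^ 2 / n < k + 1 := Nat.lt_floor_add_one _
      have hsk : s k ≤ |T z| := by
        rw [← Real.sqrt_sq_eq_abs]
        refine Real.sqrt_le_sqrt ?_
        rwa [le_div_iff₀ hn0] at hk1
      calc Real.exp (c * T z ^ 2 / (2 * n)) ≤ Real.exp (c * (k + 1) / 2) := by
            rw [Real.exp_le_exp, show c * T z ^ 2 / (2 * n) = c * (T z ^ 2 / n) / 2 by field_simp]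
            gcongr
        _ ≤ _ := le_mul_of_one_le_right (Real.exp_pos _).le (one_le_exp_add_exp (ht0 k) hsk)
    · rw [Set.indicator_of_notMem hz]
      exact Finset.sum_nonneg fun k _ => hG0 k z
  refine (integral_mono ((hsq.exp.indicator hm).integrable μ)
    ((BddMeas.sum _ hGb).integrable μ) hpt).trans ?_
  rw [integral_finsetSum _ fun k _ => (hGb k).integrable μ]
  have hk : ∀ k ∈ Finset.range K, ∫ z, G k z ∂μ ≤ 2 * Real.exp (c / 2) * q ^ k := by
    intro k hk
    rw [Finset.mem_range, hK, Nat.lt_succ_iff, Nat.le_floor_iff (by positivity)] at hk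
    have htk : t k ≤ t₀ := by
      refine le_trans ?_ hε0
      have : √((k : ℝ) * n) ≤ ε * n := by
        rw [Real.sqrt_le_left (by positivity)]
        calc (k : ℝ) * n ≤ ε ^ 2 * n * n := by gcongr
          _ = _ := by ring
      simp only [ht]
      rw [div_le_iff₀ (by positivity)]
      refine this.trans ?_
      rw [← mul_assoc]
      exact le_mul_of_one_le_right (by positivity) (by linarith)
    simp only [hG]
    rw [integral_const_mul]
    refine (mul_le_mul_of_nonneg_left (h.integral_exp_add_exp_le hT (ht0 k) htk)
      (Real.exp_pos _).le).trans (le_of_eq ?_)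
    have e1 : n * ((1 + δ) * t k ^ 2 / 2) - t k * s k = -(k * (1 / (1 + δ) / 2)) := by
      have e2 : t k = s k / (n * (1 + δ)) := rfl
      rw [e2, div_pow, div_mul_eq_mul_div, ← sq, hss]
      field_simp
      ring
    rw [e1, hq, ← Real.exp_nat_mul]
    calc _ = 2 * (Real.exp (c * (k + 1) / 2) * Real.exp (-(k * (1 / (1 + δ) / 2)))) := by ring
      _ = 2 * (Real.exp (c / 2) * Real.exp (k * (c / 2 - 1 / (1 + δ) / 2))) := by
        rw [← Real.exp_add, ← Real.exp_add]
        congr 2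
        ring
      _ = _ := by ring
  refine (Finset.sum_le_sum hk).trans ?_
  rw [← Finset.mul_sum, div_eq_mul_inv]
  refine mul_le_mul_of_nonneg_left ?_ (by positivity)
  have := (summable_geometric_of_lt_one hq0.le hq1).sum_le_tsum (Finset.range K)
    fun k _ => pow_nonneg hq0.le k
  rwa [tsum_geometric_of_lt_one hq0.le hq1] at this

end SubGaussian

section Prior
variable {Ω : Type*} [MeasurableSpace Ω] {P : Measure Ω} {ξ : Ω → ℝ} {M : ℝ}
variable [IsProbabilityMeasure P]

theorem IsSpin.bddMeas_mul (hξ : IsSpin P ξ M) : BddMeas fun p : Ω × Ω => ξ p.1 * ξ p.2 :=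
  BddMeas.mul ⟨hξ.meas.comp measurable_fst, M, fun _ => hξ.bound _⟩
    ⟨hξ.meas.comp measurable_snd, M, fun _ => hξ.bound _⟩

theorem IsSpin.abs_mul_le (hξ : IsSpin P ξ M) (p : Ω × Ω) : |ξ p.1 * ξ p.2| ≤ M ^ 2 := by
  rw [abs_mul, sq]
  exact mul_le_mul (hξ.bound _) (hξ.bound _) (abs_nonneg _) hξ.nonneg

theorem IsSpin.exists_mgf_le (hξ : IsSpin P ξ M) {δ : ℝ} (hδ : 0 < δ) :
    ∃ t₀ : ℝ, 0 < t₀ ∧ ∀ t : ℝ, |t| ≤ t₀ →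
      ∫ p, Real.exp (t * (ξ p.1 * ξ p.2)) ∂(P.prod P) ≤ Real.exp ((1 + δ) * t ^ 2 / 2) := by
  have hM := hξ.one_le
  have hM0 := hξ.nonneg
  have hb := hξ.bddMeas_mul
  refine ⟨min (1 / M ^ 2) (δ / (2 * M ^ 6)), by positivity, fun t ht => ?_⟩
  have ht1 : |t| * M ^ 2 ≤ 1 := by
    have := ht.trans (min_le_left _ _)
    rwa [le_div_iff₀ (by positivity)] at this
  have ht2 : |t| * (2 * M ^ 6) ≤ δ := by
    have := ht.trans (min_le_right _ _)
    rwa [le_div_iff₀ (by positivity)] at this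
  have hpt : ∀ p : Ω × Ω, Real.exp (t * (ξ p.1 * ξ p.2)) ≤
      1 + t * (ξ p.1 * ξ p.2) + t ^ 2 / 2 * (ξ p.1 * ξ p.2) ^ 2 + δ / 2 * t ^ 2 := by
    intro p
    set x := t * (ξ p.1 * ξ p.2) with hx
    have hxa : |x| ≤ |t| * M ^ 2 := by
      rw [hx, abs_mul]
      exact mul_le_mul_of_nonneg_left (hξ.abs_mul_le p) (abs_nonneg _)
    have h1 := Real.exp_bound (hxa.trans ht1) (n := 3) (by norm_num)
    simp only [Finset.sum_range_succ, Finset.sum_range_zero] at h1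
    norm_num [Nat.factorial] at h1
    have h2 := (le_abs_self _).trans h1
    have h3 : |x| ^ 3 ≤ (|t| * M ^ 2) ^ 3 := pow_le_pow_left₀ (abs_nonneg _) hxa 3
    have h4 : (|t| * M ^ 2) ^ 3 ≤ δ / 2 * t ^ 2 := by
      rw [← sq_abs t]
      calc (|t| * M ^ 2) ^ 3 = |t| ^ 2 * (|t| * (2 * M ^ 6)) / 2 := by ring
        _ ≤ |t| ^ 2 * δ / 2 := by gcongr
        _ = _ := by ring
    have h5 : t ^ 2 / 2 * (ξ p.1 * ξ p.2) ^ 2 = x ^ 2 / 2 := by rw [hx]; ring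
    have h6 : 0 ≤ |x| ^ 3 := by positivity
    rw [h5]
    linarith
  have hm1 : ∫ p, ξ p.1 * ξ p.2 ∂(P.prod P) = 0 := by
    rw [integral_prod_mul (fun x => ξ x) (fun x => ξ x), hξ.mean, zero_mul]
  have hm2 : ∫ p, (ξ p.1 * ξ p.2) ^ 2 ∂(P.prod P) = 1 := by
    simp only [mul_pow]
    rw [integral_prod_mul (fun x => ξ x ^ 2) (fun x => ξ x ^ 2), hξ.second, one_mul]
  have i1 := (((BddMeas.const t).mul hb).integrable (P.prod P))
  have i2 := (((BddMeas.const (t ^ 2 / 2)).mul (hb.pow 2)).integrable (P.prod P))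
  have i0 : Integrable (fun _ : Ω × Ω => (1 : ℝ)) (P.prod P) := integrable_const _
  have i3 : Integrable (fun _ : Ω × Ω => δ / 2 * t ^ 2) (P.prod P) := integrable_const _
  have i01 : Integrable (fun p : Ω × Ω => 1 + t * (ξ p.1 * ξ p.2)) (P.prod P) := i0.add i1
  have i02 : Integrable (fun p : Ω × Ω => 1 + t * (ξ p.1 * ξ p.2) +
      t ^ 2 / 2 * (ξ p.1 * ξ p.2) ^ 2) (P.prod P) := i01.add i2
  refine (integral_mono (((BddMeas.const t).mul hb).exp.integrable _) (i02.add i3) hpt).trans ?_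
  have : ∫ p : Ω × Ω, (1 + t * (ξ p.1 * ξ p.2) + t ^ 2 / 2 * (ξ p.1 * ξ p.2) ^ 2 +
      δ / 2 * t ^ 2) ∂(P.prod P) = 1 + t ^ 2 / 2 + δ / 2 * t ^ 2 := by
    rw [integral_add i02 i3, integral_add i01 i2, integral_add i0 i1,
      integral_const_mul, integral_const_mul, hm1, hm2]
    simp
  refine this.le.trans (le_trans (le_of_eq ?_) (Real.add_one_le_exp _))
  ring

theorem integral_exp_overlap (hξ : IsSpin P ξ M) (t : ℝ) (n : ℕ) :
    ∫ p, Real.exp (t * overlap ξ n p) ∂((prior P n).prod (prior P n)) =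
      (∫ p, Real.exp (t * (ξ p.1 * ξ p.2)) ∂(P.prod P)) ^ n := by
  rw [integral_prod _ (((BddMeas.const t).mul hξ.bddMeas_overlap).exp.integrable _),
    integral_prod _ (((BddMeas.const t).mul hξ.bddMeas_mul).exp.integrable _)]
  have h1 : ∀ x x' : Fin n → Ω, Real.exp (t * overlap ξ n (x, x')) =
      ∏ i, Real.exp (t * (ξ (x i) * ξ (x' i))) := fun x x' => by
    rw [overlap, Finset.mul_sum, Real.exp_sum]
  simp only [h1]
  unfold prior
  have h2 : ∀ x : Fin n → Ω, ∫ x' : Fin n → Ω, ∏ i, Real.exp (t * (ξ (x i) * ξ (x' i)))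
      ∂(Measure.pi fun _ => P) = ∏ i, ∫ ω, Real.exp (t * (ξ (x i) * ξ ω)) ∂P := fun x =>
    integral_fintype_prod_eq_prod fun i ω => Real.exp (t * (ξ (x i) * ξ ω))
  simp only [h2]
  rw [integral_fintype_prod_eq_prod fun (_ : Fin n) (ω' : Ω) => ∫ ω, Real.exp (t * (ξ ω' * ξ ω)) ∂P]
  simp

theorem IsSpin.exists_subGaussianNear (hξ : IsSpin P ξ M) {δ : ℝ} (hδ : 0 < δ) :
    ∃ t₀ : ℝ, 0 < t₀ ∧ ∀ n,
      SubGaussianNear ((prior P n).prod (prior P n)) (overlap ξ n) n δ t₀ := by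
  obtain ⟨t₀, h0, h⟩ := hξ.exists_mgf_le hδ
  refine ⟨t₀, h0, fun n t ht => ?_⟩
  rw [integral_exp_overlap hξ, Real.exp_nat_mul]
  exact pow_le_pow_left₀ (integral_nonneg fun _ => (Real.exp_pos _).le) (h t ht) n

end Prior
end SpikedWigner



namespace SpikedWigner
open scoped NNReal ENNReal

section SmallOverlap
variable {Ω : Type*} [MeasurableSpace Ω] {P : Measure Ω} {ξ : Ω → ℝ} {M β : ℝ} {n : ℕ}

theorem gram_pairField (hβ : 0 ≤ β) (x x' : Fin n → Ω) :
    gram (pairField β ξ n) x x' =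
      β / 2 * (overlap ξ n (x, x') ^ 2 - ∑ i, (ξ (x i) * ξ (x' i)) ^ 2) := by
  have h := sq_sum_eq fun i : Fin n => ξ (x i) * ξ (x' i)
  have h2 : ∑ p ∈ pairSet (Fin n), ξ (x p.1) * ξ (x' p.1) * (ξ (x p.2) * ξ (x' p.2)) =
      ∑ p : Pairs n, ξ (x p.1.1) * ξ (x' p.1.1) * (ξ (x p.1.2) * ξ (x' p.1.2)) :=
    Finset.sum_subtype _ (fun p => by simp [pairSet]) _
  have h3 : gram (pairField β ξ n) x x' =
      β * ∑ p : Pairs n, ξ (x p.1.1) * ξ (x' p.1.1) * (ξ (x p.1.2) * ξ (x' p.1.2)) := by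
    rw [gram, Finset.mul_sum]
    refine Finset.sum_congr rfl fun p _ => ?_
    simp only [pairField]
    calc _ = √β * √β * (ξ (x p.1.1) * ξ (x' p.1.1) * (ξ (x p.1.2) * ξ (x' p.1.2))) := by ring
      _ = _ := by rw [Real.mul_self_sqrt hβ]
  rw [overlap, h, h2, h3]
  ring

theorem gram_pairField_le (hβ : 0 ≤ β) (p : (Fin n → Ω) × (Fin n → Ω)) :
    gram (pairField β ξ n) p.1 p.2 ≤ β / 2 * overlap ξ n p ^ 2 := by
  rw [gram_pairField hβ]
  refine mul_le_mul_of_nonneg_left ?_ (by positivity)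
  have : 0 ≤ ∑ i, (ξ (p.1 i) * ξ (p.2 i)) ^ 2 := by positivity
  simpa using this

variable [IsProbabilityMeasure P]

theorem IsSpin.le_gram_pairField (hξ : IsSpin P ξ M) (hβ : 0 ≤ β) (p : (Fin n → Ω) × (Fin n → Ω)) :
    β / 2 * (overlap ξ n p ^ 2 - n * M ^ 4) ≤ gram (pairField β ξ n) p.1 p.2 := by
  rw [gram_pairField hβ]
  refine mul_le_mul_of_nonneg_left (sub_le_sub_left ?_ _) (by positivity)
  have : ∀ i ∈ Finset.univ, (ξ (p.1 i) * ξ (p.2 i)) ^ 2 ≤ M ^ 4 := fun i _ => by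
    rw [← sq_abs]
    calc |ξ (p.1 i) * ξ (p.2 i)| ^ 2 ≤ (M ^ 2) ^ 2 :=
          pow_le_pow_left₀ (abs_nonneg _) (hξ.abs_mul_le (p.1 i, p.2 i)) 2
      _ = _ := by ring
  refine (Finset.sum_le_card_nsmul _ _ _ this).trans (le_of_eq ?_)
  simp

theorem pow_four_le_mul_exp {x : ℝ} (hx : 0 ≤ x) : x ^ 4 ≤ 24 * Real.exp x := by
  have := Real.pow_div_factorial_le_exp x hx 4
  rw [div_le_iff₀ (by positivity)] at this
  norm_num [Nat.factorial] at this
  linarith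

theorem avg_le_of_second_moment_le (hξ : IsSpin P ξ M) (hβ : 0 ≤ β) (hn : 1 ≤ n)
    {f g : (Fin n → Ω) × (Fin n → Ω) → ℝ} (hf : BddMeas f) (hg : BddMeas g)
    (hfg : ∀ p, f p ^ 2 * Real.exp (β / 2 * overlap ξ n p ^ 2) ≤ g p) {C : ℝ}
    (hC : ∫ p, g p ∂((prior P n).prod (prior P n)) ≤ C * n ^ 4) :
    avg P ξ β n f ≤ (C + 1) / 2 * n ^ 2 := by
  have hn0 : (0 : ℝ) < n := by exact_mod_cast hn
  have ha := hξ.isField_pairField β n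
  have h1 := gibbs_le_second_moment (prior P n) ha hf (t := 1 / (n : ℝ) ^ 2) (by positivity)
  have h2 : ∫ p, f p ^ 2 * Real.exp (gram (pairField β ξ n) p.1 p.2)
      ∂((prior P n).prod (prior P n)) ≤ C * n ^ 4 := by
    refine (integral_mono (((hf.pow 2).mul (bddMeas_gram ha).exp).integrable _)
      (hg.integrable _) fun p => ?_).trans hC
    refine le_trans ?_ (hfg p)
    simp only
    gcongr
    exact gram_pairField_le hβ p
  calc avg P ξ β n f ≤ _ := h1
    _ ≤ 1 / (n : ℝ) ^ 2 / 2 * (C * n ^ 4) + 1 / (2 * (1 / (n : ℝ) ^ 2)) := by gcongr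
    _ = _ := by field_simp

/-- The fourth moment of small overlaps, and of large overlaps at small coupling. -/
theorem IsSpin.exists_avg_small_le (hξ : IsSpin P ξ M) {l : ℝ} (hl0 : 0 ≤ l) (hl1 : l < 1) :
    ∃ ε ls C : ℝ, 0 < ε ∧ 0 < ls ∧ ∀ n : ℕ, 1 ≤ n → ∀ β : ℝ, 0 < β → n * β ≤ l →
      avg P ξ β n ({p | |overlap ξ n p| ≤ ε * n}.indicator fun p => overlap ξ n p ^ 4) ≤
        C * n ^ 2 ∧
      (n * β ≤ ls →
        avg P ξ β n ({p | ε * n < |overlap ξ n p|}.indicator fun p => overlap ξ n p ^ 4) ≤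
          C * n ^ 2) := by
  have hM := hξ.one_le
  set δ := (1 - l) / 4 with hδ
  have hδ0 : 0 < δ := by rw [hδ]; linarith
  set d := (1 - l) / 2 with hd
  have hd0 : 0 < d := by rw [hd]; linarith
  have hcδ : l + d < 1 / (1 + δ) := by
    rw [lt_div_iff₀ (by positivity), hd, hδ]
    nlinarith [mul_pos (sub_pos.2 hl1) (sub_pos.2 (hl1.trans (by norm_num : (1 : ℝ) < 3)))]
  obtain ⟨ε, hε, hsg⟩ := hξ.exists_subGaussianNear hδ0
  set a := ε ^ 2 / (4 * (1 + δ)) with ha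
  have ha0 : 0 < a := by positivity
  set B := 2 * Real.exp ((l + d) / 2) / (1 - Real.exp ((l + d) / 2 - 1 / (1 + δ) / 2)) with hB
  set C₁ := 24 * (2 / d) ^ 4 * B with hC₁
  set C₂ := M ^ 16 * (2 * (24 / a ^ 4)) with hC₂
  refine ⟨ε, 2 * a / M ^ 4, max ((C₁ + 1) / 2) ((C₂ + 1) / 2), hε, by positivity,
    fun n hn β hβ hl => ⟨?_, fun hls => ?_⟩⟩
  · have hn0 : (0 : ℝ) < n := by exact_mod_cast hn
    have hT := hξ.bddMeas_overlap (n := n)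
    have hm : MeasurableSet {p | |overlap ξ n p| ≤ ε * n} :=
      measurableSet_le hT.1.abs measurable_const
    have hs := (hsg n).integral_exp_sq_le hn hT hδ0.le hε.le le_rfl (by positivity) hcδ
    have hsq : BddMeas fun p => (l + d) * overlap ξ n p ^ 2 / (2 * n) := by
      simp only [div_eq_mul_inv]
      exact ((BddMeas.const _).mul (hT.pow 2)).mul (BddMeas.const _)
    refine (avg_le_of_second_moment_le hξ hβ.le hn ((hT.pow 4).indicator hm)
      (g := fun p => 24 * (2 * n / d) ^ 4 * {p | |overlap ξ n p| ≤ ε * n}.indicator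
        (fun p => Real.exp ((l + d) * overlap ξ n p ^ 2 / (2 * n))) p)
      ((BddMeas.const _).mul (hsq.exp.indicator hm)) (fun p => ?_) (C := C₁) ?_).trans ?_
    · by_cases hp : p ∈ {p | |overlap ξ n p| ≤ ε * n}
      · simp only [Set.indicator_of_mem hp]
        have h1 := pow_four_le_mul_exp (x := d * overlap ξ n p ^ 2 / (2 * n)) (by positivity)
        have h2 : β / 2 * overlap ξ n p ^ 2 ≤ l * overlap ξ n p ^ 2 / (2 * n) := by
          rw [le_div_iff₀ (by positivity)]
          calc _ = n * β * overlap ξ n p ^ 2 := by ring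
            _ ≤ _ := by gcongr
        calc (overlap ξ n p ^ 4) ^ 2 * Real.exp (β / 2 * overlap ξ n p ^ 2)
            = (2 * n / d) ^ 4 * (d * overlap ξ n p ^ 2 / (2 * n)) ^ 4 *
                Real.exp (β / 2 * overlap ξ n p ^ 2) := by field_simp
          _ ≤ (2 * n / d) ^ 4 * (24 * Real.exp (d * overlap ξ n p ^ 2 / (2 * n))) *
                Real.exp (l * overlap ξ n p ^ 2 / (2 * n)) := by gcongr
          _ = 24 * (2 * n / d) ^ 4 * (Real.exp (d * overlap ξ n p ^ 2 / (2 * n)) *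
                Real.exp (l * overlap ξ n p ^ 2 / (2 * n))) := by ring
          _ = _ := by
            rw [← Real.exp_add]
            congr 2
            ring
      · simp [Set.indicator_of_notMem hp]
    · rw [integral_const_mul]
      calc _ ≤ 24 * (2 * n / d) ^ 4 * B := by gcongr
        _ = _ := by rw [hC₁]; ring
    · gcongr
      exact le_max_left _ _
  · have hn0 : (0 : ℝ) < n := by exact_mod_cast hn
    have hT := hξ.bddMeas_overlap (n := n)
    have hm : MeasurableSet {p | ε * n < |overlap ξ n p|} :=
      measurableSet_lt measurable_const hT.1.abs
    have hs := (hsg n).measureReal_le hT hδ0.le hε.le le_rfl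
    refine (avg_le_of_second_moment_le hξ hβ.le hn ((hT.pow 4).indicator hm)
      (g := fun p => (n * M ^ 2) ^ 8 * Real.exp (n * a) *
        {p | ε * n < |overlap ξ n p|}.indicator (fun _ => 1) p)
      ((BddMeas.const _).mul ((BddMeas.const 1).indicator hm)) (fun p => ?_) (C := C₂) ?_).trans ?_
    · by_cases hp : p ∈ {p | ε * n < |overlap ξ n p|}
      · simp only [Set.indicator_of_mem hp, mul_one]
        have h1 := hξ.abs_overlap_le p
        have h2 : overlap ξ n p ^ 2 ≤ (n * M ^ 2) ^ 2 := by
          rw [← sq_abs]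
          exact pow_le_pow_left₀ (abs_nonneg _) h1 2
        have h3 : β / 2 * overlap ξ n p ^ 2 ≤ n * a := by
          calc β / 2 * overlap ξ n p ^ 2 ≤ β / 2 * (n * M ^ 2) ^ 2 := by gcongr
            _ = n * (n * β) * M ^ 4 / 2 := by ring
            _ ≤ n * (2 * a / M ^ 4) * M ^ 4 / 2 := by gcongr
            _ = _ := by field_simp
        calc (overlap ξ n p ^ 4) ^ 2 * Real.exp (β / 2 * overlap ξ n p ^ 2)
            = (overlap ξ n p ^ 2) ^ 4 * Real.exp (β / 2 * overlap ξ n p ^ 2) := by ring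
          _ ≤ ((n * M ^ 2) ^ 2) ^ 4 * Real.exp (n * a) := by gcongr
          _ = _ := by ring
      · simp [Set.indicator_of_notMem hp]
    · rw [integral_const_mul, integral_indicator_const _ hm, smul_eq_mul, mul_one]
      have h4 := pow_four_le_mul_exp (x := n * a) (by positivity)
      have h5 : (n : ℝ) * (ε ^ 2 / (2 * (1 + δ))) = 2 * (n * a) := by rw [ha]; field_simp; ring
      rw [h5] at hs
      calc _ ≤ (n * M ^ 2) ^ 8 * Real.exp (n * a) * (2 * Real.exp (-(2 * (n * a)))) := by gcongr
        _ = (n * M ^ 2) ^ 8 * 2 * (Real.exp (n * a) * Real.exp (-(2 * (n * a)))) := by ring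
        _ = (n * M ^ 2) ^ 8 * 2 * (Real.exp (n * a))⁻¹ := by
          rw [← Real.exp_add, ← Real.exp_neg]; congr 2; ring
        _ ≤ (n * M ^ 2) ^ 8 * 2 * (24 / (n * a) ^ 4) := by
          gcongr
          rw [inv_eq_one_div, div_le_div_iff₀ (Real.exp_pos _) (by positivity)]
          linarith
        _ = _ := by rw [hC₂]; field_simp
    · gcongr
      exact le_max_right _ _

end SmallOverlap
end SpikedWigner



namespace SpikedWigner
open scoped NNReal ENNReal

theorem rpow_le_one_add {x p : ℝ} (hx : 0 ≤ x) (hp : 0 ≤ p) (hp1 : p ≤ 1) : x ^ p ≤ 1 + x := by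
  rcases le_total x 1 with h | h
  · exact (Real.rpow_le_one hx h hp).trans (by linarith)
  · calc x ^ p ≤ x ^ (1 : ℝ) := Real.rpow_le_rpow_of_exponent_le h hp1
      _ ≤ _ := by rw [Real.rpow_one]; linarith

theorem ExpGrowth.rpow_of_nonneg {W : Type*} [MeasurableSpace W] {N f : W → ℝ}
    (hf : ExpGrowth N f) (h0 : ∀ w, 0 ≤ f w) {p : ℝ} (hp : 0 ≤ p) (hp1 : p ≤ 1) :
    ExpGrowth N (fun w => f w ^ p) := by
  refine ((ExpGrowth.const 1).add hf).mono (hf.1.pow_const p) fun w => ?_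
  rw [abs_of_nonneg (Real.rpow_nonneg (h0 w) p), abs_of_nonneg (add_nonneg zero_le_one (h0 w))]
  exact rpow_le_one_add (h0 w) hp hp1

section Window
variable {X K K' : Type*} [MeasurableSpace X] [Fintype K] [Fintype K']
variable {a : X → K → ℝ} {A : ℝ}

theorem integral_lr_mul (b : K → ℝ) {F : (K → ℝ) → ℝ} (hF : Measurable F) :
    ∫ y, lr 1 b y * F y ∂gaussPi K 1 = ∫ y, F (b + y) ∂gaussPi K 1 := by
  have hm : Measurable fun y : K → ℝ => b + y := by fun_prop
  rw [← integral_map hm.aemeasurable hF.aestronglyMeasurable, gaussPi_map_add,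
    integral_withDensity_eq_integral_toReal_smul (by fun_prop) (ae_of_all _ fun _ => by simp)]
  refine integral_congr_ae (ae_of_all _ fun y => ?_)
  simp only [ENNReal.toReal_ofReal (lr_pos _ _ _).le, smul_eq_mul]

theorem lr_shift (b c y : K → ℝ) :
    lr 1 b (c + y) = Real.exp (∑ k, b k * c k) * lr 1 b y := by
  simp only [lr, ← Real.exp_add, Pi.add_apply, mul_add, Finset.sum_add_distrib]
  congr 1
  ring

/-- The partition function restricted to a window around the true signal. -/
noncomputable def winMix (a : X → K → ℝ) (ν : Measure X) (B : Set (X × X)) (w : X × (K → ℝ)) : ℝ :=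
  ∫ x, B.indicator (fun _ => 1) (w.1, x) * lr 1 (a x) w.2 ∂ν

variable (ν : Measure X) [IsProbabilityMeasure ν] {B : Set (X × X)}

theorem growth_winMix_integrand (ha : IsField a A) (hB : MeasurableSet B) :
    ExpGrowth (fun q : X × (X × (K → ℝ)) => noiseSize q.2.2)
      (fun q => B.indicator (fun _ => 1) (q.2.1, q.1) * lr 1 (a q.1) q.2.2) :=
  (((BddMeas.const (1 : ℝ)).indicator hB).comp
    (φ := fun q : X × (X × (K → ℝ)) => (q.2.1, q.1)) (by fun_prop)).growth.mul
    ((ha.expPos_lr 1).growth.comp (φ := fun q : X × (X × (K → ℝ)) => (q.1, q.2.2))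
      (by fun_prop) fun _ => le_rfl)

theorem growth_winMix (ha : IsField a A) (hB : MeasurableSet B) :
    ExpGrowth (fun w : X × (K → ℝ) => noiseSize w.2) (winMix a ν B) :=
  ExpGrowth.integral (N := fun w : X × (K → ℝ) => noiseSize w.2) (growth_winMix_integrand ha hB) ν

theorem winMix_nonneg (w : X × (K → ℝ)) : 0 ≤ winMix a ν B w :=
  integral_nonneg fun _ => mul_nonneg (Set.indicator_nonneg (fun _ _ => zero_le_one) _)
    (lr_pos _ _ _).le

theorem integrable_winMix (ha : IsField a A) (hB : MeasurableSet B) (w : X × (K → ℝ)) :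
    Integrable (fun x => B.indicator (fun _ => 1) (w.1, x) * lr 1 (a x) w.2) ν :=
  ExpGrowth.integrable_section (N := fun w : X × (K → ℝ) => noiseSize w.2)
    (growth_winMix_integrand ha hB) ν w

theorem winMix_le_mix (ha : IsField a A) (hB : MeasurableSet B) (w : X × (K → ℝ)) :
    winMix a ν B w ≤ mix 1 a ν w.2 := by
  refine integral_mono (integrable_winMix ν ha hB w) (integrable_lr_section ν ha w.2) fun x => ?_
  refine mul_le_of_le_one_left (lr_pos _ _ _).le ?_
  exact Set.indicator_le' (fun _ _ => le_rfl) (fun _ _ => zero_le_one) _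

theorem numer_indicator (ha : IsField a A) (hB : MeasurableSet B) (y : K → ℝ) :
    numer a ν (B.indicator fun _ => 1) y = ∫ x, lr 1 (a x) y * winMix a ν B (x, y) ∂ν := by
  unfold numer winMix
  rw [integral_prod _ (integrable_lr_pair ν ha ((BddMeas.const 1).indicator hB) y)]
  refine integral_congr_ae (ae_of_all _ fun x => ?_)
  simp only
  rw [← integral_const_mul]
  refine integral_congr_ae (ae_of_all _ fun x' => ?_)
  simp only
  ring

theorem growth_lr_mul_winMix_rpow (ha : IsField a A) (hB : MeasurableSet B) {p : ℝ} (hp : 0 ≤ p)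
    (hp1 : p ≤ 1) : ExpGrowth (fun w : X × (K → ℝ) => noiseSize w.2)
      (fun w => lr 1 (a w.1) w.2 * winMix a ν B w ^ p) :=
  (ha.expPos_lr 1).growth.mul ((growth_winMix ν ha hB).rpow_of_nonneg (winMix_nonneg ν) hp hp1)

theorem gibbs_indicator_le (ha : IsField a A) (hB : MeasurableSet B) {p t : ℝ} (hp : 0 ≤ p)
    (hp1 : p ≤ 1) (ht : 0 < t) :
    gibbs a ν (B.indicator fun _ => 1) ≤
      t / 2 * ∫ x, ∫ y, lr 1 (a x) y * winMix a ν B (x, y) ^ p ∂gaussPi K 1 ∂ν + 1 / t := by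
  have hg := growth_lr_mul_winMix_rpow ν ha hB hp hp1
  have hgi : ExpGrowth noiseSize fun y => ∫ x, lr 1 (a x) y * winMix a ν B (x, y) ^ p ∂ν :=
    hg.integral ν
  rw [integral_integral_swap (f := fun x y => lr 1 (a x) y * winMix a ν B (x, y) ^ p)
    (hg.integrable ((expIntegrable_gaussPi 1).prod_snd ν))]
  have hL := integrable_mix ν ha
  have hLi := integral_mix ν ha 1
  have h1L : Integrable (fun y => 1 + mix 1 a ν y) (gaussPi K 1) := (integrable_const _).add hL
  have hR : Integrable (fun y => t / 2 * (∫ x, lr 1 (a x) y * winMix a ν B (x, y) ^ p ∂ν) +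
      1 / (2 * t) * (1 + mix 1 a ν y)) (gaussPi K 1) :=
    ((hgi.integrable (expIntegrable_gaussPi 1)).const_mul _).add
      (h1L.const_mul _)
  have hval : ∫ y, (t / 2 * (∫ x, lr 1 (a x) y * winMix a ν B (x, y) ^ p ∂ν) +
      1 / (2 * t) * (1 + mix 1 a ν y)) ∂gaussPi K 1 =
      t / 2 * ∫ y, ∫ x, lr 1 (a x) y * winMix a ν B (x, y) ^ p ∂ν ∂gaussPi K 1 + 1 / t := by
    rw [integral_add ((hgi.integrable (expIntegrable_gaussPi 1)).const_mul _)
      (h1L.const_mul _), integral_const_mul, integral_const_mul,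
      integral_add (integrable_const _) hL, hLi]
    simp
    field_simp
    norm_num
  rw [← hval]
  unfold gibbs
  refine integral_mono (integrable_numer_div ν ha ((BddMeas.const 1).indicator hB)) hR fun y => ?_
  have hm := mix_pos ν ha y
  have hsec : Integrable (fun x => lr 1 (a x) y * winMix a ν B (x, y) ^ p) ν :=
    hg.integrable_section ν y
  have hls := integrable_lr_section ν ha y
  have hpt : ∀ x, lr 1 (a x) y * winMix a ν B (x, y) ≤ mix 1 a ν y *
      (t / 2 * (lr 1 (a x) y * winMix a ν B (x, y) ^ p) +
        1 / (2 * t) * mix 1 a ν y ^ (-p) * lr 1 (a x) y) := by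
    intro x
    set e := lr 1 (a x) y with he
    set L := mix 1 a ν y with hLdef
    have he0 : 0 < e := lr_pos _ _ _
    have hw0 := winMix_nonneg (a := a) ν (B := B) (x, y)
    have hw1 := winMix_le_mix ν ha hB (x, y)
    set W := winMix a ν B (x, y) with hW
    have hr0 : 0 ≤ W / L := by positivity
    have hr1 : W / L ≤ 1 := (div_le_one hm).2 hw1
    have h1 : W / L ≤ W ^ (p / 2) * L ^ (-(p / 2)) := by
      calc W / L = (W / L) ^ (1 : ℝ) := (Real.rpow_one _).symm
        _ ≤ (W / L) ^ (p / 2) := by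
          rcases hr0.eq_or_lt with h0 | h0
          · rw [← h0, Real.zero_rpow one_ne_zero]
            exact Real.rpow_nonneg le_rfl _
          · exact Real.rpow_le_rpow_of_exponent_ge h0 hr1 (by linarith)
        _ = _ := by rw [Real.div_rpow hw0 hm.le, Real.rpow_neg hm.le, div_eq_mul_inv]
    have h2 : W ^ (p / 2) * L ^ (-(p / 2)) ≤ t / 2 * W ^ p + 1 / (2 * t) * L ^ (-p) := by
      have e1 : W ^ p = (W ^ (p / 2)) ^ 2 := by
        rw [← Real.rpow_natCast, ← Real.rpow_mul hw0]; congr 1; push_cast; ring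
      have e2 : L ^ (-p) = (L ^ (-(p / 2))) ^ 2 := by
        rw [← Real.rpow_natCast, ← Real.rpow_mul hm.le]; congr 1; push_cast; ring
      rw [e1, e2]
      set u := W ^ (p / 2)
      set v := L ^ (-(p / 2))
      have : t / 2 * u ^ 2 + 1 / (2 * t) * v ^ 2 - u * v = (t * u - v) ^ 2 / (2 * t) := by
        field_simp; ring
      have : 0 ≤ (t * u - v) ^ 2 / (2 * t) := by positivity
      linarith
    have h3 := h1.trans h2
    rw [div_le_iff₀ hm] at h3
    calc e * W ≤ e * ((t / 2 * W ^ p + 1 / (2 * t) * L ^ (-p)) * L) := by gcongr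
      _ = _ := by ring
  simp only
  rw [numer_indicator ν ha hB, div_le_iff₀ hm]
  have hi1 : Integrable (fun x => lr 1 (a x) y * winMix a ν B (x, y)) ν := by
    refine ExpGrowth.integrable_section (N := noiseSize)
      (h := fun w : X × (K → ℝ) => lr 1 (a w.1) w.2 * winMix a ν B w) ?_ ν y
    exact (ha.expPos_lr 1).growth.mul (growth_winMix ν ha hB)
  have hsum : Integrable (fun x => t / 2 * (lr 1 (a x) y * winMix a ν B (x, y) ^ p) +
      1 / (2 * t) * mix 1 a ν y ^ (-p) * lr 1 (a x) y) ν :=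
    (hsec.const_mul _).add (hls.const_mul _)
  refine (integral_mono hi1 (hsum.const_mul _) hpt).trans ?_
  rw [integral_const_mul, integral_add (hsec.const_mul _) (hls.const_mul _), integral_const_mul,
    integral_const_mul, mul_comm]
  refine mul_le_mul_of_nonneg_right (add_le_add le_rfl ?_) hm.le
  have h4 : ∫ x, lr 1 (a x) y ∂ν = mix 1 a ν y := rfl
  rw [h4, mul_assoc]
  refine mul_le_mul_of_nonneg_left ?_ (by positivity)
  rw [← Real.rpow_add_one hm.ne']
  exact rpow_le_one_add hm.le (by linarith) (by linarith)

theorem growth_mix_finite {K : Type*} [Fintype K] {a : X → K → ℝ} (ha : IsField a A)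
    (μ : Measure X) [IsFiniteMeasure μ] : ExpGrowth noiseSize (mix 1 a μ) :=
  (ha.expPos_lr 1).growth.integral μ

theorem mix_nonneg {K : Type*} [Fintype K] (a : X → K → ℝ) (μ : Measure X) (y : K → ℝ) :
    0 ≤ mix 1 a μ y :=
  integral_nonneg fun _ => (lr_pos _ _ _).le

theorem integrable_mix_rpow {K : Type*} [Fintype K] {a : X → K → ℝ} (ha : IsField a A)
    (μ : Measure X) [IsFiniteMeasure μ] {p : ℝ} (hp : 0 ≤ p) (hp1 : p ≤ 1) :
    Integrable (fun y => mix 1 a μ y ^ p) (gaussPi K 1) :=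
  ((growth_mix_finite ha μ).rpow_of_nonneg (mix_nonneg a μ) hp hp1).integrable
    (expIntegrable_gaussPi 1)

/-- Kahane's comparison inequality for fractional moments, with Bochner integrals. -/
theorem integral_mix_rpow_le {c : X → K' → ℝ} {A' k p : ℝ} (hp : 0 < p)
    (hp1 : p < 1) (ha : IsField a A) (hc : IsField c A') (hk : 0 ≤ k)
    (hac : ∀ x x', gram c x x' ≤ gram a x x' + k) (μ : Measure X) [IsFiniteMeasure μ] :
    ∫ y, mix 1 a μ y ^ p ∂gaussPi K 1 ≤
      Real.exp (p * (1 - p) / 2 * k) * ∫ y, mix 1 c μ y ^ p ∂gaussPi K' 1 := by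
  have h := lintegral_rpow_le_of_gram_le hp hp1 (ha.mono (le_max_left A A'))
    (hc.mono (le_max_right A A')) hk hac μ
  have h1 := integrable_mix_rpow ha μ hp.le hp1.le
  have h2 := integrable_mix_rpow hc μ hp.le hp1.le
  have e1 := ofReal_integral_eq_lintegral_ofReal h1
    (ae_of_all _ fun y => Real.rpow_nonneg (mix_nonneg a μ y) p)
  have e2 := ofReal_integral_eq_lintegral_ofReal h2
    (ae_of_all _ fun y => Real.rpow_nonneg (mix_nonneg c μ y) p)
  simp only [mix] at e1 e2 ⊢
  rw [← e1, ← e2, ← ENNReal.ofReal_mul (Real.exp_pos _).le] at h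
  refine (ENNReal.ofReal_le_ofReal_iff ?_).1 h
  refine mul_nonneg (Real.exp_pos _).le (integral_nonneg fun y => Real.rpow_nonneg ?_ p)
  exact mix_nonneg c μ y

/-- The restricted partition function is dominated by a linearized one. -/
theorem integral_winMix_rpow_le (ha : IsField a A) (hB : MeasurableSet B) {p D : ℝ} (hp : 0 ≤ p)
    (hp1 : p ≤ 1) {h : X → ℝ} (hh : BddMeas h) (x : X)
    (hD : ∀ x', (x, x') ∈ B → gram a x' x ≤ D + h x') :
    ∫ y, lr 1 (a x) y * winMix a ν B (x, y) ^ p ∂gaussPi K 1 ≤ Real.exp (p * D) *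
      ∫ y, mix 1 a (ν.withDensity fun x' => ENNReal.ofReal (Real.exp (h x'))) y ^ p
        ∂gaussPi K 1 := by
  have hfin : IsFiniteMeasure (ν.withDensity fun x' => ENNReal.ofReal (Real.exp (h x'))) :=
    isFiniteMeasure_withDensity_ofReal (hh.exp.integrable ν).2
  have hw := (growth_winMix ν ha hB).1
  have hwx : Measurable fun y => winMix a ν B (x, y) ^ p :=
    (Measurable.comp (g := winMix a ν B) (f := fun y => (x, y)) hw
      measurable_prodMk_left).pow_const p
  rw [integral_lr_mul (a x) hwx, ← integral_const_mul]
  have hmu : ∀ y, mix 1 a (ν.withDensity fun x' => ENNReal.ofReal (Real.exp (h x'))) y =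
      ∫ x', Real.exp (h x') * lr 1 (a x') y ∂ν := by
    intro y
    rw [mix, integral_withDensity_eq_integral_toReal_smul
      (hh.exp.1.ennreal_ofReal) (ae_of_all _ fun _ => by simp)]
    simp only [ENNReal.toReal_ofReal (Real.exp_pos _).le, smul_eq_mul]
  have hpt : ∀ y, winMix a ν B (x, a x + y) ≤
      Real.exp D * mix 1 a (ν.withDensity fun x' => ENNReal.ofReal (Real.exp (h x'))) y := by
    intro y
    rw [hmu, ← integral_const_mul]
    refine integral_mono (integrable_winMix ν ha hB (x, a x + y)) (Integrable.const_mul ?_ _)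
      fun x' => ?_
    · refine ExpGrowth.integrable_section (N := noiseSize)
        (h := fun w : X × (K → ℝ) => Real.exp (h w.1) * lr 1 (a w.1) w.2) ?_ ν y
      exact (hh.exp.comp (φ := fun w : X × (K → ℝ) => w.1) measurable_fst).growth.mul
        (ha.expPos_lr 1).growth
    · by_cases hx : (x, x') ∈ B
      · simp only [Set.indicator_of_mem hx, one_mul]
        rw [lr_shift, ← mul_assoc, ← Real.exp_add]
        refine mul_le_mul_of_nonneg_right ?_ (lr_pos _ _ _).le
        exact Real.exp_le_exp.2 (hD x' hx)
      · simp only [Set.indicator_of_notMem hx, zero_mul]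
        have := lr_pos 1 (a x') y
        positivity
  have hi := integrable_mix_rpow ha (ν.withDensity fun x' => ENNReal.ofReal (Real.exp (h x'))) hp hp1
  refine integral_mono_of_nonneg (ae_of_all _ fun y => Real.rpow_nonneg (winMix_nonneg ν _) p)
    (hi.const_mul _) (ae_of_all _ fun y => ?_)
  simp only
  calc winMix a ν B (x, a x + y) ^ p ≤ (Real.exp D *
        mix 1 a (ν.withDensity fun x' => ENNReal.ofReal (Real.exp (h x'))) y) ^ p :=
        Real.rpow_le_rpow (winMix_nonneg ν _) (hpt y) hp
    _ = _ := by
      rw [Real.mul_rpow (Real.exp_pos _).le (mix_nonneg _ _ _), ← Real.exp_mul, mul_comm p D]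

/-- The information as an average over the signal and the noise. -/
theorem info_eq (ha : IsField a A) :
    info a ν = ∫ x, ∫ y, Real.log (mix 1 a ν (a x + y)) ∂gaussPi K 1 ∂ν := by
  have hm := expPos_mix ν ha 1
  have hg : ExpGrowth (fun w : X × (K → ℝ) => noiseSize w.2)
      (fun w => lr 1 (a w.1) w.2 * Real.log (mix 1 a ν w.2)) :=
    (ha.expPos_lr 1).growth.mul (hm.log.comp measurable_snd fun _ => le_rfl)
  simp only [← integral_lr_mul (a _) hm.log.1]
  rw [integral_integral_swap (f := fun x y => lr 1 (a x) y * Real.log (mix 1 a ν y))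
    (hg.integrable ((expIntegrable_gaussPi 1).prod_snd ν))]
  simp only [integral_mul_const]
  rfl

/-- Misaligned signals give a smaller free energy. -/
theorem reflected_le_info (ha : IsField a A) :
    ∫ x, ∫ y, Real.log (mix 1 a ν (-a x + y)) ∂gaussPi K 1 ∂ν ≤ info a ν := by
  have hm := expPos_mix ν ha 1
  have hmn : ExpPos noiseSize fun y => mix 1 a ν (-y) :=
    hm.comp measurable_neg fun y => by simp [noiseSize]
  have hg : ExpGrowth (fun w : X × (K → ℝ) => noiseSize w.2)
      (fun w => lr 1 (a w.1) w.2 * Real.log (mix 1 a ν (-w.2))) :=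
    (ha.expPos_lr 1).growth.mul (hmn.log.comp measurable_snd fun _ => le_rfl)
  have h1 : ∀ x, ∫ y, Real.log (mix 1 a ν (-a x + y)) ∂gaussPi K 1 =
      ∫ y, lr 1 (a x) y * Real.log (mix 1 a ν (-y)) ∂gaussPi K 1 := fun x => by
    rw [integral_lr_mul (a x) hmn.log.1]
    have hneg := measurePreserving_gaussPi_neg (K := K) 1
    have hmeas : Measurable fun y => Real.log (mix 1 a ν (-a x + y)) :=
      Measurable.comp (g := fun y => Real.log (mix 1 a ν y)) (f := fun y => -a x + y) hm.log.1
        (by fun_prop)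
    rw [← hneg.map_eq, integral_map hneg.measurable.aemeasurable hmeas.aestronglyMeasurable,
      hneg.map_eq]
    simp only [neg_add]
  simp only [h1]
  rw [integral_integral_swap (f := fun x y => lr 1 (a x) y * Real.log (mix 1 a ν (-y)))
    (hg.integrable ((expIntegrable_gaussPi 1).prod_snd ν))]
  simp only [integral_mul_const]
  have hE := expIntegrable_gaussPi (K := K) 1
  have e1 : ∫ y, mix 1 a ν (-y) ∂gaussPi K 1 = 1 := by
    have hneg := measurePreserving_gaussPi_neg (K := K) 1
    rw [← integral_mix ν ha 1]
    conv_rhs => rw [← hneg.map_eq, integral_map hneg.measurable.aemeasurable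
      hm.growth.1.aestronglyMeasurable]
  have hd : ∫ y, (mix 1 a ν y * Real.log (mix 1 a ν (-y)) -
      mix 1 a ν y * Real.log (mix 1 a ν y)) ∂gaussPi K 1 ≤
      ∫ y, (mix 1 a ν (-y) - mix 1 a ν y) ∂gaussPi K 1 := by
    refine integral_mono (((hm.growth.mul hmn.log).integrable hE).sub
      ((hm.growth.mul hm.log).integrable hE))
      ((hmn.growth.integrable hE).sub (hm.growth.integrable hE)) fun y => ?_
    have p1 := hm.pos y
    have p2 := hmn.pos y
    have := Real.log_le_sub_one_of_pos (div_pos p2 p1)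
    rw [Real.log_div p2.ne' p1.ne'] at this
    simp only
    rw [← mul_sub]
    calc _ ≤ mix 1 a ν y * (mix 1 a ν (-y) / mix 1 a ν y - 1) := by gcongr
      _ = _ := by field_simp
  rw [integral_sub ((hm.growth.mul hmn.log).integrable hE) ((hm.growth.mul hm.log).integrable hE),
    integral_sub (hmn.growth.integrable hE) (hm.growth.integrable hE), e1,
    integral_mix ν ha 1, sub_self, sub_nonpos] at hd
  exact hd

end Window
end SpikedWigner



namespace SpikedWigner
open scoped NNReal ENNReal

section Site
variable {Ω : Type*} [MeasurableSpace Ω] {P : Measure Ω} {ξ : Ω → ℝ} {M β r : ℝ} {n : ℕ}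

/-- The scalar channel of signal-to-noise ratio `r`. -/
noncomputable def scalarField (r : ℝ) (ξ : Ω → ℝ) (ω : Ω) (_ : Unit) : ℝ := √r * ξ ω

/-- The partition function of the scalar channel. -/
noncomputable def siteMix (P : Measure Ω) (ξ : Ω → ℝ) (r u : ℝ) : ℝ :=
  ∫ ω, Real.exp (√r * ξ ω * u - r / 2 * ξ ω ^ 2) ∂P

theorem IsSpin.isField_scalarField (hξ : IsSpin P ξ M) (hr : 0 ≤ r) :
    IsField (scalarField r ξ) (r * M ^ 2) where
  meas := by
    have := hξ.meas
    unfold scalarField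
    fun_prop
  nonneg := by positivity
  sq_le ω := by
    simp only [scalarField, Finset.univ_unique, Finset.sum_singleton, mul_pow, Real.sq_sqrt hr]
    exact mul_le_mul_of_nonneg_left (hξ.sq_le ω) hr

theorem mix_scalarField (hr : 0 ≤ r) (y : Unit → ℝ) :
    mix 1 (scalarField r ξ) P y = siteMix P ξ r (y ()) := by
  simp only [mix, siteMix, lr, scalarField, Finset.univ_unique, Finset.sum_singleton, mul_pow,
    Real.sq_sqrt hr, NNReal.coe_one]
  refine integral_congr_ae (ae_of_all _ fun ω => ?_)
  simp only
  congr 1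
  simp only [PUnit.default_eq_unit]
  ring

theorem integral_gaussPi_unit {F : ℝ → ℝ} (hF : Measurable F) :
    ∫ y : Unit → ℝ, F (y ()) ∂gaussPi Unit 1 = ∫ z, F z ∂gaussianReal 0 1 := by
  have h := measurePreserving_eval (fun _ : Unit => gaussianReal 0 1) ()
  have := integral_map (μ := gaussPi Unit 1) (φ := Function.eval ()) (f := F)
    h.measurable.aemeasurable hF.aestronglyMeasurable
  rw [← this]
  congr 1
  exact h.map_eq

theorem expIntegrable_gaussianReal : ExpIntegrable (fun z : ℝ => z) (gaussianReal 0 1) := by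
  intro C
  have h := measurePreserving_eval (fun _ : Unit => gaussianReal 0 1) ()
  have h2 := expIntegrable_gaussPi (K := Unit) 1 C
  rw [← h.integrable_comp (by fun_prop)]
  refine h2.congr (ae_of_all _ fun y => ?_)
  simp [noiseSize]

variable [IsProbabilityMeasure P]

theorem measurable_siteMix (hξ : IsSpin P ξ M) : Measurable (siteMix P ξ r) := by
  have := hξ.meas
  refine StronglyMeasurable.measurable (StronglyMeasurable.integral_prod_right'
    (f := fun w : ℝ × Ω => Real.exp (√r * ξ w.2 * w.1 - r / 2 * ξ w.2 ^ 2)) ?_)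
  refine Measurable.stronglyMeasurable ?_
  fun_prop

theorem integrable_siteMix (hξ : IsSpin P ξ M) (u : ℝ) :
    Integrable (fun ω => Real.exp (√r * ξ ω * u - r / 2 * ξ ω ^ 2)) P := by
  have h : BddMeas ξ := ⟨hξ.meas, M, hξ.bound⟩
  simp only [sub_eq_add_neg, ← neg_mul]
  exact ((((BddMeas.const _).mul h).mul (BddMeas.const u)).add
    ((BddMeas.const _).mul (h.pow 2))).exp.integrable P

theorem abs_site_exponent_le (hξ : IsSpin P ξ M) (hr : 0 ≤ r) (u : ℝ) (ω : Ω) :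
    |√r * ξ ω * u - r / 2 * ξ ω ^ 2| ≤ √r * M * |u| + r / 2 * M ^ 2 := by
  refine (abs_sub _ _).trans (add_le_add ?_ ?_)
  · rw [abs_mul, abs_mul, abs_of_nonneg (Real.sqrt_nonneg _)]
    gcongr
    exact hξ.bound ω
  · rw [abs_of_nonneg (by positivity)]
    exact mul_le_mul_of_nonneg_left (hξ.sq_le ω) (by positivity)

theorem siteMix_mem (hξ : IsSpin P ξ M) (hr : 0 ≤ r) (u : ℝ) :
    Real.exp (-(√r * M * |u| + r / 2 * M ^ 2)) ≤ siteMix P ξ r u ∧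
      siteMix P ξ r u ≤ Real.exp (√r * M * |u| + r / 2 * M ^ 2) := by
  have h := fun ω => abs_le.1 (abs_site_exponent_le hξ hr u ω)
  constructor
  · have := integral_mono (integrable_const (μ := P) _) (integrable_siteMix (r := r) hξ u)
      fun ω => Real.exp_le_exp.2 (h ω).1
    simpa [siteMix] using this
  · have := integral_mono (integrable_siteMix (r := r) hξ u) (integrable_const (μ := P) _)
      fun ω => Real.exp_le_exp.2 (h ω).2
    simpa [siteMix] using this

theorem siteMix_pos (hξ : IsSpin P ξ M) (hr : 0 ≤ r) (u : ℝ) : 0 < siteMix P ξ r u :=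
  (Real.exp_pos _).trans_le (siteMix_mem hξ hr u).1

theorem abs_log_siteMix_le (hξ : IsSpin P ξ M) (hr : 0 ≤ r) (u : ℝ) :
    |Real.log (siteMix P ξ r u)| ≤ √r * M * |u| + r / 2 * M ^ 2 := by
  have h := siteMix_mem hξ hr u
  have hp := siteMix_pos hξ hr u
  rw [abs_le]
  exact ⟨(Real.le_log_iff_exp_le hp).2 h.1, (Real.log_le_iff_le_exp hp).2 h.2⟩

theorem abs_log_siteMix_shift_le (hξ : IsSpin P ξ M) (hr : 0 ≤ r) {R s : ℝ} (hR : r ≤ R)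
    (hs : |s| = 1) (ω : Ω) (z : ℝ) :
    |Real.log (siteMix P ξ r (s * (√r * ξ ω) + z))| ≤ √R * M * |z| + 3 / 2 * R * M ^ 2 := by
  have hM := hξ.nonneg
  have h1 : |s * (√r * ξ ω) + z| ≤ √r * M + |z| := by
    refine (abs_add_le _ _).trans (add_le_add ?_ le_rfl)
    rw [abs_mul, hs, one_mul, abs_mul, abs_of_nonneg (Real.sqrt_nonneg _)]
    gcongr
    exact hξ.bound ω
  calc _ ≤ √r * M * (√r * M + |z|) + r / 2 * M ^ 2 :=
        (abs_log_siteMix_le hξ hr _).trans (by gcongr)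
    _ = √r * M * |z| + (√r * √r * M ^ 2 + r / 2 * M ^ 2) := by ring
    _ = √r * M * |z| + 3 / 2 * r * M ^ 2 := by rw [Real.mul_self_sqrt hr]; ring
    _ ≤ _ := by gcongr

theorem expPos_siteMix_shift (hξ : IsSpin P ξ M) (hr : 0 ≤ r) {s : ℝ} (hs : |s| = 1) :
    ExpPos (fun w : Ω × ℝ => w.2) (fun w => siteMix P ξ r (s * (√r * ξ w.1) + w.2)) := by
  have hM := hξ.nonneg
  have hξm := hξ.meas
  have hm : Measurable fun w : Ω × ℝ => siteMix P ξ r (s * (√r * ξ w.1) + w.2) :=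
    Measurable.comp (g := siteMix P ξ r) (f := fun w : Ω × ℝ => s * (√r * ξ w.1) + w.2)
      (measurable_siteMix hξ) (by fun_prop)
  have := ExpGrowth.exp_of_linear (N := fun w : Ω × ℝ => w.2) hm.log
    (√r * M + 3 / 2 * r * M ^ 2) fun w => by
    refine (abs_log_siteMix_shift_le hξ hr le_rfl hs w.1 w.2).trans ?_
    have h1 := abs_nonneg w.2
    have h2 : 0 ≤ √r * M := by positivity
    have h3 : 0 ≤ 3 / 2 * r * M ^ 2 * |w.2| := by positivity
    nlinarith
  simpa only [Real.exp_log (siteMix_pos hξ hr _)] using this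

theorem integral_log_siteMix_le (hξ : IsSpin P ξ M) (hr : 0 ≤ r) {s : ℝ} (hs : |s| = 1) :
    ∫ ω, ∫ z, Real.log (siteMix P ξ r (s * (√r * ξ ω) + z)) ∂gaussianReal 0 1 ∂P ≤
      info (scalarField r ξ) P := by
  have ha := hξ.isField_scalarField hr
  have hm : ∀ c : ℝ, Measurable fun z => Real.log (siteMix P ξ r (c + z)) := fun c =>
    (Measurable.comp (g := siteMix P ξ r) (f := fun z => c + z) (measurable_siteMix hξ)
      (by fun_prop)).log
  rcases (abs_eq zero_le_one).1 hs with rfl | rfl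
  · rw [info_eq P ha]
    simp only [mix_scalarField hr, Pi.add_apply, scalarField, one_mul]
    refine le_of_eq (integral_congr_ae (ae_of_all _ fun ω => ?_))
    exact (integral_gaussPi_unit (hm _)).symm
  · refine le_trans (le_of_eq ?_) (reflected_le_info P ha)
    simp only [mix_scalarField hr, Pi.add_apply, Pi.neg_apply, scalarField, neg_one_mul]
    refine integral_congr_ae (ae_of_all _ fun ω => ?_)
    exact (integral_gaussPi_unit (hm _)).symm

theorem info_scalarField (hξ : IsSpin P ξ M) (hr : 0 ≤ r) :
    info (scalarField r ξ) P =
      ∫ w, Real.log (siteMix P ξ r (√r * ξ w.1 + w.2)) ∂(P.prod (gaussianReal 0 1)) := by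
  have ha := hξ.isField_scalarField hr
  have hm : ∀ c : ℝ, Measurable fun z => Real.log (siteMix P ξ r (c + z)) := fun c =>
    (Measurable.comp (g := siteMix P ξ r) (f := fun z => c + z) (measurable_siteMix hξ)
      (by fun_prop)).log
  have hi : Integrable (fun w : Ω × ℝ => Real.log (siteMix P ξ r (√r * ξ w.1 + w.2)))
      (P.prod (gaussianReal 0 1)) := by
    have := (expPos_siteMix_shift hξ hr (s := 1) (by simp)).log.integrable
      (expIntegrable_gaussianReal.prod_snd P)
    simpa only [one_mul] using this
  rw [info_eq P ha, integral_prod _ hi]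
  simp only [mix_scalarField hr, Pi.add_apply, scalarField]
  refine integral_congr_ae (ae_of_all _ fun ω => ?_)
  exact integral_gaussPi_unit (hm _)

theorem IsSpin.exists_integral_siteMix_rpow_le (hξ : IsSpin P ξ M) (R : ℝ) :
    ∃ C : ℝ, 0 ≤ C ∧ ∀ r s p : ℝ, 0 ≤ r → r ≤ R → |s| = 1 → 0 ≤ p → p ≤ 1 →
      ∫ ω, ∫ z, siteMix P ξ r (s * (√r * ξ ω) + z) ^ p ∂gaussianReal 0 1 ∂P ≤
        Real.exp (p * info (scalarField r ξ) P + C * p ^ 2) := by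
  set h : ℝ → ℝ := fun z => √R * M * |z| + 3 / 2 * R * M ^ 2 with hh
  refine ⟨∫ z, 2 * Real.exp (2 * h z) ∂gaussianReal 0 1,
    integral_nonneg fun z => by positivity, fun r s p hr hrR hs hp hp1 => ?_⟩
  have hR : 0 ≤ R := hr.trans hrR
  have hM := hξ.nonneg
  have hE := expIntegrable_gaussianReal.prod_snd P
  have hpos := expPos_siteMix_shift hξ hr hs
  have hi1 := (hpos.rpow p).growth.integrable hE
  have hi2 := hpos.log.integrable hE
  have hh0 : ∀ z, 0 ≤ h z := fun z => by simp only [hh]; positivity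
  have hi3 : Integrable (fun z => 2 * Real.exp (2 * h z)) (gaussianReal 0 1) := by
    refine Integrable.const_mul ?_ 2
    have hm : Measurable fun z => 2 * h z := by simp only [hh]; fun_prop
    refine (ExpGrowth.exp_of_linear (N := fun z : ℝ => z) hm (2 * (√R * M + 3 / 2 * R * M ^ 2))
      fun z => ?_).growth.integrable expIntegrable_gaussianReal
    rw [abs_of_nonneg (by have := hh0 z; positivity)]
    simp only [hh]
    have h1 := abs_nonneg z
    have h2 : 0 ≤ √R * M := by positivity
    have h3 : 0 ≤ 3 / 2 * R * M ^ 2 * |z| := by positivity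
    nlinarith
  have hi4 : Integrable (fun w : Ω × ℝ => p ^ 2 * (2 * Real.exp (2 * h w.2)))
      (P.prod (gaussianReal 0 1)) := (hi3.comp_snd P).const_mul _
  have hi5 : Integrable (fun w : Ω × ℝ => 1 + p * Real.log (siteMix P ξ r (s * (√r * ξ w.1) + w.2)))
      (P.prod (gaussianReal 0 1)) := (integrable_const _).add (hi2.const_mul p)
  have hpt : ∀ w : Ω × ℝ, siteMix P ξ r (s * (√r * ξ w.1) + w.2) ^ p ≤
      1 + p * Real.log (siteMix P ξ r (s * (√r * ξ w.1) + w.2)) +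
        p ^ 2 * (2 * Real.exp (2 * h w.2)) := by
    intro w
    have hY := abs_log_siteMix_shift_le hξ hr hrR hs w.1 w.2
    rw [Real.rpow_def_of_pos (siteMix_pos hξ hr _)]
    set Y := Real.log (siteMix P ξ r (s * (√r * ξ w.1) + w.2)) with hYdef
    have hY' : |Y| ≤ h w.2 := hY
    have h1 := (le_abs_self _).trans (abs_exp_sub_one_sub_le (Y * p))
    have h2 : |Y * p| ≤ p * h w.2 := by
      rw [abs_mul, abs_of_nonneg hp, mul_comm]
      gcongr
    have h3 : |Y * p| ≤ h w.2 := h2.trans (mul_le_of_le_one_left (hh0 _) hp1)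
    have h4 : h w.2 ^ 2 ≤ 2 * Real.exp (h w.2) := by
      have := Real.pow_div_factorial_le_exp (h w.2) (hh0 _) 2
      rw [div_le_iff₀ (by positivity)] at this
      norm_num at this
      linarith
    have h5 : |Y * p| ^ 2 * Real.exp |Y * p| ≤ p ^ 2 * (2 * Real.exp (2 * h w.2)) := by
      calc |Y * p| ^ 2 * Real.exp |Y * p| ≤ (p * h w.2) ^ 2 * Real.exp (h w.2) := by gcongr
        _ = p ^ 2 * (h w.2 ^ 2 * Real.exp (h w.2)) := by ring
        _ ≤ p ^ 2 * (2 * Real.exp (h w.2) * Real.exp (h w.2)) := by gcongr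
        _ = _ := by rw [mul_assoc 2, ← Real.exp_add]; ring_nf
    linarith
  rw [← integral_prod _ hi1]
  have hlog := integral_log_siteMix_le hξ hr hs
  rw [← integral_prod _ hi2] at hlog
  calc _ ≤ ∫ w : Ω × ℝ, (1 + p * Real.log (siteMix P ξ r (s * (√r * ξ w.1) + w.2)) +
        p ^ 2 * (2 * Real.exp (2 * h w.2))) ∂(P.prod (gaussianReal 0 1)) :=
        integral_mono hi1 (hi5.add hi4) hpt
    _ = 1 + p * ∫ w : Ω × ℝ, Real.log (siteMix P ξ r (s * (√r * ξ w.1) + w.2))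
          ∂(P.prod (gaussianReal 0 1)) + p ^ 2 * ∫ z, 2 * Real.exp (2 * h z) ∂gaussianReal 0 1 := by
        rw [integral_add hi5 hi4, integral_add (integrable_const _) (hi2.const_mul p),
          integral_const_mul, integral_const_mul]
        rw [integral_fun_snd (fun z => 2 * Real.exp (2 * h z))]
        simp
    _ ≤ p * info (scalarField r ξ) P + (∫ z, 2 * Real.exp (2 * h z) ∂gaussianReal 0 1) * p ^ 2 + 1 := by
        have := mul_le_mul_of_nonneg_left hlog hp
        linarith
    _ ≤ _ := Real.add_one_le_exp _

/-- Factorization of the linearized partition function. -/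
theorem mix_spinField_withDensity (hξ : IsSpin P ξ M) (hr : 0 ≤ r) (s : ℝ) (x : Fin n → Ω)
    (y : Fin n → ℝ) :
    mix 1 (spinField r ξ n) ((prior P n).withDensity fun x' =>
      ENNReal.ofReal (Real.exp (s * r * overlap ξ n (x, x')))) y =
      ∏ i, siteMix P ξ r (s * (√r * ξ (x i)) + y i) := by
  have hm : Measurable fun x' : Fin n → Ω => Real.exp (s * r * overlap ξ n (x, x')) := by
    have := hξ.meas
    unfold overlap
    fun_prop
  rw [mix, integral_withDensity_eq_integral_toReal_smul hm.ennreal_ofReal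
    (ae_of_all _ fun _ => by simp)]
  simp only [siteMix]
  unfold prior
  rw [← integral_fintype_prod_eq_prod fun (i : Fin n) (ω : Ω) =>
    Real.exp (√r * ξ ω * (s * (√r * ξ (x i)) + y i) - r / 2 * ξ ω ^ 2)]
  refine integral_congr_ae (ae_of_all _ fun x' => ?_)
  simp only [ENNReal.toReal_ofReal (Real.exp_pos _).le, smul_eq_mul, lr, spinField, overlap,
    mul_pow, Real.sq_sqrt hr, NNReal.coe_one]
  rw [← Real.exp_add, ← Real.exp_sum]
  congr 1
  rw [Finset.mul_sum, Finset.mul_sum, ← Finset.sum_sub_distrib, ← Finset.sum_add_distrib]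
  refine Finset.sum_congr rfl fun i _ => ?_
  calc _ = s * (√r * √r) * (ξ (x i) * ξ (x' i)) + (√r * ξ (x' i) * y i -
        1 / 2 * (r * ξ (x' i) ^ 2)) := by rw [Real.mul_self_sqrt hr]
    _ = _ := by ring

theorem integral_prod_siteMix_rpow (hξ : IsSpin P ξ M) (hr : 0 ≤ r) (s p : ℝ) (n : ℕ) :
    ∫ x, ∫ y, (∏ i, siteMix P ξ r (s * (√r * ξ (x i)) + y i)) ^ p ∂gaussPi (Fin n) 1
      ∂(prior P n) =
      (∫ ω, ∫ z, siteMix P ξ r (s * (√r * ξ ω) + z) ^ p ∂gaussianReal 0 1 ∂P) ^ n := by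
  simp only [← Real.finsetProd_rpow _ _ fun i _ => (siteMix_pos hξ hr _).le]
  have h1 : ∀ x : Fin n → Ω, ∫ y : Fin n → ℝ,
      ∏ i, siteMix P ξ r (s * (√r * ξ (x i)) + y i) ^ p ∂gaussPi (Fin n) 1 =
      ∏ i, ∫ z, siteMix P ξ r (s * (√r * ξ (x i)) + z) ^ p ∂gaussianReal 0 1 := fun x =>
    integral_fintype_prod_eq_prod fun (i : Fin n) z => siteMix P ξ r (s * (√r * ξ (x i)) + z) ^ p
  simp only [h1]
  unfold prior
  rw [integral_fintype_prod_eq_prod fun (_ : Fin n) ω =>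
    ∫ z, siteMix P ξ r (s * (√r * ξ ω) + z) ^ p ∂gaussianReal 0 1]
  simp

end Site
end SpikedWigner



namespace SpikedWigner
open scoped NNReal ENNReal

section Tail
variable {Ω : Type*} [MeasurableSpace Ω] {P : Measure Ω} {ξ : Ω → ℝ} {M β : ℝ} {n : ℕ}

theorem overlap_comm (x x' : Fin n → Ω) : overlap ξ n (x, x') = overlap ξ n (x', x) := by
  simp only [overlap, mul_comm]

variable [IsProbabilityMeasure P]

/-- The configurations whose overlap lies in a window of half-width `n η` around `n m`. -/
def window (ξ : Ω → ℝ) (n : ℕ) (m η : ℝ) : Set ((Fin n → Ω) × (Fin n → Ω)) :=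
  {p | |overlap ξ n p - n * m| ≤ n * η}

theorem IsSpin.measurableSet_window (hξ : IsSpin P ξ M) (m η : ℝ) :
    MeasurableSet (window ξ n m η) :=
  measurableSet_le ((hξ.bddMeas_overlap.1.sub measurable_const).abs) measurable_const

theorem IsSpin.integral_window_le (hξ : IsSpin P ξ M) (hn : 1 ≤ n) (hβ : 0 < β) {q s η p : ℝ}
    (hq : 0 ≤ q) (hs : |s| = 1) (hp : 0 < p) (hp1 : p < 1) :
    ∫ x, ∫ y, lr 1 (pairField β ξ n x) y *
        winMix (pairField β ξ n) (prior P n) (window ξ n (s * q) η) (x, y) ^ p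
        ∂gaussPi (Pairs n) 1 ∂(prior P n) ≤
      Real.exp (p * (β / 2 * (n ^ 2 * η ^ 2 - n ^ 2 * q ^ 2)) +
        p * (1 - p) / 2 * (β / 2 * (n ^ 2 * q ^ 2 + n * M ^ 4))) *
      (∫ ω, ∫ z, siteMix P ξ (n * β * q) (s * (√(n * β * q) * ξ ω) + z) ^ p
        ∂gaussianReal 0 1 ∂P) ^ n := by
  have hn0 : (0 : ℝ) < n := by exact_mod_cast hn
  set r := n * β * q with hr
  have hr0 : 0 ≤ r := by positivity
  set D := β / 2 * (n ^ 2 * η ^ 2 - n ^ 2 * q ^ 2) with hD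
  set k := β / 2 * (n ^ 2 * q ^ 2 + n * M ^ 4) with hk
  have hk0 : 0 ≤ k := by positivity
  have ha := hξ.isField_pairField β n
  have hc := hξ.isField_spinField hr0 n
  have hs2 : s ^ 2 = 1 := by rw [← sq_abs, hs, one_pow]
  have hB := hξ.measurableSet_window (n := n) (s * q) η
  have hT : ∀ x : Fin n → Ω, BddMeas fun x' => s * r * overlap ξ n (x, x') := fun x =>
    (BddMeas.const _).mul (hξ.bddMeas_overlap.comp (φ := fun x' => (x, x')) measurable_prodMk_left)
  have hpt : ∀ x, ∫ y, lr 1 (pairField β ξ n x) y *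
        winMix (pairField β ξ n) (prior P n) (window ξ n (s * q) η) (x, y) ^ p
        ∂gaussPi (Pairs n) 1 ≤ Real.exp (p * D + p * (1 - p) / 2 * k) *
        ∫ y, (∏ i, siteMix P ξ r (s * (√r * ξ (x i)) + y i)) ^ p ∂gaussPi (Fin n) 1 := by
    intro x
    have hfin : IsFiniteMeasure ((prior P n).withDensity fun x' =>
        ENNReal.ofReal (Real.exp (s * r * overlap ξ n (x, x')))) :=
      isFiniteMeasure_withDensity_ofReal ((hT x).exp.integrable _).2
    have h1 := integral_winMix_rpow_le (prior P n) ha hB hp.le hp1.le (D := D) (hT x) x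
      fun x' hx' => by
        refine (gram_pairField_le hβ.le (x', x)).trans ?_
        have h2 : |overlap ξ n (x, x') - n * (s * q)| ≤ n * η := hx'
        have h3 : (overlap ξ n (x, x') - n * (s * q)) ^ 2 ≤ (n * η) ^ 2 := by
          rw [← sq_abs]
          exact pow_le_pow_left₀ (abs_nonneg _) h2 2
        rw [overlap_comm x' x, hD, hr]
        calc β / 2 * overlap ξ n (x, x') ^ 2 = β / 2 * ((overlap ξ n (x, x') - n * (s * q)) ^ 2 +
              2 * overlap ξ n (x, x') * (n * (s * q)) - n ^ 2 * (s ^ 2 * q ^ 2)) := by ring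
          _ ≤ β / 2 * ((n * η) ^ 2 +
              2 * overlap ξ n (x, x') * (n * (s * q)) - n ^ 2 * (s ^ 2 * q ^ 2)) := by gcongr
          _ = _ := by rw [hs2]; ring
    have h4 := integral_mix_rpow_le hp hp1 ha hc hk0 (fun x x' => by
        rw [gram_spinField hr0]
        have h5 := hξ.le_gram_pairField hβ.le (x, x')
        simp only at h5
        have h6 : β / 2 * (2 * (n * q) * overlap ξ n (x, x')) ≤
            β / 2 * (overlap ξ n (x, x') ^ 2 + (n * q) ^ 2) := by
          gcongr
          nlinarith [sq_nonneg (overlap ξ n (x, x') - n * q)]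
        rw [hk, hr]
        linarith) ((prior P n).withDensity fun x' =>
        ENNReal.ofReal (Real.exp (s * r * overlap ξ n (x, x'))))
    refine h1.trans ((mul_le_mul_of_nonneg_left h4 (Real.exp_pos _).le).trans (le_of_eq ?_))
    rw [← mul_assoc, ← Real.exp_add]
    simp only [mix_spinField_withDensity hξ hr0]
  rw [← integral_prod_siteMix_rpow hξ hr0, ← integral_const_mul]
  have hg := growth_lr_mul_winMix_rpow (prior P n) ha hB hp.le hp1.le
  refine integral_mono_of_nonneg (ae_of_all _ fun x => integral_nonneg fun y => ?_)
    (Integrable.const_mul ?_ _) (ae_of_all _ hpt)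
  · exact mul_nonneg (lr_pos _ _ _).le (Real.rpow_nonneg (winMix_nonneg _ _) _)
  · have hG : ExpGrowth (fun w : (Fin n → Ω) × (Fin n → ℝ) => noiseSize w.2)
        (fun w => (∏ i, siteMix P ξ r (s * (√r * ξ (w.1 i)) + w.2 i)) ^ p) := by
      simp only [← Real.finsetProd_rpow _ _ fun i _ => (siteMix_pos hξ hr0 _).le]
      refine ExpGrowth.prod _ fun i _ => ?_
      refine ((expPos_siteMix_shift hξ hr0 hs).rpow p).growth.comp
        (φ := fun w : (Fin n → Ω) × (Fin n → ℝ) => (w.1 i, w.2 i)) (by fun_prop) fun w => ?_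
      rw [abs_of_nonneg (show 0 ≤ noiseSize w.2 by unfold noiseSize; positivity)]
      exact Finset.single_le_sum (f := fun k => |w.2 k|) (fun _ _ => abs_nonneg _)
        (Finset.mem_univ i)
    exact (hG.integrable ((expIntegrable_gaussPi 1).prod_snd (prior P n))).integral_prod_left

/-- Windows away from zero have exponentially small weight. -/
theorem IsSpin.exists_avg_window_le (hξ : IsSpin P ξ M) {l l₀ ls ε : ℝ}
    (hψ : ∀ r : ℝ, 0 ≤ r → info (scalarField r ξ) P ≤ r ^ 2 / (4 * l₀)) (hl : l < l₀)
    (hl0 : 0 < l) (hl1 : l ≤ 1) (hls : 0 < ls) (hε : 0 < ε) (Q : ℝ) :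
    ∃ η α C : ℝ, 0 < η ∧ η ≤ ε / 2 ∧ 0 < α ∧ 0 ≤ C ∧ ∀ n : ℕ, 1 ≤ n → ∀ β : ℝ, 0 < β → n * β ≤ l →
      ls ≤ n * β → ∀ m : ℝ, ε / 2 ≤ |m| → |m| ≤ Q →
        avg P ξ β n ((window ξ n m η).indicator fun _ => 1) ≤ C * Real.exp (-(α * n)) := by
  have hM := hξ.nonneg
  have hl00 : 0 < l₀ := hl0.trans hl
  obtain ⟨C₀, hC₀, hsite⟩ := hξ.exists_integral_siteMix_rpow_le (max Q 0)
  have hfrac : 0 < 1 - l / l₀ := by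
    rw [sub_pos, div_lt_one hl00]; exact hl
  set κ := ls * (ε / 2) ^ 2 / 4 * (1 - l / l₀) with hκ
  have hκ0 : 0 < κ := by positivity
  set η := min (ε / 2) (√(κ / 2)) with hη
  have hη0 : 0 < η := by positivity
  have hη2 : η ^ 2 ≤ κ / 2 := by
    calc η ^ 2 ≤ √(κ / 2) ^ 2 := pow_le_pow_left₀ hη0.le (min_le_right _ _) 2
      _ = _ := Real.sq_sqrt (by positivity)
  set p := min (1 / 2) (κ / (4 * (C₀ + 1))) with hp
  have hp0 : 0 < p := by positivity
  have hp1 : p < 1 := (min_le_left _ _).trans_lt (by norm_num)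
  have hpC : C₀ * p ≤ κ / 4 := by
    have : p ≤ κ / (4 * (C₀ + 1)) := min_le_right _ _
    rw [le_div_iff₀ (by positivity)] at this
    nlinarith
  refine ⟨η, p * κ / 4, Real.exp (M ^ 4) / 2 + 1, hη0, min_le_left _ _, by positivity, by positivity,
    fun n hn β hβ hnβ hlsβ m hm hmQ => ?_⟩
  have hn0 : (0 : ℝ) < n := by exact_mod_cast hn
  obtain ⟨s, hs, hsm⟩ : ∃ s : ℝ, |s| = 1 ∧ s * |m| = m := by
    rcases le_total 0 m with h | h
    · exact ⟨1, by simp, by rw [abs_of_nonneg h, one_mul]⟩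
    · exact ⟨-1, by simp, by rw [abs_of_nonpos h]; ring⟩
  set q := |m| with hq
  have hq0 : 0 ≤ q := abs_nonneg _
  set b := n * β with hb
  have hb0 : 0 < b := by positivity
  have hb1 : b ≤ 1 := hnβ.trans hl1
  have hwin := hξ.integral_window_le (η := η) hn hβ hq0 hs hp0 hp1
  rw [hsm, ← hb] at hwin
  have hr0 : 0 ≤ b * q := by positivity
  have hst := hsite (b * q) s p hr0 ((mul_le_of_le_one_left hq0 hb1).trans (hmQ.trans
    (le_max_left _ _))) hs hp0.le hp1.le
  have hinfo := hψ (b * q) hr0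
  have hgi := gibbs_indicator_le (prior P n) (hξ.isField_pairField β n)
    (hξ.measurableSet_window (n := n) m η) hp0.le hp1.le (t := Real.exp (p * κ / 4 * n))
    (Real.exp_pos _)
  have hkey : -(b * q ^ 2 / 4) + (b * q) ^ 2 / (4 * l₀) ≤ -κ := by
    have h1 : (b * q) ^ 2 / (4 * l₀) ≤ b * q ^ 2 / 4 * (l / l₀) := by
      calc (b * q) ^ 2 / (4 * l₀) = b * q ^ 2 / 4 * (b / l₀) := by field_simp
        _ ≤ _ := by gcongr
    have h2 : κ ≤ b * q ^ 2 / 4 * (1 - l / l₀) := by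
      rw [hκ]
      gcongr
    linarith
  have hexp : ∫ x, ∫ y, lr 1 (pairField β ξ n x) y *
        winMix (pairField β ξ n) (prior P n) (window ξ n m η) (x, y) ^ p
        ∂gaussPi (Pairs n) 1 ∂(prior P n) ≤ Real.exp (M ^ 4 - 2 * (p * κ / 4 * n)) := by
    refine hwin.trans ?_
    have h0 : 0 ≤ ∫ ω, ∫ z, siteMix P ξ (b * q) (s * (√(b * q) * ξ ω) + z) ^ p
        ∂gaussianReal 0 1 ∂P := integral_nonneg fun ω => integral_nonneg fun z =>
      Real.rpow_nonneg (siteMix_pos hξ hr0 _).le _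
    calc _ ≤ Real.exp (p * (β / 2 * (n ^ 2 * η ^ 2 - n ^ 2 * q ^ 2)) +
          p * (1 - p) / 2 * (β / 2 * (n ^ 2 * q ^ 2 + n * M ^ 4))) *
          Real.exp (p * info (scalarField (b * q) ξ) P + C₀ * p ^ 2) ^ n := by gcongr
      _ = Real.exp (p * (β / 2 * (n ^ 2 * η ^ 2 - n ^ 2 * q ^ 2)) +
          p * (1 - p) / 2 * (β / 2 * (n ^ 2 * q ^ 2 + n * M ^ 4)) +
          n * (p * info (scalarField (b * q) ξ) P + C₀ * p ^ 2)) := by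
        rw [← Real.exp_nat_mul, ← Real.exp_add]
      _ ≤ _ := by
        rw [Real.exp_le_exp]
        have e1 : p * (β / 2 * (n ^ 2 * η ^ 2 - n ^ 2 * q ^ 2)) +
          p * (1 - p) / 2 * (β / 2 * (n ^ 2 * q ^ 2 + n * M ^ 4)) =
          p * n * (b * η ^ 2 / 2 - b * q ^ 2 / 4 - p * (b * q ^ 2) / 4) +
            p * (1 - p) * b * M ^ 4 / 4 := by rw [hb]; ring
        have e2 : p * (1 - p) * b * M ^ 4 / 4 ≤ 1 * 1 * 1 * M ^ 4 / 1 := by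
          have : 0 ≤ 1 - p := by linarith
          gcongr
          · linarith
          · norm_num
        have e3 : b * η ^ 2 / 2 ≤ κ / 4 := by
          calc b * η ^ 2 / 2 ≤ 1 * (κ / 2) / 2 := by gcongr
            _ = _ := by ring
        have e4 : 0 ≤ p * (b * q ^ 2) / 4 := by positivity
        have e5 : p * n * (b * η ^ 2 / 2 - b * q ^ 2 / 4 - p * (b * q ^ 2) / 4 +
            info (scalarField (b * q) ξ) P + C₀ * p) ≤ p * n * (-(κ / 2)) := by
          refine mul_le_mul_of_nonneg_left ?_ (by positivity)
          linarith
        rw [e1]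
        linarith
  calc avg P ξ β n ((window ξ n m η).indicator fun _ => 1) ≤ _ := hgi
    _ ≤ Real.exp (p * κ / 4 * n) / 2 * Real.exp (M ^ 4 - 2 * (p * κ / 4 * n)) +
        1 / Real.exp (p * κ / 4 * n) := by gcongr
    _ = _ := by
      have e6 : Real.exp (M ^ 4 - 2 * (p * κ / 4 * n)) = Real.exp (M ^ 4) *
          Real.exp (-(p * κ / 4 * n)) * Real.exp (-(p * κ / 4 * n)) := by
        rw [← Real.exp_add, ← Real.exp_add]; congr 1; ring
      have e7 : Real.exp (p * κ / 4 * n) * Real.exp (-(p * κ / 4 * n)) = 1 := by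
        rw [← Real.exp_add]; simp
      rw [e6, one_div, ← Real.exp_neg]
      linear_combination (Real.exp (M ^ 4) * Real.exp (-(p * κ / 4 * n)) / 2) * e7

/-- Uniform fourth moment bound for the overlap below the threshold. -/
theorem IsSpin.exists_overlapBound (hξ : IsSpin P ξ M) {l l₀ : ℝ}
    (hψ : ∀ r : ℝ, 0 ≤ r → info (scalarField r ξ) P ≤ r ^ 2 / (4 * l₀)) (hl : l < l₀)
    (hl0 : 0 < l) (hl1 : l < 1) : ∃ C : ℝ, 0 ≤ C ∧ OverlapBound P ξ l C := by
  obtain ⟨ε, ls, C₁, hε, hls, hsmall⟩ := hξ.exists_avg_small_le hl0.le hl1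
  obtain ⟨η, α, C₂, hη, hηε, hα, hC₂, hwin⟩ :=
    hξ.exists_avg_window_le hψ hl hl0 hl1.le hls hε (M ^ 2 + ε)
  have hM := hξ.nonneg
  set J : ℤ := ⌈M ^ 2 / η⌉ + 1 with hJ
  set S : Finset ℤ := (Finset.Icc (-J) J).filter fun j : ℤ => ε / 2 ≤ |j * η| ∧ |j * η| ≤ M ^ 2 + ε
    with hS
  set C₃ := M ^ 8 * (S.card * (C₂ * (2 / α ^ 2))) with hC₃
  refine ⟨|C₁| + max |C₁| C₃, by positivity, fun n hn β hβ hnβ => ?_⟩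
  have hn0 : (0 : ℝ) < n := by exact_mod_cast hn
  have ha := hξ.isField_pairField β n
  have hT := hξ.bddMeas_overlap (n := n)
  have hm1 : MeasurableSet {p | |overlap ξ n p| ≤ ε * n} :=
    measurableSet_le hT.1.abs measurable_const
  have hm2 : MeasurableSet {p | ε * n < |overlap ξ n p|} :=
    measurableSet_lt measurable_const hT.1.abs
  obtain ⟨h1, h2⟩ := hsmall n hn β hβ hnβ
  have hsplit : avg P ξ β n (fun p => overlap ξ n p ^ 4) =
      avg P ξ β n ({p | |overlap ξ n p| ≤ ε * n}.indicator fun p => overlap ξ n p ^ 4) +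
      avg P ξ β n ({p | ε * n < |overlap ξ n p|}.indicator fun p => overlap ξ n p ^ 4) := by
    unfold avg
    rw [← gibbs_add _ ha ((hT.pow 4).indicator hm1) ((hT.pow 4).indicator hm2)]
    congr 1
    ext p
    by_cases hp : |overlap ξ n p| ≤ ε * n
    · simp [Set.indicator, hp, not_lt.2 hp]
    · simp [Set.indicator, hp, not_le.1 hp]
  have hlarge : avg P ξ β n ({p | ε * n < |overlap ξ n p|}.indicator fun p => overlap ξ n p ^ 4) ≤
      max |C₁| C₃ * n ^ 2 := by
    rcases le_total (n * β) ls with h | h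
    · refine (h2 h).trans ?_
      gcongr
      exact (le_abs_self _).trans (le_max_left _ _)
    · have hb : ∀ j : ℤ, BddMeas ((window ξ n (j * η) η).indicator fun _ => (1 : ℝ)) := fun j =>
        (BddMeas.const 1).indicator (hξ.measurableSet_window _ _)
      have hcover : ∀ p, ({p | ε * n < |overlap ξ n p|}.indicator fun p => overlap ξ n p ^ 4) p ≤
          (n * M ^ 2) ^ 4 * ∑ j ∈ S, (window ξ n (j * η) η).indicator (fun _ => (1 : ℝ)) p := by
        intro p
        have h0 : ∀ j ∈ S, 0 ≤ (window ξ n (j * η) η).indicator (fun _ => (1 : ℝ)) p := fun j _ =>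
          Set.indicator_nonneg (fun _ _ => zero_le_one) _
        by_cases hp : p ∈ {p | ε * n < |overlap ξ n p|}
        · rw [Set.indicator_of_mem hp]
          have hp' : ε * n < |overlap ξ n p| := hp
          have hTM := hξ.abs_overlap_le p
          set u := overlap ξ n p / n with hu
          have hun : overlap ξ n p = n * u := by rw [hu]; field_simp
          have hu1 : ε < |u| := by
            rw [hun, abs_mul, abs_of_pos hn0, mul_comm] at hp'
            exact lt_of_mul_lt_mul_left hp' hn0.le
          have hu2 : |u| ≤ M ^ 2 := by
            rw [hun, abs_mul, abs_of_pos hn0] at hTM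
            exact le_of_mul_le_mul_left hTM hn0
          set j := ⌊u / η⌋ with hj
          have hj1 : j * η ≤ u := by
            have := Int.floor_le (u / η)
            rwa [le_div_iff₀ hη] at this
          have hj2 : u < j * η + η := by
            have := Int.lt_floor_add_one (u / η)
            rw [div_lt_iff₀ hη] at this
            linarith
          have hclose : |u - j * η| ≤ η := by rw [abs_le]; constructor <;> linarith
          have hjlow : ε / 2 ≤ |j * η| := by
            have := abs_sub_abs_le_abs_sub u (j * η)
            linarith
          have hjup : |j * η| ≤ M ^ 2 + ε := by
            have := abs_sub_abs_le_abs_sub (j * η) u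
            rw [abs_sub_comm] at this
            linarith
          have hjJ : |(j : ℝ)| ≤ J := by
            have h3 : |(j : ℝ)| * η ≤ M ^ 2 + η := by
              have := abs_sub_abs_le_abs_sub (j * η) u
              rw [abs_sub_comm, abs_mul, abs_of_pos hη] at this
              linarith
            have h4 : M ^ 2 / η ≤ ⌈M ^ 2 / η⌉ := Int.le_ceil _
            rw [div_le_iff₀ hη] at h4
            rw [hJ]
            push_cast
            refine le_of_mul_le_mul_right (h3.trans ?_) hη
            linarith
          have hjS : j ∈ S := by
            rw [hS, Finset.mem_filter, Finset.mem_Icc]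
            rw [abs_le] at hjJ
            refine ⟨⟨by exact_mod_cast hjJ.1, by exact_mod_cast hjJ.2⟩, hjlow, hjup⟩
          have hw : p ∈ window ξ n (j * η) η := by
            have : |overlap ξ n p - n * (j * η)| ≤ n * η := by
              rw [hun, ← mul_sub, abs_mul, abs_of_pos hn0]
              gcongr
            exact this
          have h5 := Finset.single_le_sum h0 hjS
          rw [Set.indicator_of_mem hw] at h5
          calc overlap ξ n p ^ 4 = |overlap ξ n p| ^ 4 := by
                rw [← abs_pow, abs_of_nonneg (by positivity : 0 ≤ overlap ξ n p ^ 4)]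
            _ ≤ (n * M ^ 2) ^ 4 * 1 := by
                rw [mul_one]
                exact pow_le_pow_left₀ (abs_nonneg _) hTM 4
            _ ≤ _ := by gcongr
        · rw [Set.indicator_of_notMem hp]
          exact mul_nonneg (by positivity) (Finset.sum_nonneg h0)
      calc _ ≤ avg P ξ β n (fun p => (n * M ^ 2) ^ 4 * ∑ j ∈ S,
            (window ξ n (j * η) η).indicator (fun _ => (1 : ℝ)) p) :=
            gibbs_mono _ ha ((hT.pow 4).indicator hm2)
              ((BddMeas.const _).mul (BddMeas.sum S hb)) hcover
        _ = (n * M ^ 2) ^ 4 * ∑ j ∈ S, avg P ξ β n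
            ((window ξ n (j * η) η).indicator fun _ => 1) := by
            unfold avg
            rw [gibbs_const_mul, gibbs_sum _ S ha hb]
        _ ≤ (n * M ^ 2) ^ 4 * ∑ j ∈ S, C₂ * Real.exp (-(α * n)) := by
            gcongr with j hj
            rw [hS, Finset.mem_filter] at hj
            exact hwin n hn β hβ hnβ h _ hj.2.1 hj.2.2
        _ = M ^ 8 * (S.card * (C₂ * (n ^ 2 * Real.exp (-(α * n))))) * n ^ 2 := by
            rw [Finset.sum_const, nsmul_eq_mul]; ring
        _ ≤ M ^ 8 * (S.card * (C₂ * (2 / α ^ 2))) * n ^ 2 := by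
            gcongr
            have := Real.pow_div_factorial_le_exp (α * n) (by positivity) 2
            rw [Real.exp_neg, ← div_eq_mul_inv, div_le_div_iff₀ (Real.exp_pos _) (by positivity)]
            rw [div_le_iff₀ (by positivity)] at this
            norm_num at this
            linarith
        _ ≤ _ := by
            gcongr
            exact le_max_right _ _
  rw [hsplit, add_mul]
  refine add_le_add (h1.trans ?_) hlarge
  gcongr
  exact le_abs_self _

end Tail
end SpikedWigner



namespace SpikedWigner
open scoped NNReal ENNReal

section Channel
variable {X K : Type*} [MeasurableSpace X] [Fintype K] {a : X → K → ℝ} {A : ℝ}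
variable (ν : Measure X) [IsProbabilityMeasure ν]

/-- The law of the output of a Gaussian channel. -/
theorem map_add_eq_withDensity (ha : IsField a A) :
    (ν.prod (gaussPi K 1)).map (fun w => a w.1 + w.2) =
      (gaussPi K 1).withDensity fun y => ENNReal.ofReal (mix 1 a ν y) := by
  have ham := ha.meas
  have hm : Measurable fun w : X × (K → ℝ) => a w.1 + w.2 := by fun_prop
  ext s hs
  rw [Measure.map_apply hm hs, Measure.prod_apply (hm hs), withDensity_apply _ hs]
  have h1 : ∀ x, gaussPi K 1 (Prod.mk x ⁻¹' ((fun w : X × (K → ℝ) => a w.1 + w.2) ⁻¹' s)) =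
      ∫⁻ y in s, ENNReal.ofReal (lr 1 (a x) y) ∂gaussPi K 1 := fun x => by
    rw [← withDensity_apply _ hs, ← gaussPi_map_add, Measure.map_apply (by fun_prop) hs]
    rfl
  simp only [h1]
  have hl : Measurable fun w : X × (K → ℝ) => ENNReal.ofReal (lr 1 (a w.1) w.2) := by fun_prop
  rw [lintegral_lintegral_swap hl.aemeasurable]
  refine lintegral_congr fun y => ?_
  exact (ofReal_integral_eq_lintegral_ofReal ((ha.expPos_lr 1).growth.integrable_section ν y)
    (ae_of_all _ fun x => (lr_pos _ _ _).le)).symm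

/-- The divergence of the output of a Gaussian channel from pure noise. -/
theorem klDiv_channel (ha : IsField a A) :
    InformationTheory.klDiv ((ν.prod (gaussPi K 1)).map fun w => a w.1 + w.2) (gaussPi K 1) ≠ ⊤ ∧
      (InformationTheory.klDiv ((ν.prod (gaussPi K 1)).map fun w => a w.1 + w.2)
        (gaussPi K 1)).toReal = info a ν := by
  have ham := ha.meas
  have hprob : IsProbabilityMeasure ((ν.prod (gaussPi K 1)).map fun w => a w.1 + w.2) :=
    Measure.isProbabilityMeasure_map (by fun_prop)
  rw [map_add_eq_withDensity ν ha] at hprob ⊢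
  set f : (K → ℝ) → ℝ≥0∞ := fun y => ENNReal.ofReal (mix 1 a ν y) with hf
  have hfm : Measurable f := (expPos_mix ν ha 1).growth.1.ennreal_ofReal
  have hac : (gaussPi K 1).withDensity f ≪ gaussPi K 1 := withDensity_absolutelyContinuous _ _
  have hllr : llr ((gaussPi K 1).withDensity f) (gaussPi K 1)
      =ᵐ[(gaussPi K 1).withDensity f] fun y => Real.log (mix 1 a ν y) := by
    filter_upwards [hac (Measure.rnDeriv_withDensity (gaussPi K 1) hfm)] with y hy
    rw [llr, hy, hf, ENNReal.toReal_ofReal (mix_pos ν ha y).le]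
  have hsmul : (fun y => (f y).toReal • Real.log (mix 1 a ν y)) =
      fun y => mix 1 a ν y * Real.log (mix 1 a ν y) := by
    ext y
    rw [hf, ENNReal.toReal_ofReal (mix_pos ν ha y).le, smul_eq_mul]
  have hfin : ∀ᵐ y ∂gaussPi K 1, f y < ∞ := ae_of_all _ fun _ => ENNReal.ofReal_lt_top
  constructor
  · refine InformationTheory.klDiv_ne_top hac ?_
    rw [integrable_congr hllr, integrable_withDensity_iff_integrable_smul' hfm hfin, hsmul]
    exact integrable_mix_log ν ha
  · rw [InformationTheory.toReal_klDiv_of_measure_eq hac (by simp), integral_congr_ae hllr,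
      integral_withDensity_eq_integral_toReal_smul hfm hfin, hsmul]
    rfl

end Channel

section Clip
variable {P : Measure ℝ} [IsProbabilityMeasure P] {ξ : ℝ → ℝ} {M r : ℝ}

theorem exists_isSpin_ae_eq_id (hbounded : ∃ M : ℝ, ∀ᵐ x ∂P, |x| ≤ M)
    (hcentered : ∫ x, x ∂P = 0) (hvariance : Var[id; P] = 1) :
    ∃ ξ M, IsSpin P ξ M ∧ ∀ᵐ x ∂P, ξ x = x := by
  obtain ⟨M, hM⟩ := hbounded
  have hM1 : 1 ≤ max M 1 := le_max_right _ _
  have hae : ∀ᵐ x ∂P, max (-max M 1) (min x (max M 1)) = x := by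
    filter_upwards [hM] with x hx
    have := abs_le.1 (hx.trans (le_max_left M 1))
    rw [min_eq_left this.2, max_eq_right this.1]
  refine ⟨fun x => max (-max M 1) (min x (max M 1)), max M 1, ⟨by fun_prop, hM1, fun x => ?_, ?_, ?_⟩,
    hae⟩
  · exact abs_le.2 ⟨le_max_left _ _, max_le (by linarith) (min_le_right _ _)⟩
  · rw [integral_congr_ae hae, hcentered]
  · rw [variance_of_integral_eq_zero measurable_id.aemeasurable (by simpa using hcentered)]
      at hvariance
    refine Eq.trans (integral_congr_ae ?_) hvariance
    filter_upwards [hae] with x hx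
    simp [hx]

theorem psi_eq_info (hξ : IsSpin P ξ M) (hae : ∀ᵐ x ∂P, ξ x = x) (hr : 0 ≤ r) :
    psi P r = info (scalarField r ξ) P := by
  rw [info_scalarField hξ hr, psi]
  refine integral_congr_ae ?_
  filter_upwards [Measure.quasiMeasurePreserving_fst.ae hae] with w hw
  congr 1
  refine integral_congr_ae ?_
  filter_upwards [hae] with x hx
  rw [hx, hw]
  congr 1
  calc _ = √r * w.2 * x + √r * √r * x * w.1 - r / 2 * x ^ 2 := by rw [Real.mul_self_sqrt hr]
    _ = _ := by ring

theorem law_eq_map (hae : ∀ᵐ x ∂P, ξ x = x) (lam : ℝ) (N : ℕ) :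
    law P lam N = ((prior P N).prod (gaussPi (Pairs N) 1)).map
      fun w => pairField (lam / N) ξ N w.1 + w.2 := by
  refine Measure.map_congr ?_
  have h : ∀ᵐ x ∂prior P N, ∀ i, ξ (x i) = x i := by
    rw [ae_all_iff]
    intro i
    exact (Measure.tendsto_eval_ae_ae (μ := fun _ : Fin N => P) (i := i)).eventually hae
  filter_upwards [Measure.quasiMeasurePreserving_fst.ae h] with w hw
  ext p
  simp [observation, pairField, hw]

theorem law_zero (N : ℕ) : law P 0 N = gaussPi (Pairs N) 1 := by
  have : (fun xW : (Fin N → ℝ) × (Pairs N → ℝ) => observation 0 N xW.1 xW.2) = Prod.snd := by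
    ext w p
    simp [observation]
  rw [law, this, Measure.map_snd_prod]
  simp [gaussPi]

theorem klDiv_law (hξ : IsSpin P ξ M) (hae : ∀ᵐ x ∂P, ξ x = x) (lam : ℝ) (N : ℕ) :
    InformationTheory.klDiv (law P lam N) (law P 0 N) ≠ ⊤ ∧
      (InformationTheory.klDiv (law P lam N) (law P 0 N)).toReal =
        info (pairField (lam / N) ξ N) (prior P N) := by
  rw [law_zero, law_eq_map hae]
  exact klDiv_channel (prior P N) (hξ.isField_pairField (lam / N) N)

theorem IsOptimalOverlap.psi_le {l₀ : ℝ} (h : IsOptimalOverlap P l₀ 0) (h0 : 0 < l₀)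
    (hr : 0 ≤ r) : psi P r ≤ r ^ 2 / (4 * l₀) := by
  have hz : psi P 0 = 0 := by simp [psi]
  rcases hr.eq_or_lt with rfl | hr
  · simp [hz]
  · have := h.2 (r / l₀) (by positivity) (by positivity)
    rw [rsPotential, rsPotential, mul_div_cancel₀ _ h0.ne'] at this
    simp only [mul_zero, hz] at this
    have h2 : l₀ * (r / l₀) ^ 2 / 4 = r ^ 2 / (4 * l₀) := by field_simp
    rw [h2] at this
    norm_num at this
    exact this.le

end Clip

section Threshold
variable {Ω : Type*} [MeasurableSpace Ω] {P : Measure Ω} [IsProbabilityMeasure P] {ξ : Ω → ℝ} {M : ℝ}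

/-- The scalar channel at low signal-to-noise ratio. -/
theorem IsSpin.info_scalarField_ge (hξ : IsSpin P ξ M) {r : ℝ} (hr : 0 < r) (hr1 : r ≤ 1) :
    r ^ 2 / 4 - 200 * colConst M 1 * (√r * r ^ 2) ≤ info (scalarField r ξ) P := by
  have hv : IsField (fun (_ : Unit) (_ : Unit) => √r) 1 :=
    ⟨measurable_const, zero_le_one, fun _ => by simpa [Real.sq_sqrt hr.le] using hr1⟩
  have hs : 0 < √r := Real.sqrt_pos.2 hr
  have hk := column_kl (Measure.dirac ()) hξ hv hs (by simpa using hr1)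
  have hcol : col P ξ (fun (_ : Unit) (_ : Unit) => √r) (Measure.dirac ()) =
      mix 1 (scalarField r ξ) P := by
    ext y
    have hm := hξ.meas
    rw [col, mix, Measure.dirac_prod, integral_map (by fun_prop)]
    · refine integral_congr_ae (ae_of_all _ fun ω => ?_)
      simp only [colField, lr, scalarField]
      simp [mul_comm]
    · unfold colField
      exact (Measurable.aestronglyMeasurable (by fun_prop))
  have hg : ∀ k, gramMoment (fun (_ : Unit) (_ : Unit) => √r) (Measure.dirac ()) k = r ^ k := by
    intro k
    simp [gramMoment, gram, Real.mul_self_sqrt hr.le, abs_of_pos hr]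
  rw [hcol, hg, hg] at hk
  have h3 : r ^ 3 / √r = √r * r ^ 2 := by
    rw [div_eq_iff hs.ne']
    calc r ^ 3 = r * r ^ 2 := by ring
      _ = √r * √r * r ^ 2 := by rw [Real.mul_self_sqrt hr.le]
      _ = _ := by ring
  rw [h3] at hk
  have := (abs_le.1 hk).1
  unfold info
  linarith

theorem IsSpin.le_one_of_info_le (hξ : IsSpin P ξ M) {l₀ : ℝ} (h0 : 0 < l₀)
    (hψ : ∀ r, 0 ≤ r → info (scalarField r ξ) P ≤ r ^ 2 / (4 * l₀)) : l₀ ≤ 1 := by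
  have hlim : Tendsto (fun r : ℝ => 1 / 4 - 200 * colConst M 1 * √r) (𝓝[>] 0) (𝓝 (1 / 4)) := by
    have : Continuous fun r : ℝ => 1 / 4 - 200 * colConst M 1 * √r := by fun_prop
    have := this.tendsto 0
    simp only [Real.sqrt_zero, mul_zero, sub_zero] at this
    exact this.mono_left nhdsWithin_le_nhds
  have hle : (1 : ℝ) / 4 ≤ 1 / (4 * l₀) := by
    refine le_of_tendsto hlim ?_
    filter_upwards [Ioc_mem_nhdsGT (zero_lt_one' ℝ)] with r hr
    have h := (hξ.info_scalarField_ge hr.1 hr.2).trans (hψ r hr.1.le)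
    have hr2 : 0 < r ^ 2 := pow_pos hr.1 2
    refine le_of_mul_le_mul_left ?_ hr2
    calc _ = r ^ 2 / 4 - 200 * colConst M 1 * (√r * r ^ 2) := by ring
      _ ≤ _ := h
      _ = _ := by ring
  rw [div_le_div_iff₀ (by norm_num) (by positivity)] at hle
  linarith

end Threshold
end SpikedWigner

theorem mainTheorem8 (P : Measure ℝ) [IsProbabilityMeasure P]
    (hbounded : ∃ M : ℝ, ∀ᵐ x ∂P, |x| ≤ M)
    (hcentered : ∫ x, x ∂P = 0)
    (hvariance : Var[id; P] = 1)
    (lam : ℝ) (hlam : 0 ≤ lam)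
    (hsub : (lam : EReal) < SpikedWigner.reconstructionThreshold P) :
    (∀ N : ℕ, InformationTheory.klDiv (SpikedWigner.law P lam N) (SpikedWigner.law P 0 N) ≠ ⊤) ∧
    Tendsto
      (fun N : ℕ =>
        (InformationTheory.klDiv (SpikedWigner.law P lam N) (SpikedWigner.law P 0 N)).toReal)
      atTop (𝓝 (1 / 4 * (-Real.log (1 - lam) - lam))) := by
  obtain ⟨ξ, M, hξ, hae⟩ := SpikedWigner.exists_isSpin_ae_eq_id hbounded hcentered hvariance
  refine ⟨fun N => (SpikedWigner.klDiv_law hξ hae lam N).1, ?_⟩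
  rcases hlam.eq_or_lt with rfl | hpos
  · have : SpikedWigner.law P 0 = fun N => SpikedWigner.gaussPi _ 1 :=
      funext SpikedWigner.law_zero
    simp [this, InformationTheory.klDiv_self]
  simp only [fun N => (SpikedWigner.klDiv_law hξ hae lam N).2]
  obtain ⟨_, ⟨l₀, ⟨h0, hopt⟩, rfl⟩, hlt⟩ := lt_sSup_iff.1 hsub
  have hlt : lam < l₀ := EReal.coe_lt_coe_iff.1 hlt
  have hψ : ∀ r, 0 ≤ r →
      SpikedWigner.info (SpikedWigner.scalarField r ξ) P ≤ r ^ 2 / (4 * l₀) := fun r hr =>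
    (SpikedWigner.psi_eq_info hξ hae hr).symm.trans_le (hopt.psi_le h0 hr)
  have hl1 : lam < 1 := hlt.trans_le (hξ.le_one_of_info_le h0 hψ)
  obtain ⟨C, hC, hO⟩ := hξ.exists_overlapBound hψ hlt hpos hl1
  exact hO.tendsto_info hξ hpos hl1 hC
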